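/- Let $K$ be a number field with ring of integers $\mathcal O_K$, let $\mathfrak I(K)$ be the set of nonzero ideals of $\mathcal O_K$, and let $\mathcal N(\mathfrak u)=[\mathcal O_K:\mathfrak u]$. Let $g\colon\mathfrak I(K)\to\mathbb C$ be multiplicative, i.e. $g(\mathfrak u\mathfrak v)=g(\mathfrak u)g(\mathfrak v)$ whenever $\mathfrak u+\mathfrak v=(1)$, with $|g|\le 1$, and for $\operatorname{Re}s>1$ put $G(s)=\sum_{\mathfrak u\in\mathfrak I(K)}g(\mathfrak u)\mathcal N(\mathfrak u)^{-s}$. Let $C\in\mathbb C$ (for example $C>0$ or $C=0$), let $\alpha\in\mathbb R$, and let $L\colon\mathbb R\to\mathbb C$ be a function with $|L|=1$ that is slowly oscillating, i.e. $\lim_{x\to\infty}L(ux)/L(x)=1$ for every $u>0$. Then $$\sum_{\mathcal N(\mathfrak u)\le x}g(\mathfrak u)=\frac{x^{1+i\alpha}}{1+i\alpha}\,C\,L(\log x)+o(x)\qquad(x\to\infty)$$ if and only if, writing $s=\sigma+i\tau$, $$G(s)=\frac{C}{s-(1+i\alpha)}\,L\!\left(\frac1{\sigma-1}\right)+o\!\left(\frac1{\sigma-1}\right)\qquad(\sigma\to1^+),$$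 uniformly for $\tau$ in each bounded interval $-M\le\tau\le M$. -/

import Mathlib

open scoped nonZeroDivisors NumberField

noncomputable section

namespace IdealFunction

variable {K : Type*} [Field K] [NumberField K]

/-- The norm `𝒩(𝔲) = [𝓞 K : 𝔲]` of a nonzero ideal `𝔲` of the ring of integers. -/
def norm (u : (Ideal (𝓞 K))⁰) : ℕ := Ideal.absNorm (u : Ideal (𝓞 K))

/-- A function on the nonzero ideals of `𝓞 K` is multiplicative if `g (𝔲 𝔳) = g 𝔲 * g 𝔳` for all
coprime ideals `𝔲`, `𝔳`, that is, whenever `𝔲 + 𝔳 = (1)`. -/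
def IsMultiplicative (g : (Ideal (𝓞 K))⁰ → ℂ) : Prop :=
  ∀ u v : (Ideal (𝓞 K))⁰, IsCoprime (u : Ideal (𝓞 K)) (v : Ideal (𝓞 K)) → g (u * v) = g u * g v

/-- There are finitely many nonzero ideals of norm at most `x`. -/
theorem finite_norm_le (K : Type*) [Field K] [NumberField K] (x : ℝ) :
    {u : (Ideal (𝓞 K))⁰ | (norm u : ℝ) ≤ x}.Finite :=
  (Ideal.finite_setOfPred_absNorm_le₀ (S := 𝓞 K) ⌊x⌋₊).subset fun _ hu => Nat.le_floor hu

/-- The summatory function `H(x) = ∑_{𝒩(𝔲) ≤ x} g(𝔲)`. -/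
def summatory (g : (Ideal (𝓞 K))⁰ → ℂ) (x : ℝ) : ℂ :=
  ∑ u ∈ (finite_norm_le K x).toFinset, g u

/-- The Dirichlet series `G(s) = ∑_𝔲 g(𝔲) 𝒩(𝔲)^{-s}` over the nonzero ideals. -/
def dirichletSeries (g : (Ideal (𝓞 K))⁰ → ℂ) (s : ℂ) : ℂ :=
  ∑' u : (Ideal (𝓞 K))⁰, g u * (norm u : ℂ) ^ (-s)

/-- If `|g| ≤ 1`, the Dirichlet series of `g` converges absolutely in the half-plane `Re s > 1`. -/
theorem summable_dirichletSeries {g : (Ideal (𝓞 K))⁰ → ℂ} (hg : ∀ u, ‖g u‖ ≤ 1)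
    {s : ℂ} (hs : 1 < s.re) : Summable fun u : (Ideal (𝓞 K))⁰ => g u * (norm u : ℂ) ^ (-s) := by
  set S : ℕ → Set (Ideal (𝓞 K))⁰ := fun n => {u | norm u ≤ n} with hS
  have hfin : ∀ n, (S n).Finite := fun n => Ideal.finite_setOfPred_absNorm_le₀ (S := 𝓞 K) n
  have hpos : ∀ u : (Ideal (𝓞 K))⁰, 1 ≤ norm u := fun u => Nat.one_le_iff_ne_zero.mpr
    (Ideal.absNorm_ne_zero_iff_mem_nonZeroDivisors.mpr u.2)
  classical
  let a : ℕ → ℝ := fun n => (((hfin n).toFinset.filter fun u => norm u = n).card : ℝ)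
  have hsum : ∀ n, ∑ k ∈ Finset.Icc 1 n, a k = ((hfin n).toFinset.card : ℝ) := by
    intro n
    have h : ((hfin n).toFinset : Set (Ideal (𝓞 K))⁰).MapsTo norm (Finset.Icc 1 n) := by
      intro u hu
      simp only [Set.Finite.coe_toFinset, hS, Set.mem_ofPred_eq] at hu
      simpa using ⟨hpos u, hu⟩
    rw [Finset.card_eq_sum_card_fiberwise h, Nat.cast_sum]
    refine Finset.sum_congr rfl fun k hk => ?_
    refine congrArg (fun t : Finset (Ideal (𝓞 K))⁰ => (t.card : ℝ)) (Finset.ext fun u => ?_)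
    have := (Finset.mem_Icc.mp hk).2
    simp only [Finset.mem_filter, Set.Finite.mem_toFinset, hS, Set.mem_ofPred_eq]
    omega
  have hO : (fun n => ∑ k ∈ Finset.Icc 1 n, a k) =O[Filter.atTop] fun n => (n : ℝ) ^ (1 : ℝ) := by
    have h := ((NumberField.Ideal.tendsto_norm_le_div_atTop₀ K).comp
      tendsto_natCast_atTop_atTop).isBigO_one ℝ
    have h2 := h.mul (Asymptotics.isBigO_refl (fun n : ℕ => (n : ℝ)) Filter.atTop)
    refine h2.congr' ?_ (Filter.Eventually.of_forall fun n => by simp)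
    filter_upwards [Filter.eventually_ne_atTop 0] with n hn
    have hn' : (n : ℝ) ≠ 0 := Nat.cast_ne_zero.mpr hn
    rw [hsum, Function.comp_apply, div_mul_cancel₀ _ hn']
    rw [← Nat.card_eq_card_finite_toFinset (hfin n)]
    simp only [Nat.cast_le]
    rfl
  have hA := (LSeriesSummable_of_sum_norm_bigO_and_nonneg (f := a) hO
    (fun n => Nat.cast_nonneg _) zero_le_one hs).norm
  refine Summable.of_norm (summable_of_sum_le (c := ∑' n, ‖LSeries.term (fun n => (a n : ℂ)) s n‖)
    (fun u => norm_nonneg _) fun T => ?_)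
  calc ∑ u ∈ T, ‖g u * (norm u : ℂ) ^ (-s)‖
      ≤ ∑ u ∈ T, (norm u : ℝ) ^ (-s.re) := by
        refine Finset.sum_le_sum fun u _ => ?_
        rw [norm_mul, Complex.norm_natCast_cpow_of_pos (hpos u), Complex.neg_re]
        exact mul_le_of_le_one_left (by positivity) (hg u)
    _ = ∑ n ∈ T.image norm, ∑ u ∈ T with norm u = n, (norm u : ℝ) ^ (-s.re) :=
        (Finset.sum_fiberwise_of_maps_to (fun u hu => Finset.mem_image_of_mem _ hu) _).symm
    _ ≤ ∑ n ∈ T.image norm, ‖LSeries.term (fun n => (a n : ℂ)) s n‖ := by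
        refine Finset.sum_le_sum fun n hn => ?_
        obtain ⟨u₀, -, rfl⟩ := Finset.mem_image.mp hn
        have hne : norm u₀ ≠ 0 := Nat.one_le_iff_ne_zero.mp (hpos u₀)
        rw [LSeries.norm_term_eq, if_neg hne, Complex.norm_of_nonneg (Nat.cast_nonneg _),
          Finset.sum_congr rfl (g := fun _ => (norm u₀ : ℝ) ^ (-s.re))
            fun u hu => by rw [(Finset.mem_filter.mp hu).2],
          Finset.sum_const, nsmul_eq_mul, Real.rpow_neg (Nat.cast_nonneg _), ← div_eq_mul_inv]
        refine div_le_div_of_nonneg_right (Nat.cast_le.mpr (Finset.card_le_card fun u hu => ?_))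
          (by positivity)
        have := (Finset.mem_filter.mp hu).2
        simp [hS, this]
    _ ≤ _ := hA.sum_le_tsum _ fun _ _ => norm_nonneg _

end IdealFunction

/-- A function `L : ℝ → ℂ` is slowly oscillating if `L (u x) / L x → 1` as `x → ∞`, for each
fixed `u > 0`. -/
def SlowlyOscillating (L : ℝ → ℂ) : Prop :=
  ∀ u : ℝ, 0 < u → Filter.Tendsto (fun x : ℝ => L (u * x) / L x) Filter.atTop (nhds 1)

end

/-!
For a bounded multiplicative function `g` on ideals, the behaviour of its summatory function and the
behaviour of its Dirichlet series near the line `Re s = 1` determine each other. With `u = log x`,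
`y = 1 / (σ - 1)`, `β = 1 + iα` and `c(y) = C L(y) / β`, the claim is that the normalized sums
`ψ(u) = e^{-βu} ∑_{log 𝒩(𝔲) ≤ u} g(𝔲)` satisfy `ψ(y) - c(y) → 0` if and only if
`G(s) = C L(y) / (s - β) + o(y)` at `s = 1 + 1/y + iτ`, uniformly for bounded `τ`. Both directions
are proved for general Dirichlet series `∑ g i e^{-s ℓ i}`, under the hypotheses collected in
`GeneralDirichlet.LogConvolution`.

*From sums to series* (`LogConvolution.seriesAsymptotic_of_tendsto`). `G(s) / s` is the Laplace
transform of the partial sums. After subtracting the main term and rescaling `u = y v`, the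
error is at most `y ∫ e^{-v} |ψ(yv) - c(y)| dv`, and the integral tends to zero by dominated
convergence, as `L(yv) / L(y) → 1` for every `v > 0`.

*From series to sums* (`LogConvolution.tendsto_normalized_sub`). This is Halász's method. The
function `D = -G' = ∑ g i ℓ i e^{-s ℓ i}` satisfies `D = G S + E`, where for ideals `S` is a sum
over the primes and the coefficients of `E` live on the ideals divisible by the square of a prime.

* Plancherel's theorem turns bounds for partial sums (Chebyshev's bound in the case of `S`) into
  mean square bounds for `S`, `E` and `D` on vertical lines. They show that `D(s) / s`, minus the
  transform of its main term, has mean square `o(y³)` on `Re s = 1 + 1/y`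
  (`eventually_lintegral_errorTransform_le`). For `τ` within a multiple of `1/y` of `α`, a finite
  difference in the real direction transfers the hypothesis from `G` to `D` (`eventually_near`). For
  the other bounded `τ`, the hypothesis makes `G` small compared with `y`, and `D = G S + E` is
  small in mean square (`setLIntegral_mid`). Large `τ` are harmless because of the factor `1 / s`,
  since the mean square of `D` over unit intervals is `O(y³)` uniformly in their position
  (`exists_far`).
* By Plancherel's theorem again, and partial summation, `|ψ(u) - c(y)|` has mean `o(1)` over
  `0 ≤ u ≤ 2y` (`eventually_integral_deviation_le`).
* The convolution identity for partial sums expresses `u ψ(u)` through the values `ψ(u - ℓ i)` with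
  weights `b i e^{-β ℓ i}`. Replace each of these values by `c(y)`. The cost, averaged over a short
  interval of `u`, is bounded by a multiple of the integral of `|ψ - c(y)|` over `[0, 2y]`, because
  by Chebyshev's bound the weights with `ℓ i` in a short interval have bounded sum. As `ψ` itself
  varies little over short intervals, the average may be undone, and `u ψ(u) = c(y) W(u) + o(y)`
  uniformly for `y/2 ≤ u ≤ y`, where `W(u)` is the sum of the weights with `ℓ i ≤ u`
  (`eventually_norm_mul_normalized_sub_le`). Now `W` is Lipschitz at scales above `1`, so `ψ` is
  nearly constant on `[(1 - δ) y, y]`, and there it must agree with its mean value `c(y)`.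

The hypotheses of `LogConvolution` are verified for ideals in `IdealFunction.exists_logConvolution`:
the ideal counting function has a density, the norms of prime ideals satisfy Chebyshev's bound
because the primes above `p` divide `(p)`, and multiplicativity together with
`log 𝒩(𝔲) = ∑_{P ^ j ∣ 𝔲} log 𝒩(P)` gives the convolution identity.
-/

/-! ### Plancherel's theorem and Laplace transforms -/

open MeasureTheory in
open scoped FourierTransform ContDiff in
/-- On `L¹ ∩ L²` the Fourier transform of `L²` functions is given by the Fourier integral. -/
theorem MeasureTheory.MemLp.fourier_toLp_ae_eq {f : ℝ → ℂ} (hf : Integrable f) (hf2 : MemLp f 2) :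
    (𝓕 (hf2.toLp f) : Lp ℂ 2) =ᵐ[volume] 𝓕 f := by
  have hcont : Continuous (𝓕 f) := by
    refine VectorFourier.fourierIntegral_continuous Real.continuous_fourierChar ?_ hf
    exact continuous_inner
  refine ae_eq_of_integral_contDiff_smul_eq
    ((Lp.memLp _).locallyIntegrable (by norm_num)) hcont.locallyIntegrable ?_
  intro φ hφ hφc
  have h1 : HasCompactSupport (Complex.ofRealCLM ∘ φ) := hφc.comp_left rfl
  have h2 : ContDiff ℝ ∞ (Complex.ofRealCLM ∘ φ) := by fun_prop
  set Φ := h1.toSchwartzMap h2 with hΦ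
  have h3 := DFunLike.congr_fun (Lp.fourier_toTemperedDistribution_eq (hf2.toLp f)) Φ
  rw [TemperedDistribution.fourier_apply, Lp.toTemperedDistribution_apply,
    Lp.toTemperedDistribution_apply] at h3
  have h4 : ∫ x, (𝓕 Φ) x • (hf2.toLp f) x = ∫ x, (𝓕 Φ) x • f x := by
    refine integral_congr_ae ?_
    filter_upwards [hf2.coeFn_toLp] with x hx
    rw [hx]
  have h5 : ∫ x, (𝓕 (Φ : ℝ → ℂ)) x • f x = ∫ x, (Φ : ℝ → ℂ) x • (𝓕 f) x := by
    simpa using! (VectorFourier.integral_fourierIntegral_smul_eq_flip (L := innerₗ ℝ)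
      Real.continuous_fourierChar continuous_inner Φ.integrable hf)
  rw [h4, SchwartzMap.fourier_coe, h5] at h3
  have h6 : ∀ x, Φ x = (φ x : ℂ) := fun x => rfl
  simp only [h6] at h3
  simpa using h3.symm

open MeasureTheory in
open scoped FourierTransform in
/-- **Plancherel's theorem** for `L¹ ∩ L²`, in terms of the angular frequency. -/
theorem lintegral_enorm_sq_integral_mul_exp {f : ℝ → ℂ} (hf : Integrable f) (hf2 : MemLp f 2) :
    ∫⁻ τ : ℝ, ‖∫ u : ℝ, f u * Complex.exp (-(Complex.I * τ * u))‖ₑ ^ 2 =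
      ENNReal.ofReal (2 * Real.pi) * ∫⁻ u, ‖f u‖ₑ ^ 2 := by
  have h0 : eLpNorm (𝓕 f) 2 = eLpNorm f 2 := by
    have h := Lp.norm_fourier_eq (hf2.toLp f)
    rw [Lp.norm_def, Lp.norm_def, ENNReal.toReal_eq_toReal_iff' (Lp.eLpNorm_ne_top _)
      (Lp.eLpNorm_ne_top _), eLpNorm_congr_ae hf2.coeFn_toLp,
      eLpNorm_congr_ae (MemLp.fourier_toLp_ae_eq hf hf2)] at h
    exact h
  have h1 : ∫⁻ x, ‖𝓕 f x‖ₑ ^ 2 = ∫⁻ u, ‖f u‖ₑ ^ 2 := by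
    have e : ∀ k : ℝ → ℂ, ∫⁻ x, ‖k x‖ₑ ^ 2 = eLpNorm k 2 ^ 2 := by
      intro k
      have := eLpNorm_nnreal_pow_eq_lintegral (f := k) (p := 2) (μ := volume) (by norm_num)
      simpa using this.symm
    rw [e, e, h0]
  have h2 : ∀ τ : ℝ, ∫ u : ℝ, f u * Complex.exp (-(Complex.I * τ * u)) =
      𝓕 f ((2 * Real.pi)⁻¹ * τ) := by
    intro τ
    rw [Real.fourier_real_eq_integral_exp_smul]
    refine integral_congr_ae (Filter.Eventually.of_forall fun u => ?_)
    simp only [smul_eq_mul]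
    rw [mul_comm]
    congr 2
    have : (Real.pi : ℂ) ≠ 0 := by exact_mod_cast Real.pi_ne_zero
    push_cast
    field_simp
  simp only [h2]
  have hpi : (0 : ℝ) < 2 * Real.pi := by positivity
  have hcont : Continuous (𝓕 f) :=
    VectorFourier.fourierIntegral_continuous Real.continuous_fourierChar continuous_inner hf
  have h3 : ∫⁻ x, ‖𝓕 f x‖ₑ ^ 2 ∂(Measure.map (fun x : ℝ => (2 * Real.pi)⁻¹ * x) volume) =
      ∫⁻ τ : ℝ, ‖𝓕 f ((2 * Real.pi)⁻¹ * τ)‖ₑ ^ 2 :=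
    lintegral_map (by fun_prop) (by fun_prop)
  rw [← h3, Real.map_volume_mul_left (by positivity), lintegral_smul_measure, h1, inv_inv,
    abs_of_pos hpi, smul_eq_mul]

/-- The two-sided Laplace transform `∫ f(u) e^{-su} du`; it is applied to functions that vanish on
the negative half-line. -/
noncomputable def laplace (f : ℝ → ℂ) (s : ℂ) : ℂ := ∫ u : ℝ, f u * Complex.exp (-(s * u))

namespace laplace

open MeasureTheory

variable {f : ℝ → ℂ} {B ρ σ : ℝ}

theorem integrable_exp_indicator {ε : ℝ} (hε : 0 < ε) (B : ℝ) :
    Integrable ((Set.Ici (0 : ℝ)).indicator fun u => B * Real.exp (-ε * u)) := by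
  rw [integrable_indicator_iff measurableSet_Ici, integrableOn_Ici_iff_integrableOn_Ioi]
  exact (exp_neg_integrableOn_Ioi 0 hε).const_mul B

theorem integral_exp_indicator {ε : ℝ} (hε : 0 < ε) (B : ℝ) :
    ∫ u, (Set.Ici (0 : ℝ)).indicator (fun u => B * Real.exp (-ε * u)) u = B / ε := by
  rw [integral_indicator measurableSet_Ici, integral_Ici_eq_integral_Ioi, integral_const_mul,
    integral_exp_mul_Ioi (by linarith)]
  simp [div_eq_mul_inv]

theorem norm_exp_neg (s : ℂ) (u : ℝ) : ‖Complex.exp (-(s * u))‖ = Real.exp (-(s.re * u)) := by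
  simp [Complex.norm_exp]

theorem norm_mul_exp_le (h0 : ∀ u < 0, f u = 0)
    (hb : ∀ u, 0 ≤ u → ‖f u‖ ≤ B * Real.exp (ρ * u)) (s : ℂ) (u : ℝ) :
    ‖f u * Complex.exp (-(s * u))‖ ≤
      (Set.Ici (0 : ℝ)).indicator (fun u => B * Real.exp (-(s.re - ρ) * u)) u := by
  rcases lt_or_ge u 0 with hu | hu
  · simp [h0 u hu, hu]
  · rw [Set.indicator_of_mem (Set.mem_Ici.mpr hu), norm_mul, norm_exp_neg]
    refine (mul_le_mul_of_nonneg_right (hb u hu) (Real.exp_nonneg _)).trans_eq ?_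
    rw [mul_assoc, ← Real.exp_add]
    ring_nf

theorem integrable (hf : Measurable f) (h0 : ∀ u < 0, f u = 0)
    (hb : ∀ u, 0 ≤ u → ‖f u‖ ≤ B * Real.exp (ρ * u)) {s : ℂ} (hs : ρ < s.re) :
    Integrable fun u : ℝ => f u * Complex.exp (-(s * u)) := by
  refine (integrable_exp_indicator (sub_pos.mpr hs) B).mono' ?_
    (Filter.Eventually.of_forall (norm_mul_exp_le h0 hb s))
  exact (hf.mul (by fun_prop)).aestronglyMeasurable

theorem norm_le (h0 : ∀ u < 0, f u = 0)
    (hb : ∀ u, 0 ≤ u → ‖f u‖ ≤ B * Real.exp (ρ * u)) {s : ℂ} (hs : ρ < s.re) :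
    ‖laplace f s‖ ≤ B / (s.re - ρ) := by
  rw [← integral_exp_indicator (sub_pos.mpr hs) B]
  exact norm_integral_le_of_norm_le (integrable_exp_indicator (sub_pos.mpr hs) B)
    (Filter.Eventually.of_forall (norm_mul_exp_le h0 hb s))

theorem sq_norm_mul_exp_le (h0 : ∀ u < 0, f u = 0)
    (hb : ∀ u, 0 ≤ u → ‖f u‖ ≤ B * Real.exp (ρ * u)) (s : ℂ) (u : ℝ) :
    ‖f u * Complex.exp (-(s * u))‖ ^ 2 ≤
      (Set.Ici (0 : ℝ)).indicator (fun u => B ^ 2 * Real.exp (-(2 * (s.re - ρ)) * u)) u := by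
  refine (pow_le_pow_left₀ (norm_nonneg _) (norm_mul_exp_le h0 hb s u) 2).trans_eq ?_
  by_cases hu : u ∈ Set.Ici (0 : ℝ)
  · rw [Set.indicator_of_mem hu, Set.indicator_of_mem hu, mul_pow, ← Real.exp_nat_mul]
    congr 2
    push_cast
    ring
  · simp [Set.indicator_of_notMem hu]

theorem memLp (hf : Measurable f) (h0 : ∀ u < 0, f u = 0)
    (hb : ∀ u, 0 ≤ u → ‖f u‖ ≤ B * Real.exp (ρ * u)) {s : ℂ} (hs : ρ < s.re) :
    MemLp (fun u : ℝ => f u * Complex.exp (-(s * u))) 2 := by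
  have hm : AEStronglyMeasurable (fun u : ℝ => f u * Complex.exp (-(s * u))) volume :=
    (hf.mul (by fun_prop)).aestronglyMeasurable
  refine (memLp_two_iff_integrable_sq_norm hm).mpr ?_
  refine (integrable_exp_indicator (ε := 2 * (s.re - ρ)) (by linarith) (B ^ 2)).mono'
    (hm.norm.pow 2) (Filter.Eventually.of_forall fun u => ?_)
  rw [Real.norm_of_nonneg (by positivity)]
  exact sq_norm_mul_exp_le h0 hb s u

/-- **Plancherel's theorem** on the vertical line `Re s = σ`. -/
theorem lintegral_enorm_sq (hf : Measurable f) (h0 : ∀ u < 0, f u = 0)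
    (hb : ∀ u, 0 ≤ u → ‖f u‖ ≤ B * Real.exp (ρ * u)) (hσ : ρ < σ) :
    ∫⁻ τ : ℝ, ‖laplace f (σ + Complex.I * τ)‖ₑ ^ 2 =
      ENNReal.ofReal (2 * Real.pi) * ∫⁻ u : ℝ, ‖f u * Complex.exp (-((σ : ℂ) * u))‖ₑ ^ 2 := by
  have hσ' : ρ < (σ : ℂ).re := by simpa using hσ
  rw [← lintegral_enorm_sq_integral_mul_exp (integrable hf h0 hb hσ') (memLp hf h0 hb hσ')]
  refine lintegral_congr fun τ => ?_
  congr 2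
  refine integral_congr_ae (Filter.Eventually.of_forall fun u => ?_)
  simp only
  rw [mul_assoc, ← Complex.exp_add]
  ring_nf

theorem lintegral_enorm_sq_le (hf : Measurable f) (h0 : ∀ u < 0, f u = 0)
    (hb : ∀ u, 0 ≤ u → ‖f u‖ ≤ B * Real.exp (ρ * u)) (hσ : ρ < σ) :
    ∫⁻ τ : ℝ, ‖laplace f (σ + Complex.I * τ)‖ₑ ^ 2 ≤
      ENNReal.ofReal (Real.pi * B ^ 2 / (σ - ρ)) := by
  rw [lintegral_enorm_sq hf h0 hb hσ]
  have h1 : ∫⁻ u : ℝ, ‖f u * Complex.exp (-((σ : ℂ) * u))‖ₑ ^ 2 ≤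
      ENNReal.ofReal (B ^ 2 / (2 * (σ - ρ))) := by
    have hpos : 0 < 2 * (σ - ρ) := by linarith
    rw [← integral_exp_indicator hpos, ofReal_integral_eq_lintegral_ofReal
      (integrable_exp_indicator hpos _) (Filter.Eventually.of_forall fun u =>
        Set.indicator_nonneg (fun _ _ => by positivity) u)]
    refine lintegral_mono fun u => ?_
    rw [← ofReal_norm, ← ENNReal.ofReal_pow (norm_nonneg _)]
    exact ENNReal.ofReal_le_ofReal (by simpa using sq_norm_mul_exp_le h0 hb (σ : ℂ) u)
  refine (mul_le_mul_right h1 _).trans_eq ?_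
  rw [← ENNReal.ofReal_mul (by positivity)]
  congr 1
  have : σ - ρ ≠ 0 := by linarith
  field_simp

theorem continuous_vertical (hf : Measurable f) (h0 : ∀ u < 0, f u = 0)
    (hb : ∀ u, 0 ≤ u → ‖f u‖ ≤ B * Real.exp (ρ * u)) (hσ : ρ < σ) :
    Continuous fun τ : ℝ => laplace f (σ + Complex.I * τ) := by
  refine continuous_of_dominated (fun τ => (hf.mul (by fun_prop)).aestronglyMeasurable)
    (fun τ => Filter.Eventually.of_forall fun u => ?_)
    (integrable_exp_indicator (sub_pos.mpr hσ) B)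
    (Filter.Eventually.of_forall fun u => by fun_prop)
  simpa using norm_mul_exp_le h0 hb ((σ : ℂ) + Complex.I * τ) u

end laplace

/-! ### Partial sums and general Dirichlet series -/

namespace GeneralDirichlet

open MeasureTheory

variable {ι : Type*} {ℓ : ι → ℝ}

/-- The sum `∑_{ℓ i ≤ u} a i`, for a locally finite family `ℓ` of exponents. -/
noncomputable def partialSum {M : Type*} [AddCommMonoid M] (hℓ : ∀ x, {i | ℓ i ≤ x}.Finite)
    (a : ι → M) (u : ℝ) : M :=
  ∑ i ∈ (hℓ u).toFinset, a i

/-- The general Dirichlet series `∑ a_i e^{-s ℓ_i}`. -/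
noncomputable def dseries (ℓ : ι → ℝ) (a : ι → ℂ) (s : ℂ) : ℂ :=
  ∑' i, a i * Complex.exp (-(s * ℓ i))

variable (hℓ : ∀ x, {i | ℓ i ≤ x}.Finite)

theorem partialSum_eq_zero {M : Type*} [AddCommMonoid M] (h0 : ∀ i, 0 ≤ ℓ i) (a : ι → M) {u : ℝ}
    (hu : u < 0) : partialSum hℓ a u = 0 := by
  refine Finset.sum_eq_zero fun i hi => ?_
  have := h0 i
  simp only [Set.Finite.mem_toFinset, Set.mem_ofPred_eq] at hi
  linarith

theorem norm_partialSum_le (a : ι → ℂ) (u : ℝ) :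
    ‖partialSum hℓ a u‖ ≤ partialSum hℓ (fun i => ‖a i‖) u :=
  norm_sum_le _ _

theorem partialSum_nonneg {a : ι → ℝ} (ha : ∀ i, 0 ≤ a i) (u : ℝ) : 0 ≤ partialSum hℓ a u :=
  Finset.sum_nonneg fun i _ => ha i

theorem partialSum_le_partialSum {a b : ι → ℝ} (u : ℝ) (hab : ∀ i, ℓ i ≤ u → a i ≤ b i) :
    partialSum hℓ a u ≤ partialSum hℓ b u :=
  Finset.sum_le_sum fun i hi => hab i (by simpa using hi)

theorem partialSum_mono {a : ι → ℝ} (ha : ∀ i, 0 ≤ a i) : Monotone (partialSum hℓ a) := by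
  intro u v huv
  refine Finset.sum_le_sum_of_subset_of_nonneg (fun i hi => ?_) fun i _ _ => ha i
  simp only [Set.Finite.mem_toFinset, Set.mem_ofPred_eq] at hi ⊢
  exact hi.trans huv

theorem partialSum_eq_sum_ite {M : Type*} [AddCommMonoid M] (a : ι → M) {u x : ℝ} (hux : u ≤ x) :
    partialSum hℓ a u = ∑ i ∈ (hℓ x).toFinset, if ℓ i ≤ u then a i else 0 := by
  rw [← Finset.sum_filter]
  refine Finset.sum_congr (Finset.ext fun i => ?_) fun _ _ => rfl
  simp only [Set.Finite.mem_toFinset, Set.mem_ofPred_eq, Finset.mem_filter]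
  exact ⟨fun h => ⟨h.trans hux, h⟩, fun h => h.2⟩

theorem hasSum_partialSum (a : ι → ℂ) (u : ℝ) :
    HasSum (fun i => if ℓ i ≤ u then a i else 0) (partialSum hℓ a u) := by
  rw [partialSum_eq_sum_ite hℓ a le_rfl]
  refine hasSum_sum_of_ne_finset_zero fun i hi => ?_
  simp only [Set.Finite.mem_toFinset, Set.mem_ofPred_eq] at hi
  simp [hi]

theorem measurable_partialSum (a : ι → ℂ) : Measurable (partialSum hℓ a) := by
  refine measurable_of_tendsto_metrizable
    (f := fun (n : ℕ) u => ∑ i ∈ (hℓ n).toFinset, if ℓ i ≤ u then a i else 0) (fun n => ?_) ?_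
  · refine Finset.measurable_sum _ fun i _ => ?_
    exact Measurable.ite measurableSet_Ici measurable_const measurable_const
  · refine tendsto_pi_nhds.mpr fun u => tendsto_const_nhds.congr' ?_
    filter_upwards [Filter.eventually_ge_atTop ⌈u⌉₊] with n hn
    exact partialSum_eq_sum_ite hℓ a ((Nat.le_ceil u).trans (by exact_mod_cast hn))

theorem integral_step {c s : ℂ} (hs : 0 < s.re) (x : ℝ) :
    Integrable (fun u : ℝ => (if x ≤ u then c else 0) * Complex.exp (-(s * u))) ∧
    ∫ u : ℝ, (if x ≤ u then c else 0) * Complex.exp (-(s * u)) =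
      c * Complex.exp (-(s * x)) / s := by
  have h1 : (fun u : ℝ => (if x ≤ u then c else 0) * Complex.exp (-(s * u))) =
      (Set.Ici x).indicator fun u : ℝ => c * Complex.exp (-s * u) := by
    ext u
    by_cases hu : x ≤ u <;> simp [hu, Set.indicator]
  have hs0 : s ≠ 0 := fun h => by simp [h] at hs
  rw [h1]
  constructor
  · rw [integrable_indicator_iff measurableSet_Ici, integrableOn_Ici_iff_integrableOn_Ioi]
    exact (integrableOn_exp_mul_complex_Ioi (by simpa using hs) x).const_mul c
  · rw [integral_indicator measurableSet_Ici, integral_Ici_eq_integral_Ioi, integral_const_mul,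
      integral_exp_mul_complex_Ioi (by simpa using hs)]
    rw [neg_mul]
    field_simp

variable {B ρ σ : ℝ}

/-- Partial sums of exponential growth of order `ρ` give summability to the right of `ρ`. -/
theorem summable_of_partialSum_le {a : ι → ℝ} (h0 : ∀ i, 0 ≤ ℓ i) (ha : ∀ i, 0 ≤ a i)
    (hB : ∀ u, 0 ≤ u → partialSum hℓ a u ≤ B * Real.exp (ρ * u)) (hρ : 0 ≤ ρ) (hσ : ρ < σ) :
    Summable (fun i => a i * Real.exp (-(σ * ℓ i))) ∧
      ∑' i, a i * Real.exp (-(σ * ℓ i)) ≤ B * σ / (σ - ρ) := by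
  have key : ∀ T : Finset ι, ∑ i ∈ T, a i * Real.exp (-(σ * ℓ i)) ≤ B * σ / (σ - ρ) := by
    intro T
    have hσ0 : 0 < σ := by linarith
    set f : ℝ → ℂ := fun u => ∑ i ∈ T, if ℓ i ≤ u then (a i : ℂ) else 0 with hf
    have hint : laplace f σ = ((∑ i ∈ T, a i * Real.exp (-(σ * ℓ i))) / σ : ℝ) := by
      have hstep := fun i =>
        integral_step (c := (a i : ℂ)) (s := (σ : ℂ)) (by simpa using hσ0) (ℓ i)
      simp only [laplace, hf, Finset.sum_mul]
      rw [integral_finsetSum _ fun i _ => (hstep i).1, Finset.sum_congr rfl fun i _ => (hstep i).2,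
        ← Finset.sum_div]
      push_cast
      rfl
    have hle : ‖laplace f σ‖ ≤ B / (σ - ρ) := by
      refine laplace.norm_le (f := f) (B := B) (ρ := ρ) (s := (σ : ℂ)) (fun u hu => ?_)
        (fun u hu => ?_) (by simpa using hσ)
      · refine Finset.sum_eq_zero fun i _ => ?_
        have := h0 i
        rw [if_neg (by linarith)]
      · refine le_trans ?_ (hB u hu)
        have h1 : f u = ((∑ i ∈ T, if ℓ i ≤ u then a i else 0 : ℝ) : ℂ) := by
          simp only [hf, Complex.ofReal_sum, apply_ite Complex.ofReal, Complex.ofReal_zero]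
        rw [h1, Complex.norm_of_nonneg (Finset.sum_nonneg fun i _ => by split_ifs <;> simp [ha])]
        rw [← Finset.sum_filter]
        refine Finset.sum_le_sum_of_subset_of_nonneg (fun i hi => ?_) fun i _ _ => ha i
        simpa using (Finset.mem_filter.mp hi).2
    rw [hint, Complex.norm_real, Real.norm_eq_abs] at hle
    have h2 := (le_abs_self _).trans hle
    rw [div_le_iff₀ hσ0] at h2
    exact h2.trans_eq (by ring)
  have hn : ∀ i, 0 ≤ a i * Real.exp (-(σ * ℓ i)) := fun i => mul_nonneg (ha i) (Real.exp_nonneg _)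
  have hs := summable_of_sum_le hn key
  exact ⟨hs, hs.tsum_le_of_sum_le key⟩

theorem norm_term (a : ℂ) (s : ℂ) (x : ℝ) :
    ‖a * Complex.exp (-(s * x))‖ = ‖a‖ * Real.exp (-(s.re * x)) := by
  rw [norm_mul, laplace.norm_exp_neg]

variable {a : ι → ℂ}

theorem summable_norm (h0 : ∀ i, 0 ≤ ℓ i)
    (hB : ∀ u, 0 ≤ u → partialSum hℓ (fun i => ‖a i‖) u ≤ B * Real.exp (ρ * u)) (hρ : 0 ≤ ρ)
    {s : ℂ} (hs : ρ < s.re) :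
    Summable fun i => ‖a i * Complex.exp (-(s * ℓ i))‖ := by
  simp only [norm_term]
  exact (summable_of_partialSum_le hℓ h0 (fun i => norm_nonneg _) hB hρ hs).1

theorem norm_dseries_le (h0 : ∀ i, 0 ≤ ℓ i)
    (hB : ∀ u, 0 ≤ u → partialSum hℓ (fun i => ‖a i‖) u ≤ B * Real.exp (ρ * u)) (hρ : 0 ≤ ρ)
    {s : ℂ} (hs : ρ < s.re) :
    ‖dseries ℓ a s‖ ≤ B * s.re / (s.re - ρ) := by
  refine (norm_tsum_le_tsum_norm (summable_norm hℓ h0 hB hρ hs)).trans ?_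
  simp only [norm_term]
  exact (summable_of_partialSum_le hℓ h0 (fun i => norm_nonneg _) hB hρ hs).2

theorem dseries_eq_laplace (h0 : ∀ i, 0 ≤ ℓ i)
    (hB : ∀ u, 0 ≤ u → partialSum hℓ (fun i => ‖a i‖) u ≤ B * Real.exp (ρ * u)) (hρ : 0 ≤ ρ)
    {s : ℂ} (hs : ρ < s.re) :
    dseries ℓ a s / s = laplace (partialSum hℓ a) s := by
  have hs0 : 0 < s.re := by linarith
  have : Countable ι := by
    have : (Set.univ : Set ι) = ⋃ n : ℕ, {i | ℓ i ≤ n} := by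
      refine (Set.eq_univ_of_forall fun i => Set.mem_iUnion.mpr ?_).symm
      exact exists_nat_ge (ℓ i)
    rw [← Set.countable_univ_iff, this]
    exact Set.countable_iUnion fun n => (hℓ n).countable
  have hstep := fun i => integral_step (c := a i) hs0 (ℓ i)
  have hnorm : ∀ i, ∫ u : ℝ, ‖(if ℓ i ≤ u then a i else 0) * Complex.exp (-(s * u))‖ =
      ‖a i * Complex.exp (-(s * ℓ i))‖ / s.re := by
    intro i
    have h1 := (integral_step (c := (‖a i‖ : ℂ)) (s := (s.re : ℂ)) (by simpa using hs0) (ℓ i)).2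
    have h2 : ∀ u : ℝ, (if ℓ i ≤ u then (‖a i‖ : ℂ) else 0) * Complex.exp (-((s.re : ℂ) * u)) =
        ((‖(if ℓ i ≤ u then a i else 0) * Complex.exp (-(s * u))‖ : ℝ) : ℂ) := by
      intro u
      rw [norm_term]
      split_ifs <;> simp
    simp only [h2] at h1
    rw [integral_complex_ofReal] at h1
    rw [norm_term]
    exact_mod_cast h1
  have hsum := hasSum_integral_of_summable_integral_norm (fun i => (hstep i).1) (by
    simp only [hnorm]
    exact (summable_norm hℓ h0 hB hρ hs).div_const _)
  simp only [(hstep _).2] at hsum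
  rw [dseries, ← tsum_div_const, hsum.tsum_eq, laplace]
  refine integral_congr_ae (Filter.Eventually.of_forall fun u => ?_)
  exact ((hasSum_partialSum hℓ a u).mul_right _).tsum_eq

theorem norm_partialSum_le_exp
    (hB : ∀ u, 0 ≤ u → partialSum hℓ (fun i => ‖a i‖) u ≤ B * Real.exp (ρ * u)) (u : ℝ)
    (hu : 0 ≤ u) :
    ‖partialSum hℓ a u‖ ≤ B * Real.exp (ρ * u) :=
  (norm_partialSum_le hℓ a u).trans (hB u hu)

/-- The mean square of `D(s)/s` over a vertical line. -/
theorem lintegral_dseries_div_le (h0 : ∀ i, 0 ≤ ℓ i)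
    (hB : ∀ u, 0 ≤ u → partialSum hℓ (fun i => ‖a i‖) u ≤ B * Real.exp (ρ * u)) (hρ : 0 ≤ ρ)
    (hσ : ρ < σ) :
    ∫⁻ τ : ℝ, ‖dseries ℓ a (σ + Complex.I * τ) / (σ + Complex.I * τ)‖ₑ ^ 2 ≤
      ENNReal.ofReal (Real.pi * B ^ 2 / (σ - ρ)) := by
  have h1 : ∀ τ : ℝ, dseries ℓ a (σ + Complex.I * τ) / (σ + Complex.I * τ) =
      laplace (partialSum hℓ a) (σ + Complex.I * τ) :=
    fun τ => dseries_eq_laplace hℓ h0 hB hρ (by simpa using hσ)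
  simp only [h1]
  exact laplace.lintegral_enorm_sq_le (measurable_partialSum hℓ a)
    (fun u hu => partialSum_eq_zero hℓ h0 a hu) (norm_partialSum_le_exp hℓ hB) hσ

theorem continuous_dseries_div (h0 : ∀ i, 0 ≤ ℓ i)
    (hB : ∀ u, 0 ≤ u → partialSum hℓ (fun i => ‖a i‖) u ≤ B * Real.exp (ρ * u)) (hρ : 0 ≤ ρ)
    (hσ : ρ < σ) :
    Continuous fun τ : ℝ => dseries ℓ a (σ + Complex.I * τ) / (σ + Complex.I * τ) := by
  have h1 : ∀ τ : ℝ, dseries ℓ a (σ + Complex.I * τ) / (σ + Complex.I * τ) =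
      laplace (partialSum hℓ a) (σ + Complex.I * τ) :=
    fun τ => dseries_eq_laplace hℓ h0 hB hρ (by simpa using hσ)
  simp only [h1]
  exact laplace.continuous_vertical (measurable_partialSum hℓ a)
    (fun u hu => partialSum_eq_zero hℓ h0 a hu) (norm_partialSum_le_exp hℓ hB) hσ

end GeneralDirichlet

/-! ### Mean squares on vertical lines -/

namespace GeneralDirichlet

open MeasureTheory Filter Topology

/-- A bounded coefficient function `g` whose logarithmic derivative is under control: up to an
error `e`, the coefficients `g i * ℓ i` are the convolution of `g` with a function `b`, the partial
sums of `1`, `|b|` and `|e|` all grow at most like `e^u`, and the exponents have a density with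
respect to `e^u`. The convolution identity is recorded for the Dirichlet series and for the partial
sums. The series with coefficients `g`, `b`, `e` and `g i * ℓ i` are denoted by `G`, `S`, `E` and
`D` in the comments below. -/
structure LogConvolution {ι : Type*} (ℓ : ι → ℝ) (g b e : ι → ℂ) (B : ℝ) : Prop where
  finite : ∀ x, {i | ℓ i ≤ x}.Finite
  nonneg : ∀ i, 0 ≤ ℓ i
  norm_le_one : ∀ i, ‖g i‖ ≤ 1
  count_le : ∀ u, 0 ≤ u → partialSum finite (fun _ => (1 : ℝ)) u ≤ B * Real.exp u
  b_le : ∀ u, 0 ≤ u → partialSum finite (fun i => ‖b i‖) u ≤ B * Real.exp u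
  e_le : ∀ u, 0 ≤ u → partialSum finite (fun i => ‖e i‖) u ≤ B * Real.exp u
  count_tendsto : ∃ κ : ℝ,
    Tendsto (fun u => partialSum finite (fun _ => (1 : ℝ)) u * Real.exp (-u)) atTop (𝓝 κ)
  dseries_eq : ∀ s : ℂ, 1 < s.re →
    dseries ℓ (fun i => g i * ℓ i) s = dseries ℓ g s * dseries ℓ b s + dseries ℓ e s
  partialSum_eq : ∀ u, partialSum finite (fun i => g i * ℓ i) u =
    ∑ i ∈ (finite u).toFinset, b i * partialSum finite g (u - ℓ i) + partialSum finite e u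

namespace LogConvolution

variable {ι : Type*} {ℓ : ι → ℝ} {g b e : ι → ℂ} {B : ℝ}

/-- The point `1 + 1/y + iτ`. -/
noncomputable def point (y τ : ℝ) : ℂ := ((1 + 1 / y : ℝ) : ℂ) + Complex.I * τ

@[simp] theorem point_re (y τ : ℝ) : (point y τ).re = 1 + 1 / y := by simp [point]

@[simp] theorem point_im (y τ : ℝ) : (point y τ).im = τ := by simp [point]

theorem one_lt_point_re {y : ℝ} (hy : 0 < y) (τ : ℝ) : 1 < (point y τ).re := by
  rw [point_re]
  have : 0 < 1 / y := by positivity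
  linarith

theorem one_le_norm_point {y : ℝ} (hy : 0 < y) (τ : ℝ) : 1 ≤ ‖point y τ‖ :=
  (one_lt_point_re hy τ).le.trans (Complex.re_le_norm _)

theorem abs_le_norm_point (y τ : ℝ) : |τ| ≤ ‖point y τ‖ := by
  have := Complex.abs_im_le_norm (point y τ)
  rwa [point_im] at this

theorem B_nonneg (h : LogConvolution ℓ g b e B) : 0 ≤ B := by
  have h1 := h.count_le 0 le_rfl
  have h2 := partialSum_nonneg h.finite (a := fun _ => (1 : ℝ)) (fun _ => zero_le_one) 0
  simp only [Real.exp_zero, mul_one] at h1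
  linarith

theorem norm_g_le (h : LogConvolution ℓ g b e B) (u : ℝ) (hu : 0 ≤ u) :
    partialSum h.finite (fun i => ‖g i‖) u ≤ B * Real.exp (1 * u) := by
  rw [one_mul]
  exact (partialSum_le_partialSum h.finite u fun i _ => h.norm_le_one i).trans (h.count_le u hu)

theorem norm_partialSum_g_le (h : LogConvolution ℓ g b e B) (u : ℝ) :
    ‖partialSum h.finite g u‖ ≤ B * Real.exp u := by
  rcases lt_or_ge u 0 with hu | hu
  · rw [partialSum_eq_zero h.finite h.nonneg g hu, norm_zero]
    exact mul_nonneg h.B_nonneg (Real.exp_nonneg u)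
  · simpa using (norm_partialSum_le h.finite g u).trans (h.norm_g_le u hu)

/-- Twisting by `e^{-it ℓ}` does not change the bound for the partial sums of `g * ℓ`. -/
theorem norm_twist_le (h : LogConvolution ℓ g b e B) (t : ℝ) {y : ℝ} (hy : 0 < y) (u : ℝ)
    (hu : 0 ≤ u) :
    partialSum h.finite (fun i => ‖g i * ℓ i * Complex.exp (-(Complex.I * t * ℓ i))‖) u ≤
      (2 * y * B) * Real.exp ((1 + 1 / (2 * y)) * u) := by
  have h1 : partialSum h.finite (fun i => ‖g i * ℓ i * Complex.exp (-(Complex.I * t * ℓ i))‖) u ≤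
      partialSum h.finite (fun i => u * 1) u := by
    refine partialSum_le_partialSum h.finite u fun i hi => ?_
    have h2 : ‖Complex.exp (-(Complex.I * t * ℓ i))‖ = 1 := by
      simp [Complex.norm_exp]
    rw [norm_mul, norm_mul, h2, mul_one, Complex.norm_real, Real.norm_of_nonneg (h.nonneg i),
      mul_one]
    calc ‖g i‖ * ℓ i ≤ 1 * ℓ i := mul_le_mul_of_nonneg_right (h.norm_le_one i) (h.nonneg i)
      _ ≤ u := by rwa [one_mul]
  refine h1.trans ?_
  have h3 : partialSum h.finite (fun i => u * 1) u = u * partialSum h.finite (fun _ => (1 : ℝ)) u :=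
    (Finset.mul_sum _ _ _).symm
  rw [h3]
  have h4 : u / (2 * y) ≤ Real.exp (u / (2 * y)) := by
    have := Real.add_one_le_exp (u / (2 * y))
    linarith
  have h5 : u ≤ 2 * y * Real.exp (u / (2 * y)) := by
    rw [div_le_iff₀ (by positivity)] at h4
    linarith
  have h6 : (1 + 1 / (2 * y)) * u = u / (2 * y) + u := by ring
  calc u * partialSum h.finite (fun _ => (1 : ℝ)) u
      ≤ (2 * y * Real.exp (u / (2 * y))) * (B * Real.exp u) :=
        mul_le_mul h5 (h.count_le u hu)
          (partialSum_nonneg h.finite (fun _ => zero_le_one) u) (by positivity)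
    _ = _ := by
        rw [h6, Real.exp_add]
        ring

theorem norm_gl_le (h : LogConvolution ℓ g b e B) {y : ℝ} (hy : 0 < y) (u : ℝ) (hu : 0 ≤ u) :
    partialSum h.finite (fun i => ‖g i * ℓ i‖) u ≤
      (2 * y * B) * Real.exp ((1 + 1 / (2 * y)) * u) := by
  simpa using h.norm_twist_le 0 hy u hu

/-- The abscissa `1 + 1/(2y)` lies to the left of `1 + 1/y`, at distance `1/(2y)`; it is where the
partial sums of `g i * ℓ i` are compared with an exponential. -/
theorem half_lt {y : ℝ} (hy : 0 < y) : 1 + 1 / (2 * y) < 1 + 1 / y := by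
  have : 1 / (2 * y) < 1 / y := one_div_lt_one_div_of_lt hy (by linarith)
  linarith

theorem lintegral_S_le (h : LogConvolution ℓ g b e B) {y : ℝ} (hy : 0 < y) :
    ∫⁻ τ : ℝ, ‖dseries ℓ b (point y τ) / point y τ‖ₑ ^ 2 ≤
      ENNReal.ofReal (Real.pi * B ^ 2 * y) := by
  have := lintegral_dseries_div_le (σ := 1 + 1 / y) h.finite h.nonneg
    (fun u hu => by simpa using h.b_le u hu) (zero_le_one (α := ℝ)) (by simpa using hy)
  refine this.trans_eq (congrArg _ ?_)
  field_simp
  ring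

theorem lintegral_E_le (h : LogConvolution ℓ g b e B) {y : ℝ} (hy : 0 < y) :
    ∫⁻ τ : ℝ, ‖dseries ℓ e (point y τ) / point y τ‖ₑ ^ 2 ≤
      ENNReal.ofReal (Real.pi * B ^ 2 * y) := by
  have := lintegral_dseries_div_le (σ := 1 + 1 / y) h.finite h.nonneg
    (fun u hu => by simpa using h.e_le u hu) (zero_le_one (α := ℝ)) (by simpa using hy)
  refine this.trans_eq (congrArg _ ?_)
  field_simp
  ring

/-- The mean square of `D` over a unit interval, uniformly in its position: twist so that the
interval moves to the origin, where the weight `1/s` is harmless. -/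
theorem setLIntegral_D_le (h : LogConvolution ℓ g b e B) {y : ℝ} (hy : 1 ≤ y) (t : ℝ) :
    ∫⁻ τ in Set.Icc t (t + 1), ‖dseries ℓ (fun i => g i * ℓ i) (point y τ)‖ₑ ^ 2 ≤
      ENNReal.ofReal (40 * Real.pi * B ^ 2 * y ^ 3) := by
  have hy0 : 0 < y := by linarith
  have h1 := lintegral_dseries_div_le h.finite h.nonneg (h.norm_twist_le t hy0) (by positivity)
    (half_lt hy0)
  have h2 : Real.pi * (2 * y * B) ^ 2 / (1 + 1 / y - (1 + 1 / (2 * y))) =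
      8 * Real.pi * B ^ 2 * y ^ 3 := by
    have : 1 + 1 / y - (1 + 1 / (2 * y)) = 1 / (2 * y) := by
      field_simp
      ring
    rw [this]
    field_simp
    ring
  rw [h2] at h1
  have h3 : ∀ τ : ℝ, dseries ℓ (fun i => g i * ℓ i * Complex.exp (-(Complex.I * t * ℓ i)))
      (point y (τ - t)) = dseries ℓ (fun i => g i * ℓ i) (point y τ) := by
    intro τ
    refine tsum_congr fun i => ?_
    rw [mul_assoc, ← Complex.exp_add]
    congr 2
    simp only [point]
    push_cast
    ring
  have h4 := lintegral_sub_right_eq_self (μ := volume) (fun τ : ℝ => ‖dseries ℓ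
      (fun i => g i * ℓ i * Complex.exp (-(Complex.I * t * ℓ i))) (point y τ) / point y τ‖ₑ ^ 2) t
  calc ∫⁻ τ in Set.Icc t (t + 1), ‖dseries ℓ (fun i => g i * ℓ i) (point y τ)‖ₑ ^ 2
      ≤ ∫⁻ τ in Set.Icc t (t + 1), ENNReal.ofReal 5 * ‖dseries ℓ
          (fun i => g i * ℓ i * Complex.exp (-(Complex.I * t * ℓ i))) (point y (τ - t)) /
            point y (τ - t)‖ₑ ^ 2 := by
        refine setLIntegral_mono' measurableSet_Icc fun τ hτ => ?_
        rw [h3]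
        simp only [← ofReal_norm]
        rw [← ENNReal.ofReal_pow (norm_nonneg _), ← ENNReal.ofReal_pow (norm_nonneg _),
          ← ENNReal.ofReal_mul (by norm_num)]
        refine ENNReal.ofReal_le_ofReal ?_
        rw [norm_div, div_pow, ← mul_div_assoc, le_div_iff₀
          (by have := one_le_norm_point hy0 (τ - t); positivity), mul_comm]
        refine mul_le_mul_of_nonneg_right ?_ (by positivity)
        rw [Complex.sq_norm, Complex.normSq_apply, point_re, point_im]
        have hy1 : 1 / y ≤ 1 := by rw [div_le_one hy0]; exact hy
        have hy2 : 0 < 1 / y := by positivity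
        have a1 : 0 ≤ τ - t := by linarith [hτ.1]
        have a2 : τ - t ≤ 1 := by linarith [hτ.2]
        nlinarith
    _ ≤ ∫⁻ τ, ENNReal.ofReal 5 * ‖dseries ℓ
          (fun i => g i * ℓ i * Complex.exp (-(Complex.I * t * ℓ i))) (point y (τ - t)) /
            point y (τ - t)‖ₑ ^ 2 := setLIntegral_le_lintegral _ _
    _ = ENNReal.ofReal 5 * ∫⁻ τ, ‖dseries ℓ
          (fun i => g i * ℓ i * Complex.exp (-(Complex.I * t * ℓ i))) (point y τ) /
            point y τ‖ₑ ^ 2 := by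
        rw [lintegral_const_mul' _ _ ENNReal.ofReal_ne_top, h4]
    _ ≤ ENNReal.ofReal 5 * ENNReal.ofReal (8 * Real.pi * B ^ 2 * y ^ 3) := mul_le_mul_right h1 _
    _ = _ := by
        rw [← ENNReal.ofReal_mul (by norm_num)]
        congr 1
        ring

/-- The far range of the vertical line contributes a small proportion of the mean square. -/
theorem exists_far (h : LogConvolution ℓ g b e B) {ε : ℝ} (hε : 0 < ε) :
    ∃ M : ℝ, 0 < M ∧ ∀ y : ℝ, 1 ≤ y →
      ∫⁻ τ in {τ : ℝ | M < |τ|}, ‖dseries ℓ (fun i => g i * ℓ i) (point y τ) / point y τ‖ₑ ^ 2 ≤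
        ENNReal.ofReal (ε * y ^ 3) := by
  -- `f n` bounds the two unit intervals at distance `n` from the origin, up to the factor `y ^ 3`.
  set f : ℕ → ℝ := fun n => 80 * Real.pi * B ^ 2 * (1 / (n : ℝ) ^ 2) with hf
  have hfs : Summable f := (Real.summable_one_div_nat_pow.mpr one_lt_two).mul_left _
  have hf0 : ∀ n, 0 ≤ f n := fun n => by positivity
  obtain ⟨N, hN, hN1⟩ := (((tendsto_sum_nat_add f).eventually (gt_mem_nhds hε)).and
    (eventually_ge_atTop 1)).exists
  refine ⟨N, by exact_mod_cast hN1, fun y hy => ?_⟩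
  have hy0 : 0 < y := by linarith
  set D := fun τ : ℝ => dseries ℓ (fun i => g i * ℓ i) (point y τ) with hD
  have hcell : ∀ (n : ℕ) (t : ℝ), 1 ≤ n → (∀ τ ∈ Set.Icc t (t + 1), (n : ℝ) ≤ |τ|) →
      ∫⁻ τ in Set.Icc t (t + 1), ‖D τ / point y τ‖ₑ ^ 2 ≤ ENNReal.ofReal (f n * y ^ 3 / 2) := by
    intro n t hn hτ
    have hn0 : (0 : ℝ) < n := by exact_mod_cast hn
    calc ∫⁻ τ in Set.Icc t (t + 1), ‖D τ / point y τ‖ₑ ^ 2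
        ≤ ∫⁻ τ in Set.Icc t (t + 1), ENNReal.ofReal (1 / (n : ℝ) ^ 2) * ‖D τ‖ₑ ^ 2 := by
          refine setLIntegral_mono' measurableSet_Icc fun τ h1 => ?_
          simp only [← ofReal_norm]
          rw [← ENNReal.ofReal_pow (norm_nonneg _), ← ENNReal.ofReal_pow (norm_nonneg _),
            ← ENNReal.ofReal_mul (by positivity)]
          refine ENNReal.ofReal_le_ofReal ?_
          rw [norm_div, div_pow, div_eq_mul_one_div, mul_comm]
          refine mul_le_mul_of_nonneg_right (one_div_le_one_div_of_le (by positivity) ?_)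
            (by positivity)
          exact pow_le_pow_left₀ hn0.le ((hτ τ h1).trans (abs_le_norm_point y τ)) 2
      _ ≤ ENNReal.ofReal (1 / (n : ℝ) ^ 2) * ENNReal.ofReal (40 * Real.pi * B ^ 2 * y ^ 3) := by
          rw [lintegral_const_mul' _ _ ENNReal.ofReal_ne_top]
          exact mul_le_mul_right (h.setLIntegral_D_le hy t) _
      _ = _ := by
          rw [← ENNReal.ofReal_mul (by positivity)]
          congr 1
          simp only [hf]
          ring
  have hsub : {τ : ℝ | (N : ℝ) < |τ|} ⊆ ⋃ k : ℕ, (Set.Icc ((k + N : ℕ) : ℝ) ((k + N : ℕ) + 1) ∪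
      Set.Icc (-((k + N : ℕ) : ℝ) - 1) (-((k + N : ℕ) : ℝ) - 1 + 1)) := by
    intro τ hτ
    have h1 : N ≤ ⌊|τ|⌋₊ := Nat.le_floor (le_of_lt hτ)
    refine Set.mem_iUnion.mpr ⟨⌊|τ|⌋₊ - N, ?_⟩
    rw [Nat.sub_add_cancel h1]
    have h2 := Nat.floor_le (abs_nonneg τ)
    have h3 := (Nat.lt_floor_add_one |τ|).le
    rcases abs_cases τ with ⟨h4, _⟩ | ⟨h4, _⟩
    · left
      rw [h4] at h2 h3 ⊢
      exact ⟨h2, h3⟩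
    · right
      rw [h4] at h2 h3 ⊢
      exact ⟨by linarith, by linarith⟩
  calc ∫⁻ τ in {τ : ℝ | (N : ℝ) < |τ|}, ‖D τ / point y τ‖ₑ ^ 2
      ≤ ∑' k : ℕ, ∫⁻ τ in (Set.Icc ((k + N : ℕ) : ℝ) ((k + N : ℕ) + 1) ∪
      Set.Icc (-((k + N : ℕ) : ℝ) - 1) (-((k + N : ℕ) : ℝ) - 1 + 1)), ‖D τ / point y τ‖ₑ ^ 2 :=
        (lintegral_mono_set hsub).trans (lintegral_iUnion_le _ _)
    _ ≤ ∑' k : ℕ, ENNReal.ofReal (f (k + N) * y ^ 3) := by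
        refine ENNReal.tsum_le_tsum fun k => (lintegral_union_le _ _ _).trans ?_
        have hk : 1 ≤ k + N := by omega
        have e1 := hcell (k + N) ((k + N : ℕ) : ℝ) hk fun τ hτ => hτ.1.trans (le_abs_self τ)
        have e2 := hcell (k + N) (-((k + N : ℕ) : ℝ) - 1) hk fun τ hτ =>
          le_trans (by linarith [hτ.2]) (neg_le_abs τ)
        refine (add_le_add e1 e2).trans_eq ?_
        have := hf0 (k + N)
        rw [← ENNReal.ofReal_add (by positivity) (by positivity)]
        congr 1
        ring
    _ = ENNReal.ofReal ((∑' k : ℕ, f (k + N)) * y ^ 3) := by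
        rw [← tsum_mul_right, ENNReal.ofReal_tsum_of_nonneg
          (fun k => by have := hf0 (k + N); positivity)
          (((summable_nat_add_iff N).mpr hfs).mul_right _)]
    _ ≤ _ := ENNReal.ofReal_le_ofReal (by gcongr)

/-- On a range where `|G| ≤ ε y`, the identity `D = G S + E` and the mean squares of `S` and `E`
bound the mean square of `D`. -/
theorem setLIntegral_mid (h : LogConvolution ℓ g b e B) {y ε : ℝ} (hy : 1 ≤ y)
    {A : Set ℝ} (hA : MeasurableSet A) (hG : ∀ τ ∈ A, ‖dseries ℓ g (point y τ)‖ ≤ ε * y) :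
    ∫⁻ τ in A, ‖dseries ℓ (fun i => g i * ℓ i) (point y τ) / point y τ‖ₑ ^ 2 ≤
      ENNReal.ofReal (2 * Real.pi * B ^ 2 * (ε ^ 2 * y ^ 3 + y)) := by
  have hy0 : 0 < y := by linarith
  set S := fun τ : ℝ => dseries ℓ b (point y τ) / point y τ with hS
  set E := fun τ : ℝ => dseries ℓ e (point y τ) / point y τ with hE
  have hEm : Measurable fun τ => ENNReal.ofReal 2 * ‖E τ‖ₑ ^ 2 := by
    have hc : Continuous E := continuous_dseries_div (σ := 1 + 1 / y) h.finite h.nonneg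
      (fun u hu => by simpa using h.e_le u hu) (zero_le_one (α := ℝ)) (by simpa using hy0)
    exact (hc.measurable.enorm.pow_const 2).const_mul _
  calc ∫⁻ τ in A, ‖dseries ℓ (fun i => g i * ℓ i) (point y τ) / point y τ‖ₑ ^ 2
      ≤ ∫⁻ τ in A, (ENNReal.ofReal (2 * ε ^ 2 * y ^ 2) * ‖S τ‖ₑ ^ 2 +
          ENNReal.ofReal 2 * ‖E τ‖ₑ ^ 2) := by
        refine setLIntegral_mono' hA fun τ hτ => ?_
        rw [h.dseries_eq _ (one_lt_point_re hy0 τ)]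
        have e1 : (dseries ℓ g (point y τ) * dseries ℓ b (point y τ) + dseries ℓ e (point y τ)) /
            point y τ = dseries ℓ g (point y τ) * S τ + E τ := by
          simp only [hS, hE]
          ring
        rw [e1]
        simp only [← ofReal_norm]
        rw [← ENNReal.ofReal_pow (norm_nonneg _), ← ENNReal.ofReal_pow (norm_nonneg _),
          ← ENNReal.ofReal_pow (norm_nonneg _), ← ENNReal.ofReal_mul (by positivity),
          ← ENNReal.ofReal_mul (by positivity),
          ← ENNReal.ofReal_add (by positivity) (by positivity)]
        refine ENNReal.ofReal_le_ofReal ?_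
        have e2 : ‖dseries ℓ g (point y τ) * S τ + E τ‖ ≤ ε * y * ‖S τ‖ + ‖E τ‖ := by
          refine (norm_add_le _ _).trans (add_le_add_left ?_ _)
          rw [norm_mul]
          exact mul_le_mul_of_nonneg_right (hG τ hτ) (norm_nonneg _)
        refine (pow_le_pow_left₀ (norm_nonneg _) e2 2).trans ?_
        nlinarith [sq_nonneg (ε * y * ‖S τ‖ - ‖E τ‖)]
    _ ≤ ∫⁻ τ, (ENNReal.ofReal (2 * ε ^ 2 * y ^ 2) * ‖S τ‖ₑ ^ 2 +
          ENNReal.ofReal 2 * ‖E τ‖ₑ ^ 2) := setLIntegral_le_lintegral _ _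
    _ = ENNReal.ofReal (2 * ε ^ 2 * y ^ 2) * (∫⁻ τ, ‖S τ‖ₑ ^ 2) +
          ENNReal.ofReal 2 * (∫⁻ τ, ‖E τ‖ₑ ^ 2) := by
        rw [lintegral_add_right _ hEm, lintegral_const_mul' _ _ ENNReal.ofReal_ne_top,
          lintegral_const_mul' _ _ ENNReal.ofReal_ne_top]
    _ ≤ ENNReal.ofReal (2 * ε ^ 2 * y ^ 2) * ENNReal.ofReal (Real.pi * B ^ 2 * y) +
          ENNReal.ofReal 2 * ENNReal.ofReal (Real.pi * B ^ 2 * y) := by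
        gcongr
        · exact h.lintegral_S_le hy0
        · exact h.lintegral_E_le hy0
    _ = _ := by
        rw [← ENNReal.ofReal_mul (by positivity), ← ENNReal.ofReal_mul (by positivity),
          ← ENNReal.ofReal_add (by positivity) (by positivity)]
        congr 1
        ring

end LogConvolution

end GeneralDirichlet

/-! ### The derivative of the series near the pole -/

namespace GeneralDirichlet.LogConvolution

open MeasureTheory Filter Topology

variable {ι : Type*} {ℓ : ι → ℝ} {g b e : ι → ℂ} {B : ℝ}

theorem sq_le_exp {t : ℝ} (ht : 0 ≤ t) : t ^ 2 ≤ 2 * Real.exp t := by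
  have := Real.quadratic_le_exp_of_nonneg ht
  linarith

theorem abs_exp_neg_sub_le {x : ℝ} (hx : 0 ≤ x) : |Real.exp (-x) - 1 + x| ≤ x ^ 2 := by
  have h1 := Real.add_one_le_exp (-x)
  rw [abs_of_nonneg (by linarith)]
  rcases le_or_gt x 1 with h | h
  · have := Real.abs_exp_sub_one_sub_id_le (x := -x) (by rwa [abs_neg, abs_of_nonneg hx])
    rw [abs_le] at this
    linarith [this.2, neg_sq x]
  · have : Real.exp (-x) ≤ 1 := Real.exp_le_one_iff.mpr (by linarith)
    nlinarith

/-- A finite difference of `G` in the real direction approximates `-D`. -/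
theorem norm_finite_difference_le (h : LogConvolution ℓ g b e B) {y δ : ℝ} (hy : 1 ≤ y)
    (hδ : 0 < δ) (τ : ℝ) :
    ‖dseries ℓ g (point y τ + (δ / y : ℝ)) - dseries ℓ g (point y τ) +
      (δ / y : ℝ) * dseries ℓ (fun i => g i * ℓ i) (point y τ)‖ ≤ 24 * B * δ ^ 2 * y := by
  have hy0 : 0 < y := by linarith
  set η := δ / y with hη
  have hη0 : 0 < η := by positivity
  have hs := one_lt_point_re hy0 τ
  have s1 := (summable_norm h.finite h.nonneg h.norm_g_le zero_le_one
    (s := point y τ + (η : ℝ)) (by rw [Complex.add_re, Complex.ofReal_re]; linarith)).of_norm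
  have s2 := (summable_norm h.finite h.nonneg h.norm_g_le zero_le_one hs).of_norm
  have s3 := (summable_norm h.finite h.nonneg (h.norm_gl_le hy0) (by positivity)
    (s := point y τ) (by rw [point_re]; exact half_lt hy0)).of_norm
  have key := ((s1.hasSum.sub s2.hasSum).add (s3.hasSum.mul_left (η : ℂ)))
  have hZ := summable_of_partialSum_le h.finite h.nonneg (fun _ => zero_le_one' ℝ)
    (fun u hu => by simpa using h.count_le u hu) (zero_le_one' ℝ) (σ := 1 + 1 / (2 * y))
    (by have : 0 < 1 / (2 * y) := by positivity
        linarith)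
  have hb : ∀ i, ‖g i * Complex.exp (-((point y τ + (η : ℝ)) * ℓ i)) -
      g i * Complex.exp (-(point y τ * ℓ i)) +
      η * (g i * ℓ i * Complex.exp (-(point y τ * ℓ i)))‖ ≤
      8 * δ ^ 2 * (1 * Real.exp (-((1 + 1 / (2 * y)) * ℓ i))) := by
    intro i
    have e1 : g i * Complex.exp (-((point y τ + (η : ℝ)) * ℓ i)) -
      g i * Complex.exp (-(point y τ * ℓ i)) +
      η * (g i * ℓ i * Complex.exp (-(point y τ * ℓ i))) =
      g i * Complex.exp (-(point y τ * ℓ i)) * ((Real.exp (-(η * ℓ i)) - 1 + η * ℓ i : ℝ) : ℂ) := by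
      rw [add_mul, neg_add, Complex.exp_add]
      push_cast
      ring
    have hx : 0 ≤ η * ℓ i := mul_nonneg hη0.le (h.nonneg i)
    rw [e1, norm_mul, norm_term, Complex.norm_real, Real.norm_eq_abs, point_re]
    have e2 := sq_le_exp (t := ℓ i / (2 * y)) (div_nonneg (h.nonneg i) (by positivity))
    calc ‖g i‖ * Real.exp (-((1 + 1 / y) * ℓ i)) * |Real.exp (-(η * ℓ i)) - 1 + η * ℓ i|
        ≤ 1 * Real.exp (-((1 + 1 / y) * ℓ i)) * (η * ℓ i) ^ 2 := by
          gcongr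
          · exact h.norm_le_one i
          · exact abs_exp_neg_sub_le hx
      _ = 4 * δ ^ 2 * Real.exp (-((1 + 1 / y) * ℓ i)) * (ℓ i / (2 * y)) ^ 2 := by
          rw [hη]
          field_simp
          ring
      _ ≤ 4 * δ ^ 2 * Real.exp (-((1 + 1 / y) * ℓ i)) * (2 * Real.exp (ℓ i / (2 * y))) := by
          gcongr
      _ = 8 * δ ^ 2 * (Real.exp (-((1 + 1 / y) * ℓ i)) * Real.exp (ℓ i / (2 * y))) := by ring
      _ = _ := by
          rw [← Real.exp_add, one_mul]
          congr 2
          field_simp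
          ring
  have hle := tsum_of_norm_bounded (hZ.1.hasSum.mul_left (8 * δ ^ 2)) hb
  rw [key.tsum_eq] at hle
  refine hle.trans ?_
  have h3 : B * (1 + 1 / (2 * y)) / (1 + 1 / (2 * y) - 1) = B * (2 * y + 1) := by
    rw [add_sub_cancel_left]
    field_simp
  rw [h3] at hZ
  calc 8 * δ ^ 2 * ∑' i, 1 * Real.exp (-((1 + 1 / (2 * y)) * ℓ i)) ≤
      8 * δ ^ 2 * (B * (2 * y + 1)) := by
        gcongr
        exact hZ.2
    _ ≤ 8 * δ ^ 2 * (B * (3 * y)) := by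
        have := h.B_nonneg
        gcongr
        linarith
    _ = _ := by ring

variable {C : ℂ} {α : ℝ} {L : ℝ → ℂ}

/-- The hypothesis on `G` near the line `Re s = 1`, in terms of `y = 1 / (σ - 1)`. -/
def SeriesAsymptotic (ℓ : ι → ℝ) (g : ι → ℂ) (C : ℂ) (α : ℝ) (L : ℝ → ℂ) : Prop :=
  ∀ M : ℝ, ∀ ε > 0, ∀ᶠ y in atTop, ∀ τ : ℝ, |τ| ≤ M →
    ‖dseries ℓ g (point y τ) - C / (point y τ - (1 + Complex.I * α)) * L y‖ ≤ ε * y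

theorem point_sub (y τ α : ℝ) :
    point y τ - (1 + Complex.I * α) = (1 / y : ℝ) + Complex.I * ((τ - α : ℝ) : ℂ) := by
  simp only [point]
  push_cast
  ring

theorem inv_le_norm_point_sub {y : ℝ} (hy : 0 < y) (τ α : ℝ) :
    1 / y ≤ ‖point y τ - (1 + Complex.I * α)‖ := by
  have h1 := Complex.abs_re_le_norm (point y τ - (1 + Complex.I * α))
  rw [point_sub] at h1 ⊢
  simpa [abs_of_pos hy] using h1

theorem abs_sub_le_norm_point_sub (y τ α : ℝ) :
    |τ - α| ≤ ‖point y τ - (1 + Complex.I * α)‖ := by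
  have h1 := Complex.abs_im_le_norm (point y τ - (1 + Complex.I * α))
  rw [point_sub] at h1 ⊢
  simpa using h1

theorem norm_point_sub_le {y : ℝ} (hy : 0 < y) (τ α : ℝ) :
    ‖point y τ - (1 + Complex.I * α)‖ ≤ 1 / y + |τ - α| := by
  rw [point_sub]
  refine (norm_add_le _ _).trans_eq ?_
  rw [Complex.norm_real, norm_mul, Complex.norm_I, one_mul, Complex.norm_real, Real.norm_eq_abs,
    Real.norm_eq_abs, abs_of_pos (by positivity : 0 < 1 / y)]

/-- Since `|L| = 1`, slow oscillation can be stated as a difference. -/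
theorem norm_sub_tendsto (hL : SlowlyOscillating L) (hL1 : ∀ x, ‖L x‖ = 1) {u : ℝ} (hu : 0 < u) :
    Tendsto (fun y => ‖L (u * y) - L y‖) atTop (𝓝 0) := by
  have h1 := ((hL u hu).sub_const 1).norm
  rw [sub_self, norm_zero] at h1
  refine h1.congr fun y => ?_
  have h2 : L y ≠ 0 := fun h0 => by simpa [h0] using hL1 y
  rw [← div_self h2, ← sub_div, norm_div, hL1 y, div_one]

/-- Close to the pole, `D` is asymptotic to minus the derivative of the main term of `G`. Only the
values of `L` at two fixed multiples of `y` enter, so no uniformity in the slow oscillation of `L`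
is needed. -/
theorem eventually_near (h : LogConvolution ℓ g b e B) (hL : SlowlyOscillating L)
    (hL1 : ∀ x, ‖L x‖ = 1) (hG : SeriesAsymptotic ℓ g C α L) {K ε : ℝ} (hK : 0 < K)
    (hε : 0 < ε) :
    ∀ᶠ y in atTop, ∀ τ : ℝ, |τ - α| ≤ K / y →
      ‖dseries ℓ (fun i => g i * ℓ i) (point y τ) -
        C * L y / (point y τ - (1 + Complex.I * α)) ^ 2‖ ≤ ε * y ^ 2 := by
  have hB := h.B_nonneg
  set A := ‖C‖ + 24 * B + 1 with hA
  have hA0 : 0 < A := by positivity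
  -- The step `δ / y` of the finite difference costs `A δ y ^ 2`. With `δ` fixed, the error `ε₁ y`
  -- in the hypothesis is divided by the step, so `ε₁` has to be small compared with `δ`.
  set δ := ε / (2 * A) with hδ
  have hδ0 : 0 < δ := by positivity
  set ε₁ := ε * δ / (4 * (‖C‖ + 2)) with hε₁
  have hε₁0 : 0 < ε₁ := by positivity
  have hu : 0 < 1 / (1 + δ) := by positivity
  have t1 := hG (|α| + K) ε₁ hε₁0
  have t2 : Tendsto (fun y : ℝ => 1 / (1 + δ) * y) atTop atTop :=
    tendsto_id.const_mul_atTop hu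
  have t3 := (norm_sub_tendsto hL hL1 hu).eventually (gt_mem_nhds hε₁0)
  filter_upwards [t1, t2.eventually t1, t3, eventually_ge_atTop 1] with y a1 a2 a3 hy τ hτ
  have hy0 : 0 < y := by linarith
  have hτ' : |τ| ≤ |α| + K := by
    have e1 : K / y ≤ K := div_le_self hK.le hy
    have e2 : |τ| ≤ |α| + |τ - α| := by
      have := abs_add_le α (τ - α)
      rwa [add_sub_cancel] at this
    linarith
  have b1 := a1 τ hτ'
  have b2 := a2 τ hτ'
  -- Moving by `δ / y` to the right amounts to replacing `y` by `y / (1 + δ)`.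
  have hp : point (1 / (1 + δ) * y) τ = point y τ + (δ / y : ℝ) := by
    simp only [point]
    have : 1 + 1 / (1 / (1 + δ) * y) = 1 + 1 / y + δ / y := by
      field_simp
      ring
    rw [this]
    push_cast
    ring
  have hle1 : 1 / (1 + δ) * y ≤ y := by
    refine mul_le_of_le_one_left hy0.le ?_
    rw [div_le_one (by positivity)]
    linarith
  rw [hp] at b2
  set s := point y τ with hs
  set η : ℝ := δ / y with hη
  have hη0 : 0 < η := by positivity
  set a := s - (1 + Complex.I * α) with ha
  have ha' : s + (η : ℂ) - (1 + Complex.I * α) = a + η := by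
    rw [ha]
    ring
  rw [ha'] at b2
  have na : 1 / y ≤ ‖a‖ := inv_le_norm_point_sub hy0 τ α
  have na' : 1 / y ≤ ‖a + η‖ := by
    have e1 := Complex.re_le_norm (a + η)
    have e2 : (a + η).re = 1 / y + η := by
      rw [ha, hs, point_sub]
      simp
    rw [e2] at e1
    linarith
  have hypos : 0 < 1 / y := by positivity
  have ha0 : a ≠ 0 := norm_pos_iff.mp (by linarith)
  have ha0' : a + η ≠ 0 := norm_pos_iff.mp (by linarith)
  have ia : ‖a⁻¹‖ ≤ y := by
    rw [norm_inv]
    refine inv_le_of_inv_le₀ hy0 ?_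
    rwa [← one_div]
  have ia' : ‖(a + η)⁻¹‖ ≤ y := by
    rw [norm_inv]
    refine inv_le_of_inv_le₀ hy0 ?_
    rwa [← one_div]
  have b3 := h.norm_finite_difference_le hy hδ0 τ
  rw [← hs, ← hη] at b3
  set D := dseries ℓ (fun i => g i * ℓ i) s with hD
  set G0 := dseries ℓ g s with hG0
  set G1 := dseries ℓ g (s + (η : ℂ)) with hG1
  set L1 := L (1 / (1 + δ) * y) with hL1'
  have hη' : (η : ℂ) ≠ 0 := by exact_mod_cast hη0.ne'
  have e : (η : ℂ) * (D - C * L y / a ^ 2) = (G1 - G0 + η * D) + (G0 - C / a * L y) -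
      (G1 - C / (a + η) * L1) - C * (a + η)⁻¹ * (L1 - L y) -
      η * η * C * L y * (a⁻¹ * a⁻¹ * (a + η)⁻¹) := by
    field_simp
    ring
  have n1 : ‖C * (a + η)⁻¹ * (L1 - L y)‖ ≤ ‖C‖ * y * ε₁ := by
    rw [norm_mul, norm_mul]
    gcongr
  have n2 : ‖(η : ℂ) * η * C * L y * (a⁻¹ * a⁻¹ * (a + η)⁻¹)‖ ≤ ‖C‖ * δ ^ 2 * y := by
    simp only [norm_mul, Complex.norm_real, Real.norm_of_nonneg hη0.le, hL1, mul_one]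
    calc η * η * ‖C‖ * (‖a⁻¹‖ * ‖a⁻¹‖ * ‖(a + η)⁻¹‖) ≤ η * η * ‖C‖ * (y * y * y) := by gcongr
      _ = _ := by
        rw [hη]
        field_simp
  have n3 : ‖(η : ℂ) * (D - C * L y / a ^ 2)‖ ≤ 24 * B * δ ^ 2 * y + ε₁ * y + ε₁ * y +
      ‖C‖ * y * ε₁ + ‖C‖ * δ ^ 2 * y := by
    rw [e]
    have b2' := b2.trans (mul_le_mul_of_nonneg_left hle1 hε₁0.le)
    refine (norm_sub_le _ _).trans (add_le_add ((norm_sub_le _ _).trans (add_le_add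
      ((norm_sub_le _ _).trans (add_le_add ((norm_add_le _ _).trans (add_le_add b3 b1)) b2')) n1))
      n2)
  rw [norm_mul, Complex.norm_real, Real.norm_of_nonneg hη0.le] at n3
  have n4 : η * ‖D - C * L y / a ^ 2‖ ≤ η * (ε * y ^ 2) := by
    refine n3.trans ?_
    have e1 : η * (ε * y ^ 2) = δ * ε * y := by
      rw [hη]
      field_simp
    have e2 : ε₁ * (‖C‖ + 2) = ε * δ / 4 := by
      rw [hε₁]
      field_simp
    have e3 : δ * A = ε / 2 := by
      rw [hδ]
      field_simp
    have e4 : 24 * B * δ ^ 2 * y + ε₁ * y + ε₁ * y + ‖C‖ * y * ε₁ + ‖C‖ * δ ^ 2 * y =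
        δ * (δ * A) * y - δ ^ 2 * y + (ε₁ * (‖C‖ + 2)) * y := by
      rw [hA]
      ring
    rw [e1, e4, e2, e3]
    have : 0 ≤ δ * ε * y := by positivity
    have : 0 ≤ δ ^ 2 * y := by positivity
    linarith
  exact le_of_mul_le_mul_left n4 hη0

end GeneralDirichlet.LogConvolution

/-! ### The mean square of the error transform -/

namespace laplace

open MeasureTheory

theorem integral_exp_mul {β s : ℂ} (hs : β.re < s.re) :
    laplace (fun u => if 0 ≤ u then Complex.exp (β * u) else 0) s = 1 / (s - β) := by
  have h := (GeneralDirichlet.integral_step (c := 1) (s := s - β) (by simpa using hs) 0).2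
  simp only [Complex.ofReal_zero, mul_zero, neg_zero, Complex.exp_zero, mul_one] at h
  rw [← h, laplace]
  refine integral_congr_ae (Filter.Eventually.of_forall fun u => ?_)
  simp only [ite_mul, zero_mul, one_mul]
  refine if_congr Iff.rfl ?_ rfl
  rw [← Complex.exp_add]
  ring_nf

theorem tendsto_mul_exp_neg {z : ℂ} (hz : 0 < z.re) (c : ℂ) :
    Filter.Tendsto (fun u : ℝ => -((u / z + c) * Complex.exp (-(z * u)))) Filter.atTop
      (nhds 0) := by
  have h1 := Real.tendsto_pow_mul_exp_neg_atTop_nhds_zero 1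
  have h2 := (h1.comp (Filter.tendsto_id.const_mul_atTop hz)).const_mul (‖z‖⁻¹ * z.re⁻¹)
  have h3 := ((Real.tendsto_exp_neg_atTop_nhds_zero).comp
    (Filter.tendsto_id.const_mul_atTop hz)).const_mul ‖c‖
  have h4 := h2.add h3
  simp only [mul_zero, add_zero] at h4
  refine squeeze_zero_norm' ?_ h4
  filter_upwards [Filter.eventually_ge_atTop 0] with u hu
  rw [norm_neg, norm_mul, norm_exp_neg]
  have h5 : ‖(u : ℂ) / z + c‖ ≤ ‖z‖⁻¹ * u + ‖c‖ := by
    refine (norm_add_le _ _).trans_eq ?_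
    rw [norm_div, Complex.norm_real, Real.norm_of_nonneg hu, div_eq_inv_mul]
  refine (mul_le_mul_of_nonneg_right h5 (Real.exp_nonneg _)).trans_eq ?_
  simp only [Function.comp_apply, id, pow_one]
  field_simp

theorem integral_mul_exp_mul {β s : ℂ} (hs : β.re < s.re) :
    laplace (fun u => if 0 ≤ u then u * Complex.exp (β * u) else 0) s = 1 / (s - β) ^ 2 := by
  set z := s - β with hz
  have hz0 : 0 < z.re := by simpa [hz] using hs
  have hzne : z ≠ 0 := fun h => by simp [h] at hz0
  have e1 : laplace (fun u => if 0 ≤ u then u * Complex.exp (β * u) else 0) s =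
      ∫ u : ℝ in Set.Ioi 0, u * Complex.exp (-(z * u)) := by
    rw [laplace, ← integral_Ici_eq_integral_Ioi, ← integral_indicator measurableSet_Ici]
    refine integral_congr_ae (Filter.Eventually.of_forall fun u => ?_)
    by_cases hu : 0 ≤ u
    · simp only [hu, if_true, Set.indicator_of_mem (Set.mem_Ici.mpr hu)]
      rw [mul_assoc, ← Complex.exp_add, hz]
      ring_nf
    · simp [hu]
  have hint : IntegrableOn (fun u : ℝ => (u : ℂ) * Complex.exp (-(z * u))) (Set.Ioi 0) := by
    have h1 := laplace.integrable (f := fun u : ℝ => if 0 ≤ u then (u : ℂ) else 0)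
      (B := 2 / z.re) (ρ := z.re / 2) (s := z)
      (Measurable.ite measurableSet_Ici (by fun_prop) measurable_const)
      (fun u hu => by simp [hu]) (fun u hu => ?_) (by linarith)
    · refine (h1.integrableOn (s := Set.Ioi 0)).congr_fun (fun u hu => ?_) measurableSet_Ioi
      simp [(Set.mem_Ioi.mp hu).le]
    · simp only [hu, if_true, Complex.norm_real, Real.norm_of_nonneg hu]
      have h2 := Real.add_one_le_exp (z.re / 2 * u)
      rw [div_mul_eq_mul_div, le_div_iff₀ hz0]
      linarith
  have hd : ∀ u ∈ Set.Ici (0 : ℝ), HasDerivAt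
      (fun u : ℝ => -(((u : ℂ) / z + 1 / z ^ 2) * Complex.exp (-(z * u))))
      ((u : ℂ) * Complex.exp (-(z * u))) u := by
    intro u _
    have h1 : HasDerivAt (fun u : ℝ => (u : ℂ)) 1 u := Complex.ofRealCLM.hasDerivAt
    have h2 := (((h1.div_const z).add_const (1 / z ^ 2)).mul ((h1.const_mul z).neg.cexp)).neg
    refine h2.congr_deriv ?_
    simp only [Pi.neg_apply]
    field_simp
    ring
  rw [e1, integral_Ioi_of_hasDerivAt_of_tendsto' hd hint (tendsto_mul_exp_neg hz0 _)]
  simp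

end laplace

namespace GeneralDirichlet.LogConvolution

open MeasureTheory Filter Topology

variable {ι : Type*} {ℓ : ι → ℝ} {g b e : ι → ℂ} {B : ℝ} {C : ℂ} {α : ℝ} {L : ℝ → ℂ}

theorem one_le_norm_one_add (α : ℝ) : 1 ≤ ‖1 + Complex.I * (α : ℂ)‖ := by
  have h1 := Complex.re_le_norm (1 + Complex.I * (α : ℂ))
  simpa using h1

theorem one_add_ne_zero (α : ℝ) : 1 + Complex.I * (α : ℂ) ≠ 0 :=
  norm_pos_iff.mp (zero_lt_one.trans_le (one_le_norm_one_add α))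

theorem norm_exp_beta (α u : ℝ) : ‖Complex.exp ((1 + Complex.I * α) * u)‖ = Real.exp u := by
  simp [Complex.norm_exp]

/-- The mean square of `1 / (s - β)` on a vertical line, `β = 1 + iα`. -/
theorem lintegral_inv_le (α : ℝ) {y : ℝ} (hy : 0 < y) :
    ∫⁻ τ : ℝ, ‖1 / (point y τ - (1 + Complex.I * α))‖ₑ ^ 2 ≤ ENNReal.ofReal (Real.pi * y) := by
  set f : ℝ → ℂ := fun u => if 0 ≤ u then Complex.exp ((1 + Complex.I * α) * u) else 0 with hf
  have h1 := laplace.lintegral_enorm_sq_le (f := f) (B := 1) (ρ := 1) (σ := 1 + 1 / y)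
    (Measurable.ite measurableSet_Ici (by fun_prop) measurable_const)
    (fun u hu => by simp [hf, hu])
    (fun u hu => by simp only [hf, hu, if_true]; rw [norm_exp_beta]; simp)
    (by simpa using hy)
  have h2 : ∀ τ : ℝ, laplace f (((1 + 1 / y : ℝ) : ℂ) + Complex.I * τ) =
      1 / (point y τ - (1 + Complex.I * α)) := by
    intro τ
    refine laplace.integral_exp_mul ?_
    have := one_lt_point_re hy τ
    simpa [point] using this
  simp only [h2] at h1
  refine h1.trans_eq (congrArg _ ?_)
  field_simp
  ring

theorem enorm_sq_eq (z : ℂ) : ‖z‖ₑ ^ 2 = ENNReal.ofReal (‖z‖ ^ 2) := by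
  rw [← ofReal_norm, ENNReal.ofReal_pow (norm_nonneg _)]

/-- The coefficient `C L(y) / (1 + iα)` of the main term at scale `y`. -/
noncomputable def mainCoeff (C : ℂ) (α : ℝ) (L : ℝ → ℂ) (y : ℝ) : ℂ :=
  C * L y / (1 + Complex.I * α)

theorem norm_mainCoeff_le (hL1 : ∀ x, ‖L x‖ = 1) (y : ℝ) : ‖mainCoeff C α L y‖ ≤ ‖C‖ := by
  rw [mainCoeff, norm_div, norm_mul, hL1, mul_one]
  exact div_le_self (norm_nonneg _) (one_le_norm_one_add α)

/-- The Laplace transform of `∑_{ℓ i ≤ u} g i ℓ i - c u e^{βu}` at the point `s = 1 + 1/y + iτ`,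
where `β = 1 + iα` and `c = C L(y) / β`. -/
noncomputable def errorTransform (ℓ : ι → ℝ) (g : ι → ℂ) (C : ℂ) (α : ℝ) (L : ℝ → ℂ) (y τ : ℝ) :
    ℂ :=
  dseries ℓ (fun i => g i * ℓ i) (point y τ) / point y τ -
    mainCoeff C α L y / (point y τ - (1 + Complex.I * α)) ^ 2

theorem eventually_near_errorTransform (h : LogConvolution ℓ g b e B) (hL : SlowlyOscillating L)
    (hL1 : ∀ x, ‖L x‖ = 1) (hG : SeriesAsymptotic ℓ g C α L) {K ε : ℝ} (hK : 0 < K)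
    (hε : 0 < ε) :
    ∀ᶠ y in atTop, ∀ τ : ℝ, |τ - α| ≤ K / y → ‖errorTransform ℓ g C α L y τ‖ ≤ ε * y ^ 2 := by
  filter_upwards [h.eventually_near hL hL1 hG hK (half_pos hε), eventually_gt_atTop 0,
    eventually_ge_atTop (2 * ‖C‖ * (1 + K) / ε)] with y h1 hy hyε τ hτ
  have h2 := h1 τ hτ
  set s := point y τ with hs
  set β := 1 + Complex.I * (α : ℂ) with hβ
  have ns : 1 ≤ ‖s‖ := one_le_norm_point hy τ
  have nβ : 1 ≤ ‖β‖ := one_le_norm_one_add α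
  have hs0 : s ≠ 0 := norm_pos_iff.mp (by linarith)
  have hβ0 : β ≠ 0 := one_add_ne_zero α
  have na : 1 / y ≤ ‖s - β‖ := inv_le_norm_point_sub hy τ α
  have nb : ‖s - β‖ ≤ (1 + K) / y := by
    refine (norm_point_sub_le hy τ α).trans ?_
    rw [add_div]
    linarith
  have hypos : 0 < 1 / y := by positivity
  have ha0 : s - β ≠ 0 := norm_pos_iff.mp (by linarith)
  have ia : ‖(s - β)⁻¹‖ ≤ y := by
    rw [norm_inv]
    refine inv_le_of_inv_le₀ hy ?_
    rwa [← one_div]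
  have e1 : errorTransform ℓ g C α L y τ = (dseries ℓ (fun i => g i * ℓ i) s -
      C * L y / (s - β) ^ 2) * s⁻¹ - C * L y * ((s - β)⁻¹ * (s - β)⁻¹) * (s - β) * (s⁻¹ * β⁻¹) := by
    rw [errorTransform, mainCoeff, ← hs, ← hβ]
    field_simp
    ring
  have is : ‖s⁻¹‖ ≤ 1 := by
    rw [norm_inv]
    exact inv_le_one_of_one_le₀ ns
  have iβ : ‖β⁻¹‖ ≤ 1 := by
    rw [norm_inv]
    exact inv_le_one_of_one_le₀ nβ
  rw [e1]
  refine (norm_sub_le _ _).trans ?_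
  simp only [norm_mul, hL1, mul_one]
  rw [div_le_iff₀ hε] at hyε
  calc _ ≤ ε / 2 * y ^ 2 * 1 + ‖C‖ * (y * y) * ((1 + K) / y) * (1 * 1) := by gcongr
    _ = ε / 2 * y ^ 2 + ‖C‖ * (1 + K) * y := by field_simp
    _ ≤ _ := by nlinarith

/-- The mean square of the error transform on the line `Re s = 1 + 1/y` is `o(y³)`: the range near
`1 + iα` is controlled by the asymptotics of `D`, the middle range by `D = G S + E` and the
smallness of `G`, the far range by twisting. -/
theorem eventually_lintegral_errorTransform_le (h : LogConvolution ℓ g b e B)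
    (hL : SlowlyOscillating L) (hL1 : ∀ x, ‖L x‖ = 1) (hG : SeriesAsymptotic ℓ g C α L) {ε : ℝ}
    (hε : 0 < ε) :
    ∀ᶠ y in atTop, ∫⁻ τ : ℝ, ‖errorTransform ℓ g C α L y τ‖ₑ ^ 2 ≤
      ENNReal.ofReal (ε * y ^ 3) := by
  obtain ⟨η, hη0, hη⟩ : ∃ η : ℝ, 0 < η ∧
      η ^ 2 * (4 + 2 * Real.pi + 8 * Real.pi * B ^ 2) ≤ ε := by
    set Q := 4 + 2 * Real.pi + 8 * Real.pi * B ^ 2 with hQ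
    have hQ0 : 0 < Q := by positivity
    refine ⟨√(ε / Q), by positivity, ?_⟩
    rw [Real.sq_sqrt (by positivity)]
    field_simp
    exact le_rfl
  -- `K` is so large that the main term of `G` is at most `η y / 2` when `|τ - α| ≥ K / y`.
  set K := 1 + 3 * ‖C‖ / η with hK
  have hK1 : 1 ≤ K := by
    rw [hK]
    have : 0 ≤ 3 * ‖C‖ / η := by positivity
    linarith
  have hK0 : 0 < K := by linarith
  have hCK : ‖C‖ / K ≤ η / 2 := by
    rw [div_le_iff₀ hK0, hK]
    have : η / 2 * (1 + 3 * ‖C‖ / η) = η / 2 + (3 / 2) * ‖C‖ := by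
      field_simp
    rw [this]
    linarith [norm_nonneg C]
  obtain ⟨M, hM0, hM⟩ := h.exists_far (ε := η ^ 2) (by positivity)
  filter_upwards [h.eventually_near_errorTransform hL hL1 hG hK0 (ε := η / K) (by positivity),
    hG M (η / 2) (by positivity), eventually_ge_atTop 1, eventually_ge_atTop (1 / η)]
    with y near mid hy hyη
  have hy0 : 0 < y := by linarith
  set D := fun τ => dseries ℓ (fun i => g i * ℓ i) (point y τ) with hD
  set N : Set ℝ := {τ | |τ - α| ≤ K / y} with hN
  have hNI : N = Set.Icc (α - K / y) (α + K / y) := by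
    ext τ
    simp only [hN, Set.mem_ofPred_eq, abs_le, Set.mem_Icc]
    constructor <;> rintro ⟨h1, h2⟩ <;> constructor <;> linarith
  have hNm : MeasurableSet N := by
    rw [hNI]
    exact measurableSet_Icc
  have hvol : volume N = ENNReal.ofReal (2 * K / y) := by
    rw [hNI, Real.volume_Icc]
    congr 1
    ring
  set F : Set ℝ := {τ | M < |τ|} with hF
  have hFm : MeasurableSet F := measurableSet_lt measurable_const (by fun_prop)
  -- `N` is the near range and `F` the far range. Outside `N`, the two terms of the error transform
  -- are estimated separately.
  have hN1 : ∫⁻ τ in N, ‖errorTransform ℓ g C α L y τ‖ₑ ^ 2 ≤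
      ENNReal.ofReal (2 * η ^ 2 * y ^ 3) := by
    calc ∫⁻ τ in N, ‖errorTransform ℓ g C α L y τ‖ₑ ^ 2
        ≤ ∫⁻ τ in N, ENNReal.ofReal ((η / K * y ^ 2) ^ 2) := by
          refine setLIntegral_mono' hNm fun τ hτ => ?_
          rw [enorm_sq_eq]
          exact ENNReal.ofReal_le_ofReal (pow_le_pow_left₀ (norm_nonneg _) (near τ hτ) 2)
      _ = ENNReal.ofReal (2 * η ^ 2 * y ^ 3 / K) := by
          rw [setLIntegral_const, hvol, ← ENNReal.ofReal_mul (by positivity)]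
          congr 1
          field_simp
      _ ≤ _ := ENNReal.ofReal_le_ofReal (div_le_self (by positivity) hK1)
  have hN2 : ∫⁻ τ in Nᶜ, ‖D τ / point y τ‖ₑ ^ 2 ≤
      ENNReal.ofReal (4 * Real.pi * B ^ 2 * η ^ 2 * y ^ 3 + η ^ 2 * y ^ 3) := by
    have hsub : Nᶜ ⊆ (Nᶜ ∩ Fᶜ) ∪ F := by
      intro τ hτ
      by_cases h1 : τ ∈ F
      · exact Or.inr h1
      · exact Or.inl ⟨hτ, h1⟩
    refine (lintegral_mono_set hsub).trans ((lintegral_union_le _ _ _).trans ?_)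
    rw [ENNReal.ofReal_add (by positivity) (by positivity)]
    refine add_le_add ?_ (hM y hy)
    refine (h.setLIntegral_mid hy (hNm.compl.inter hFm.compl) (ε := η) ?_).trans
      (ENNReal.ofReal_le_ofReal ?_)
    · rintro τ ⟨h1, h2⟩
      simp only [hN, hF, Set.mem_compl_iff, Set.mem_ofPred_eq, not_le, not_lt] at h1 h2
      have h3 := mid τ h2
      have h4 : ‖C / (point y τ - (1 + Complex.I * α)) * L y‖ ≤ η / 2 * y := by
        rw [norm_mul, hL1, mul_one, norm_div]
        have h5 : K / y ≤ ‖point y τ - (1 + Complex.I * α)‖ :=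
          h1.le.trans (abs_sub_le_norm_point_sub y τ α)
        calc _ ≤ ‖C‖ / (K / y) := by gcongr
          _ = ‖C‖ / K * y := by field_simp
          _ ≤ _ := by gcongr
      have h6 := norm_add_le (dseries ℓ g (point y τ) -
        C / (point y τ - (1 + Complex.I * α)) * L y) (C / (point y τ - (1 + Complex.I * α)) * L y)
      rw [sub_add_cancel] at h6
      linarith
    · have h1 : y ≤ η ^ 2 * y ^ 3 := by
        have h2 : 1 ≤ η * y := by
          rw [div_le_iff₀ hη0] at hyη
          linarith
        have h3 : 1 ≤ (η * y) ^ 2 := one_le_pow₀ h2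
        nlinarith
      have h2 : 0 ≤ 2 * Real.pi * B ^ 2 := by positivity
      nlinarith [mul_le_mul_of_nonneg_left h1 h2]
  have hN3 : ∫⁻ τ in Nᶜ, ‖mainCoeff C α L y / (point y τ - (1 + Complex.I * α)) ^ 2‖ₑ ^ 2 ≤
      ENNReal.ofReal (Real.pi * η ^ 2 * y ^ 3) := by
    calc _ ≤ ∫⁻ τ in Nᶜ, ENNReal.ofReal ((η * y) ^ 2) *
          ‖1 / (point y τ - (1 + Complex.I * α))‖ₑ ^ 2 := by
          refine setLIntegral_mono' hNm.compl fun τ hτ => ?_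
          rw [enorm_sq_eq, enorm_sq_eq, ← ENNReal.ofReal_mul (by positivity), ← mul_pow]
          refine ENNReal.ofReal_le_ofReal (pow_le_pow_left₀ (norm_nonneg _) ?_ 2)
          simp only [hN, Set.mem_compl_iff, Set.mem_ofPred_eq, not_le] at hτ
          have h5 : K / y ≤ ‖point y τ - (1 + Complex.I * α)‖ :=
            hτ.le.trans (abs_sub_le_norm_point_sub y τ α)
          have e1 : mainCoeff C α L y / (point y τ - (1 + Complex.I * α)) ^ 2 =
            mainCoeff C α L y / (point y τ - (1 + Complex.I * α)) *
              (1 / (point y τ - (1 + Complex.I * α))) := by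
            rw [sq, ← div_div, div_eq_mul_one_div]
          rw [e1, norm_mul]
          refine mul_le_mul_of_nonneg_right ?_ (norm_nonneg _)
          rw [norm_div]
          calc _ ≤ ‖C‖ / (K / y) := by
                gcongr
                exact norm_mainCoeff_le hL1 y
            _ = ‖C‖ / K * y := by field_simp
            _ ≤ _ := by
                gcongr
                linarith
      _ ≤ ∫⁻ τ, ENNReal.ofReal ((η * y) ^ 2) *
          ‖1 / (point y τ - (1 + Complex.I * α))‖ₑ ^ 2 := setLIntegral_le_lintegral _ _
      _ ≤ ENNReal.ofReal ((η * y) ^ 2) * ENNReal.ofReal (Real.pi * y) := by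
          rw [lintegral_const_mul' _ _ ENNReal.ofReal_ne_top]
          exact mul_le_mul_right (lintegral_inv_le α hy0) _
      _ = _ := by
          rw [← ENNReal.ofReal_mul (by positivity)]
          congr 1
          ring
  have hDm : Measurable fun τ => ENNReal.ofReal 2 * ‖D τ / point y τ‖ₑ ^ 2 := by
    have hc : Continuous fun τ => D τ / point y τ :=
      continuous_dseries_div h.finite h.nonneg (h.norm_gl_le hy0) (by positivity) (half_lt hy0)
    exact (hc.measurable.enorm.pow_const 2).const_mul _
  have hNc : ∫⁻ τ in Nᶜ, ‖errorTransform ℓ g C α L y τ‖ₑ ^ 2 ≤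
      ENNReal.ofReal (2 * (4 * Real.pi * B ^ 2 * η ^ 2 * y ^ 3 + η ^ 2 * y ^ 3) +
        2 * (Real.pi * η ^ 2 * y ^ 3)) := by
    calc _ ≤ ∫⁻ τ in Nᶜ, (ENNReal.ofReal 2 * ‖D τ / point y τ‖ₑ ^ 2 + ENNReal.ofReal 2 *
          ‖mainCoeff C α L y / (point y τ - (1 + Complex.I * α)) ^ 2‖ₑ ^ 2) := by
          refine lintegral_mono fun τ => ?_
          simp only [enorm_sq_eq]
          rw [← ENNReal.ofReal_mul (by positivity), ← ENNReal.ofReal_mul (by positivity),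
            ← ENNReal.ofReal_add (by positivity) (by positivity)]
          refine ENNReal.ofReal_le_ofReal ?_
          refine (pow_le_pow_left₀ (norm_nonneg _) (norm_sub_le _ _) 2).trans ?_
          have := add_sq_le (a := ‖D τ / point y τ‖)
            (b := ‖mainCoeff C α L y / (point y τ - (1 + Complex.I * α)) ^ 2‖)
          simp only [hD] at this ⊢
          linarith
      _ = ENNReal.ofReal 2 * (∫⁻ τ in Nᶜ, ‖D τ / point y τ‖ₑ ^ 2) + ENNReal.ofReal 2 *
          ∫⁻ τ in Nᶜ, ‖mainCoeff C α L y / (point y τ - (1 + Complex.I * α)) ^ 2‖ₑ ^ 2 := by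
          rw [lintegral_add_left hDm, lintegral_const_mul' _ _ ENNReal.ofReal_ne_top,
            lintegral_const_mul' _ _ ENNReal.ofReal_ne_top]
      _ ≤ ENNReal.ofReal 2 *
            ENNReal.ofReal (4 * Real.pi * B ^ 2 * η ^ 2 * y ^ 3 + η ^ 2 * y ^ 3) +
          ENNReal.ofReal 2 * ENNReal.ofReal (Real.pi * η ^ 2 * y ^ 3) := by gcongr
      _ = _ := by
          rw [← ENNReal.ofReal_mul (by positivity), ← ENNReal.ofReal_mul (by positivity),
            ← ENNReal.ofReal_add (by positivity) (by positivity)]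
  rw [← lintegral_add_compl _ hNm]
  refine (add_le_add hN1 hNc).trans ?_
  rw [← ENNReal.ofReal_add (by positivity) (by positivity)]
  refine ENNReal.ofReal_le_ofReal ?_
  have := mul_le_mul_of_nonneg_right hη (by positivity : 0 ≤ y ^ 3)
  linarith

end GeneralDirichlet.LogConvolution

/-! ### The mean deviation of the partial sums -/

namespace GeneralDirichlet.LogConvolution

open MeasureTheory Filter Topology

variable {ι : Type*} {ℓ : ι → ℝ} {g b e : ι → ℂ} {B : ℝ} {C : ℂ} {α : ℝ} {L : ℝ → ℂ}

/-- The sum equals the integral of the counting function over `[0, u]`. -/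
theorem partialSum_sub_le (h : LogConvolution ℓ g b e B) {u : ℝ} (hu : 0 ≤ u) :
    partialSum h.finite (fun i => u - ℓ i) u ≤ B * Real.exp u := by
  have hB := h.B_nonneg
  have h1 : ∀ i ∈ (h.finite u).toFinset, ∫ v in Set.Icc 0 u, (Set.Ici (ℓ i)).indicator
      (fun _ => (1 : ℝ)) v = u - ℓ i := by
    intro i hi
    have hi' : ℓ i ≤ u := by simpa using hi
    rw [setIntegral_indicator measurableSet_Ici, setIntegral_const]
    have : Set.Icc 0 u ∩ Set.Ici (ℓ i) = Set.Icc (ℓ i) u := by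
      ext v
      simp only [Set.mem_inter_iff, Set.mem_Icc, Set.mem_Ici]
      have := h.nonneg i
      constructor
      · rintro ⟨⟨h1, h2⟩, h3⟩
        exact ⟨h3, h2⟩
      · rintro ⟨h1, h2⟩
        exact ⟨⟨by linarith, h2⟩, h1⟩
    rw [this, Real.volume_real_Icc_of_le hi', smul_eq_mul, mul_one]
  have hint : ∀ i, IntegrableOn ((Set.Ici (ℓ i)).indicator (fun _ => (1 : ℝ))) (Set.Icc 0 u) :=
    fun i => (integrableOn_const (by simp)).indicator measurableSet_Ici
  rw [partialSum, ← Finset.sum_congr rfl h1, ← integral_finsetSum _ fun i _ => hint i]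
  calc _ ≤ ∫ v in Set.Icc 0 u, B * Real.exp v := by
        refine setIntegral_mono_on (integrable_finsetSum _ fun i _ => hint i)
          (Continuous.integrableOn_Icc (by fun_prop)) measurableSet_Icc fun v hv => ?_
        refine le_trans (le_of_eq ?_) (h.count_le v hv.1)
        rw [partialSum_eq_sum_ite h.finite _ hv.2]
        rfl
    _ = B * (Real.exp u - 1) := by
        rw [integral_Icc_eq_integral_Ioc, ← intervalIntegral.integral_of_le hu,
          intervalIntegral.integral_const_mul, integral_exp, Real.exp_zero]
    _ ≤ _ := by nlinarith

/-- Partial summation: the sums of `g i * ℓ i` and of `g i`. -/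
theorem norm_partialSum_mul_sub_le (h : LogConvolution ℓ g b e B) {u : ℝ} (hu : 0 ≤ u) :
    ‖partialSum h.finite (fun i => g i * ℓ i) u - u * partialSum h.finite g u‖ ≤
      B * Real.exp u := by
  refine le_trans ?_ (h.partialSum_sub_le hu)
  rw [partialSum, partialSum, Finset.mul_sum, ← Finset.sum_sub_distrib]
  refine norm_sum_le_of_le _ fun i hi => ?_
  have hi' : ℓ i ≤ u := by simpa using hi
  have e1 : g i * ℓ i - u * g i = g i * ((ℓ i - u : ℝ) : ℂ) := by
    push_cast
    ring
  rw [e1, norm_mul, Complex.norm_real, Real.norm_eq_abs, abs_sub_comm,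
    abs_of_nonneg (by linarith)]
  exact mul_le_of_le_one_left (by linarith) (h.norm_le_one i)

/-- The normalized deviation `e^{-u} (∑_{ℓ i ≤ u} g i - c e^{βu})` for `u ≥ 0`, extended by zero;
here `β = 1 + iα` and `c = C L(y) / β`. -/
noncomputable def deviation (hℓ : ∀ x, {i | ℓ i ≤ x}.Finite) (g : ι → ℂ) (C : ℂ) (α : ℝ)
    (L : ℝ → ℂ) (y u : ℝ) : ℂ :=
  if 0 ≤ u then Real.exp (-u) * partialSum hℓ g u -
    mainCoeff C α L y * Complex.exp (Complex.I * α * u) else 0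

theorem norm_exp_I (α u : ℝ) : ‖Complex.exp (Complex.I * α * u)‖ = 1 := by
  simp [Complex.norm_exp]

theorem measurable_deviation (hℓ : ∀ x, {i | ℓ i ≤ x}.Finite) (y : ℝ) :
    Measurable (deviation hℓ g C α L y) :=
  Measurable.ite measurableSet_Ici (((by fun_prop : Measurable fun u : ℝ =>
    ((Real.exp (-u) : ℝ) : ℂ)).mul (measurable_partialSum hℓ g)).sub (by fun_prop))
    measurable_const

theorem norm_deviation_le (h : LogConvolution ℓ g b e B) (hL1 : ∀ x, ‖L x‖ = 1) (y u : ℝ) :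
    ‖deviation h.finite g C α L y u‖ ≤ B + ‖C‖ := by
  have hB := h.B_nonneg
  rw [deviation]
  split_ifs with hu
  · refine (norm_sub_le _ _).trans (add_le_add ?_ ?_)
    · rw [norm_mul, Complex.norm_real, Real.norm_of_nonneg (Real.exp_nonneg _)]
      refine (mul_le_mul_of_nonneg_left (h.norm_partialSum_g_le u) (Real.exp_nonneg _)).trans_eq ?_
      rw [mul_left_comm, ← Real.exp_add, neg_add_cancel, Real.exp_zero, mul_one]
    · rw [norm_mul, norm_exp_I, mul_one]
      exact norm_mainCoeff_le hL1 y
  · rw [norm_zero]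
    positivity

/-- The function whose Laplace transform is the error transform. -/
noncomputable def weightedError (hℓ : ∀ x, {i | ℓ i ≤ x}.Finite) (g : ι → ℂ) (C : ℂ) (α : ℝ)
    (L : ℝ → ℂ) (y u : ℝ) : ℂ :=
  partialSum hℓ (fun i => g i * ℓ i) u -
    mainCoeff C α L y * (if 0 ≤ u then u * Complex.exp ((1 + Complex.I * α) * u) else 0)

theorem le_exp_div {y u : ℝ} (hy : 0 < y) : u ≤ 2 * y * Real.exp (1 / (2 * y) * u) := by
  have := Real.add_one_le_exp (1 / (2 * y) * u)
  have h2 : u = 2 * y * (1 / (2 * y) * u) := by field_simp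
  calc u = 2 * y * (1 / (2 * y) * u) := h2
    _ ≤ _ := by gcongr; linarith

theorem norm_weightedError_le (h : LogConvolution ℓ g b e B) (hL1 : ∀ x, ‖L x‖ = 1) {y : ℝ}
    (hy : 0 < y) (u : ℝ) (hu : 0 ≤ u) :
    ‖weightedError h.finite g C α L y u‖ ≤
      (2 * y * B + ‖C‖ * (2 * y)) * Real.exp ((1 + 1 / (2 * y)) * u) := by
  rw [weightedError, add_mul (2 * y * B)]
  refine (norm_sub_le _ _).trans (add_le_add ?_ ?_)
  · exact (norm_partialSum_le h.finite _ u).trans (h.norm_gl_le hy u hu)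
  · rw [if_pos hu, norm_mul, norm_mul, norm_exp_beta, Complex.norm_real, Real.norm_of_nonneg hu,
      add_mul, Real.exp_add, one_mul]
    calc _ ≤ ‖C‖ * (2 * y * Real.exp (1 / (2 * y) * u) * Real.exp u) := by
          gcongr
          · exact norm_mainCoeff_le hL1 y
          · exact le_exp_div hy
      _ = _ := by ring

theorem measurable_weightedError (hℓ : ∀ x, {i | ℓ i ≤ x}.Finite) (y : ℝ) :
    Measurable (weightedError hℓ g C α L y) :=
  (measurable_partialSum hℓ _).sub
    ((Measurable.ite measurableSet_Ici (by fun_prop) measurable_const).const_mul _)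

theorem laplace_weightedError (h : LogConvolution ℓ g b e B) {y : ℝ} (hy : 0 < y) (τ : ℝ) :
    laplace (weightedError h.finite g C α L y) (point y τ) = errorTransform ℓ g C α L y τ := by
  have hre : 1 + 1 / (2 * y) < (point y τ).re := by
    rw [point_re]
    exact half_lt hy
  have hre1 := one_lt_point_re hy τ
  have i1 := laplace.integrable (s := point y τ) (measurable_partialSum h.finite fun i => g i * ℓ i)
    (fun u hu => partialSum_eq_zero h.finite h.nonneg _ hu)
    (fun u hu => (norm_partialSum_le h.finite _ u).trans (h.norm_gl_le hy u hu)) hre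
  have i2 := laplace.integrable (s := point y τ) (B := 2 * y)
    (f := fun u => if 0 ≤ u then u * Complex.exp ((1 + Complex.I * α) * u) else 0)
    (Measurable.ite measurableSet_Ici (by fun_prop) measurable_const)
    (fun u hu => by simp [hu]) (fun u hu => by
      rw [if_pos hu, norm_mul, norm_exp_beta, Complex.norm_real, Real.norm_of_nonneg hu, add_mul,
        add_comm, Real.exp_add, one_mul, ← mul_assoc]
      gcongr
      exact le_exp_div hy) hre
  have e1 := laplace.integral_mul_exp_mul (β := 1 + Complex.I * α) (s := point y τ)
    (by simpa using hy)
  have e2 := dseries_eq_laplace h.finite h.nonneg (h.norm_gl_le hy) (by positivity) hre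
  rw [errorTransform, e2, div_eq_mul_one_div (mainCoeff C α L y), ← e1, laplace, laplace, laplace,
    ← integral_const_mul, ← integral_sub i1 (i2.const_mul _)]
  refine integral_congr_ae (Filter.Eventually.of_forall fun u => ?_)
  simp only [weightedError]
  ring

theorem eventually_lintegral_weightedError_le (h : LogConvolution ℓ g b e B)
    (hL : SlowlyOscillating L) (hL1 : ∀ x, ‖L x‖ = 1) (hG : SeriesAsymptotic ℓ g C α L) {ε : ℝ}
    (hε : 0 < ε) :
    ∀ᶠ y in atTop, ∫⁻ u : ℝ, ‖weightedError h.finite g C α L y u *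
      Complex.exp (-(((1 + 1 / y : ℝ) : ℂ) * u))‖ₑ ^ 2 ≤ ENNReal.ofReal (ε * y ^ 3) := by
  filter_upwards [h.eventually_lintegral_errorTransform_le hL hL1 hG hε, eventually_gt_atTop 0]
    with y h1 hy
  have h2 := laplace.lintegral_enorm_sq (σ := 1 + 1 / y)
    (measurable_weightedError (g := g) (C := C) (α := α) (L := L) h.finite y)
    (fun u hu => by
      rw [weightedError, partialSum_eq_zero h.finite h.nonneg _ hu, if_neg (not_le.mpr hu)]
      simp)
    (h.norm_weightedError_le hL1 hy) (half_lt hy)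
  have h3 : ∀ τ : ℝ, laplace (weightedError h.finite g C α L y)
      (((1 + 1 / y : ℝ) : ℂ) + Complex.I * τ) = errorTransform ℓ g C α L y τ :=
    fun τ => h.laplace_weightedError hy τ
  simp only [h3] at h2
  rw [h2] at h1
  refine le_trans ?_ h1
  have h4 : (1 : ENNReal) ≤ ENNReal.ofReal (2 * Real.pi) := by
    rw [ENNReal.one_le_ofReal]
    linarith [Real.pi_gt_three]
  calc _ = 1 * _ := (one_mul _).symm
    _ ≤ _ := mul_le_mul_left h4 _

/-- Away from the origin the deviation is controlled by the weighted error. The bound is quadratic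
in the weighted error, to fit Plancherel's theorem; the linear bound is converted by the inequality
of arithmetic and geometric means. -/
theorem norm_deviation_le_weightedError (h : LogConvolution ℓ g b e B) {y δ u : ℝ} (hy : 0 < y)
    (hδ : 0 < δ) (hu : δ * y ≤ u) (hu2 : u ≤ 2 * y) :
    ‖deviation h.finite g C α L y u‖ ≤ 9 * δ + B / (δ * y) + 9 / (δ ^ 3 * y ^ 2) *
      ‖weightedError h.finite g C α L y u * Complex.exp (-(((1 + 1 / y : ℝ) : ℂ) * u))‖ ^ 2 := by
  have hu0 : 0 < u := lt_of_lt_of_le (by positivity) hu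
  have hB := h.B_nonneg
  set W := weightedError h.finite g C α L y u with hW
  set X := ‖W * Complex.exp (-(((1 + 1 / y : ℝ) : ℂ) * u))‖ with hX
  have hX0 : 0 ≤ X := norm_nonneg _
  have e1 : (u : ℂ) * deviation h.finite g C α L y u = Real.exp (-u) * (W -
      (partialSum h.finite (fun i => g i * ℓ i) u - u * partialSum h.finite g u)) := by
    rw [deviation, if_pos hu0.le, hW, weightedError, if_pos hu0.le, add_mul, Complex.exp_add]
    have : (Real.exp (-u) : ℂ) * Complex.exp (1 * u) = 1 := by
      rw [Complex.ofReal_exp, ← Complex.exp_add]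
      simp
    linear_combination (mainCoeff C α L y * u * Complex.exp (Complex.I * α * u)) * this
  have e2 : Real.exp (-u) * ‖W‖ ≤ 9 * X := by
    rw [hX, norm_term, Complex.ofReal_re]
    have : Real.exp (-u) = Real.exp (u / y) * Real.exp (-((1 + 1 / y) * u)) := by
      rw [← Real.exp_add]
      ring_nf
    rw [this]
    have h9 : Real.exp (u / y) ≤ 9 := by
      calc Real.exp (u / y) ≤ Real.exp 2 := by
            gcongr
            rwa [div_le_iff₀ hy]
        _ = Real.exp 1 ^ 2 := by rw [← Real.exp_nat_mul]; norm_num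
        _ ≤ 3 ^ 2 := by
            gcongr
            exact Real.exp_one_lt_three.le
        _ = 9 := by norm_num
    calc _ ≤ 9 * Real.exp (-((1 + 1 / y) * u)) * ‖W‖ := by gcongr
      _ = _ := by ring
  have e3 : u * ‖deviation h.finite g C α L y u‖ ≤ 9 * X + B := by
    have := congrArg norm e1
    rw [norm_mul, norm_mul, Complex.norm_real, Complex.norm_real, Real.norm_of_nonneg hu0.le,
      Real.norm_of_nonneg (Real.exp_nonneg _)] at this
    rw [this]
    calc _ ≤ Real.exp (-u) * (‖W‖ + B * Real.exp u) := by
          gcongr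
          exact (norm_sub_le _ _).trans
            (add_le_add le_rfl (h.norm_partialSum_mul_sub_le hu0.le))
      _ = Real.exp (-u) * ‖W‖ + B := by
          rw [mul_add, mul_left_comm, ← Real.exp_add, neg_add_cancel, Real.exp_zero, mul_one]
      _ ≤ _ := by linarith
  have e4 : X ≤ δ ^ 2 * y + X ^ 2 / (δ ^ 2 * y) := by
    have h5 : 0 < δ ^ 2 * y := by positivity
    rw [← sub_le_iff_le_add', le_div_iff₀ h5]
    nlinarith [sq_nonneg (X - δ ^ 2 * y)]
  have e5 : δ * y * ‖deviation h.finite g C α L y u‖ ≤ 9 * X + B :=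
    (mul_le_mul_of_nonneg_right hu (norm_nonneg _)).trans e3
  rw [mul_comm, ← le_div_iff₀ (by positivity)] at e5
  refine e5.trans ?_
  calc (9 * X + B) / (δ * y) ≤ (9 * (δ ^ 2 * y + X ^ 2 / (δ ^ 2 * y)) + B) / (δ * y) := by gcongr
    _ = _ := by
      field_simp
      ring

/-- The deviation is small on average over `[0, 2y]`. -/
theorem eventually_integral_deviation_le (h : LogConvolution ℓ g b e B)
    (hL : SlowlyOscillating L) (hL1 : ∀ x, ‖L x‖ = 1) (hG : SeriesAsymptotic ℓ g C α L) {ε : ℝ}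
    (hε : 0 < ε) :
    ∀ᶠ y in atTop, ∫ u in Set.Icc 0 (2 * y), ‖deviation h.finite g C α L y u‖ ≤ ε * y := by
  have hB := h.B_nonneg
  set δ := ε / (3 * (B + ‖C‖ + 19)) with hδ
  have hδ0 : 0 < δ := by positivity
  filter_upwards [h.eventually_lintegral_weightedError_le hL hL1 hG
    (ε := ε * δ ^ 3 / 27) (by positivity), eventually_gt_atTop 0,
    eventually_ge_atTop (6 * B / (δ * ε))] with y h1 hy hyB
  set W := fun u : ℝ => weightedError h.finite g C α L y u *
    Complex.exp (-(((1 + 1 / y : ℝ) : ℂ) * u)) with hW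
  have hdm := measurable_deviation (g := g) (C := C) (α := α) (L := L) h.finite y
  rw [integral_norm_eq_lintegral_enorm hdm.aestronglyMeasurable]
  refine ENNReal.toReal_le_of_le_ofReal (by positivity) ?_
  have hsub : Set.Icc 0 (2 * y) ⊆ Set.Icc 0 (δ * y) ∪ Set.Icc (δ * y) (2 * y) := by
    intro u hu
    rcases le_total u (δ * y) with h2 | h2
    · exact Or.inl ⟨hu.1, h2⟩
    · exact Or.inr ⟨h2, hu.2⟩
  have p1 : ∫⁻ u in Set.Icc 0 (δ * y), ‖deviation h.finite g C α L y u‖ₑ ≤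
      ENNReal.ofReal ((B + ‖C‖) * (δ * y)) := by
    calc _ ≤ ∫⁻ u in Set.Icc 0 (δ * y), ENNReal.ofReal (B + ‖C‖) := by
          refine lintegral_mono fun u => ?_
          rw [← ofReal_norm]
          exact ENNReal.ofReal_le_ofReal (h.norm_deviation_le hL1 y u)
      _ = _ := by
          rw [setLIntegral_const, Real.volume_Icc, ← ENNReal.ofReal_mul (by positivity), sub_zero]
  have p2 : ∫⁻ u in Set.Icc (δ * y) (2 * y), ‖deviation h.finite g C α L y u‖ₑ ≤
      ENNReal.ofReal ((9 * δ + B / (δ * y)) * (2 * y) +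
        9 / (δ ^ 3 * y ^ 2) * (ε * δ ^ 3 / 27 * y ^ 3)) := by
    calc _ ≤ ∫⁻ u in Set.Icc (δ * y) (2 * y), (ENNReal.ofReal (9 * δ + B / (δ * y)) +
          ENNReal.ofReal (9 / (δ ^ 3 * y ^ 2)) * ‖W u‖ₑ ^ 2) := by
          refine setLIntegral_mono' measurableSet_Icc fun u hu => ?_
          rw [enorm_sq_eq, ← ofReal_norm, ← ENNReal.ofReal_mul (by positivity),
            ← ENNReal.ofReal_add (by positivity) (by positivity)]
          exact ENNReal.ofReal_le_ofReal (h.norm_deviation_le_weightedError hy hδ0 hu.1 hu.2)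
      _ = ENNReal.ofReal (9 * δ + B / (δ * y)) * volume (Set.Icc (δ * y) (2 * y)) +
          ENNReal.ofReal (9 / (δ ^ 3 * y ^ 2)) * ∫⁻ u in Set.Icc (δ * y) (2 * y), ‖W u‖ₑ ^ 2 := by
          rw [lintegral_add_left measurable_const, setLIntegral_const,
            lintegral_const_mul' _ _ ENNReal.ofReal_ne_top]
      _ ≤ ENNReal.ofReal (9 * δ + B / (δ * y)) * ENNReal.ofReal (2 * y) +
          ENNReal.ofReal (9 / (δ ^ 3 * y ^ 2)) * ENNReal.ofReal (ε * δ ^ 3 / 27 * y ^ 3) := by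
          gcongr
          · rw [Real.volume_Icc]
            refine ENNReal.ofReal_le_ofReal ?_
            have : 0 ≤ δ * y := by positivity
            linarith
          · exact (setLIntegral_le_lintegral _ _).trans h1
      _ = _ := by
          rw [← ENNReal.ofReal_mul (by positivity), ← ENNReal.ofReal_mul (by positivity),
            ← ENNReal.ofReal_add (by positivity) (by positivity)]
  refine (lintegral_mono_set hsub).trans ((lintegral_union_le _ _ _).trans
    ((add_le_add p1 p2).trans ?_))
  rw [← ENNReal.ofReal_add (by positivity) (by positivity)]
  refine ENNReal.ofReal_le_ofReal ?_
  have e1 : δ * (B + ‖C‖ + 19) = ε / 3 := by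
    rw [hδ]
    field_simp
  have e2 : (B + ‖C‖) * (δ * y) + ((9 * δ + B / (δ * y)) * (2 * y) +
      9 / (δ ^ 3 * y ^ 2) * (ε * δ ^ 3 / 27 * y ^ 3)) =
      δ * (B + ‖C‖ + 19) * y - δ * y + 2 * B / δ + ε / 3 * y := by
    field_simp
    ring
  rw [e2, e1]
  have e3 : 2 * B / δ ≤ ε / 3 * y := by
    rw [div_le_iff₀ (by positivity)] at hyB ⊢
    linarith
  have : 0 ≤ δ * y := by positivity
  linarith

end GeneralDirichlet.LogConvolution

/-! ### Normalized partial sums and the convolution identity -/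

namespace GeneralDirichlet.LogConvolution

open MeasureTheory Filter Topology

variable {ι : Type*} {ℓ : ι → ℝ} {g b e : ι → ℂ} {B : ℝ} {C : ℂ} {α : ℝ} {L : ℝ → ℂ}

/-- The normalized partial sum `e^{-βu} ∑_{ℓ i ≤ u} g i`, `β = 1 + iα`. -/
noncomputable def normalized (hℓ : ∀ x, {i | ℓ i ≤ x}.Finite) (g : ι → ℂ) (α u : ℝ) : ℂ :=
  Complex.exp (-((1 + Complex.I * α) * u)) * partialSum hℓ g u

/-- The sum `∑_{ℓ i ≤ u} b i e^{-βℓ i}`, `β = 1 + iα`. -/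
noncomputable def weightSum (hℓ : ∀ x, {i | ℓ i ≤ x}.Finite) (b : ι → ℂ) (α u : ℝ) : ℂ :=
  partialSum hℓ (fun i => b i * Complex.exp (-((1 + Complex.I * α) * ℓ i))) u

theorem norm_exp_neg_beta (α u : ℝ) :
    ‖Complex.exp (-((1 + Complex.I * α) * u))‖ = Real.exp (-u) := by
  simp [Complex.norm_exp]

theorem norm_deviation_eq (hℓ : ∀ x, {i | ℓ i ≤ x}.Finite) {y u : ℝ} (hu : 0 ≤ u) :
    ‖deviation hℓ g C α L y u‖ = ‖normalized hℓ g α u - mainCoeff C α L y‖ := by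
  have : deviation hℓ g C α L y u =
      Complex.exp (Complex.I * α * u) * (normalized hℓ g α u - mainCoeff C α L y) := by
    rw [deviation, if_pos hu, normalized, mul_sub, ← mul_assoc, ← Complex.exp_add,
      Complex.ofReal_exp, mul_comm (mainCoeff C α L y)]
    congr 3
    push_cast
    ring
  rw [this, norm_mul, norm_exp_I, one_mul]

theorem norm_normalized_le (h : LogConvolution ℓ g b e B) (u : ℝ) :
    ‖normalized h.finite g α u‖ ≤ B := by
  rw [normalized, norm_mul, norm_exp_neg_beta]
  refine (mul_le_mul_of_nonneg_left (h.norm_partialSum_g_le u) (Real.exp_nonneg _)).trans_eq ?_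
  rw [mul_left_comm, ← Real.exp_add, neg_add_cancel, Real.exp_zero, mul_one]

/-- The weights `|b i| e^{-ℓ i}` with `ℓ i` in a bounded interval have bounded sum. -/
theorem sum_weight_le (h : LogConvolution ℓ g b e B) (T : Finset ι) {x η : ℝ}
    (hη1 : η ≤ 1) (hT : ∀ i ∈ T, x ≤ ℓ i ∧ ℓ i ≤ x + η) :
    ∑ i ∈ T, ‖b i‖ * Real.exp (-ℓ i) ≤ 3 * B := by
  have hB := h.B_nonneg
  rcases T.eq_empty_or_nonempty with rfl | ⟨j, hj⟩
  · simpa using hB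
  have hx : 0 ≤ x + η := (h.nonneg j).trans (hT j hj).2
  calc ∑ i ∈ T, ‖b i‖ * Real.exp (-ℓ i) ≤ ∑ i ∈ T, ‖b i‖ * Real.exp (-x) := by
        refine Finset.sum_le_sum fun i hi => ?_
        gcongr
        exact (hT i hi).1
    _ = (∑ i ∈ T, ‖b i‖) * Real.exp (-x) := (Finset.sum_mul _ _ _).symm
    _ ≤ (B * Real.exp (x + η)) * Real.exp (-x) := by
        gcongr
        refine le_trans ?_ (h.b_le _ hx)
        refine Finset.sum_le_sum_of_subset_of_nonneg (fun i hi => ?_) fun i _ _ => norm_nonneg _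
        simpa using (hT i hi).2
    _ = B * Real.exp η := by
        rw [mul_assoc, ← Real.exp_add]
        ring_nf
    _ ≤ B * 3 := by
        gcongr
        exact (Real.exp_le_exp.mpr hη1).trans Real.exp_one_lt_three.le
    _ = _ := mul_comm _ _

theorem norm_weightSum_sub_le_of_le_one (h : LogConvolution ℓ g b e B) {u v : ℝ} (huv : u ≤ v)
    (hv : v ≤ u + 1) : ‖weightSum h.finite b α v - weightSum h.finite b α u‖ ≤ 3 * B := by
  classical
  have hsub : (h.finite u).toFinset ⊆ (h.finite v).toFinset := by
    intro i hi
    simp only [Set.Finite.mem_toFinset, Set.mem_ofPred_eq] at hi ⊢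
    exact hi.trans huv
  rw [weightSum, weightSum, partialSum, partialSum, ← Finset.sum_sdiff hsub, add_sub_cancel_right]
  refine (norm_sum_le _ _).trans ?_
  simp only [norm_mul, norm_exp_neg_beta]
  refine h.sum_weight_le _ le_rfl (x := u) fun i hi => ?_
  simp only [Finset.mem_sdiff, Set.Finite.mem_toFinset, Set.mem_ofPred_eq, not_le] at hi
  exact ⟨hi.2.le, hi.1.trans hv⟩

/-- The function `weightSum` is Lipschitz at scales above `1`. -/
theorem norm_weightSum_sub_le (h : LogConvolution ℓ g b e B) {u v : ℝ} (huv : u ≤ v) :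
    ‖weightSum h.finite b α v - weightSum h.finite b α u‖ ≤ 3 * B * (v - u + 1) := by
  have hB := h.B_nonneg
  have key : ∀ n : ℕ, ‖weightSum h.finite b α (u + n) - weightSum h.finite b α u‖ ≤ 3 * B * n := by
    intro n
    induction n with
    | zero => simp
    | succ n ih =>
      have h1 := h.norm_weightSum_sub_le_of_le_one (α := α) (u := u + n) (v := u + (n + 1 : ℕ))
        (by push_cast; linarith) (by push_cast; linarith)
      have h2 := norm_sub_le_norm_sub_add_norm_sub (weightSum h.finite b α (u + (n + 1 : ℕ)))
        (weightSum h.finite b α (u + n)) (weightSum h.finite b α u)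
      have h3 : 3 * B * ((n + 1 : ℕ) : ℝ) = 3 * B + 3 * B * n := by
        push_cast
        ring
      linarith
  have h1 := Nat.floor_le (sub_nonneg.mpr huv)
  have h2 := (Nat.lt_floor_add_one (v - u)).le
  have h3 := key ⌊v - u⌋₊
  have h4 := h.norm_weightSum_sub_le_of_le_one (α := α) (u := u + ⌊v - u⌋₊) (v := v)
    (by linarith) (by linarith)
  have h5 := norm_sub_le_norm_sub_add_norm_sub (weightSum h.finite b α v)
    (weightSum h.finite b α (u + ⌊v - u⌋₊)) (weightSum h.finite b α u)
  nlinarith [mul_le_mul_of_nonneg_left h1 (by positivity : 0 ≤ 3 * B)]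

/-- The normalized partial sums vary little over short intervals, because the density of the
exponents leaves few of them in a short interval. -/
theorem exists_norm_normalized_sub_le (h : LogConvolution ℓ g b e B) (α : ℝ) :
    ∃ A : ℝ, 0 ≤ A ∧ ∀ η : ℝ, 0 < η → η ≤ 1 → ∀ᶠ u in atTop, ∀ t ∈ Set.Icc 0 η,
      ‖normalized h.finite g α (u + t) - normalized h.finite g α u‖ ≤ A * η := by
  obtain ⟨κ, hκ⟩ := h.count_tendsto
  have hB := h.B_nonneg
  set N := partialSum h.finite (fun _ => (1 : ℝ)) with hN
  have hN0 : ∀ u, 0 ≤ N u := partialSum_nonneg h.finite fun _ => zero_le_one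
  have hκ0 : 0 ≤ κ := ge_of_tendsto' hκ fun u => mul_nonneg (hN0 u) (Real.exp_nonneg _)
  set A := 2 * (κ + 1) + (1 + |α|) * B with hA
  refine ⟨A, by positivity, fun η hη hη1 => ?_⟩
  have t1 : Tendsto (fun u => (N (u + η) - N u) * Real.exp (-u)) atTop
      (𝓝 (κ * Real.exp η - κ)) := by
    have := ((hκ.comp (tendsto_atTop_add_const_right _ η tendsto_id)).mul_const
      (Real.exp η)).sub hκ
    refine this.congr fun u => ?_
    simp only [Function.comp_apply, id]
    rw [mul_assoc, ← Real.exp_add, sub_mul]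
    ring_nf
  have hexp : Real.exp η - 1 ≤ 2 * η := by
    have := Real.abs_exp_sub_one_sub_id_le (x := η) (by rwa [abs_of_pos hη])
    rw [abs_le] at this
    nlinarith [this.2]
  have hlt : κ * Real.exp η - κ < 2 * (κ + 1) * η := by nlinarith
  filter_upwards [t1.eventually (gt_mem_nhds hlt), eventually_ge_atTop 0] with u hu hu0 t ht
  set β := 1 + Complex.I * (α : ℂ) with hβ
  have e1 : normalized h.finite g α (u + t) - normalized h.finite g α u =
      Complex.exp (-(β * (u + t : ℝ))) * (partialSum h.finite g (u + t) - partialSum h.finite g u) +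
      (Complex.exp (-(β * t)) - 1) * normalized h.finite g α u := by
    simp only [normalized, ← hβ]
    have : Complex.exp (-(β * (u + t : ℝ))) = Complex.exp (-(β * u)) * Complex.exp (-(β * t)) := by
      rw [← Complex.exp_add]
      push_cast
      ring_nf
    rw [this]
    ring
  have n1 : ‖partialSum h.finite g (u + t) - partialSum h.finite g u‖ ≤ N (u + η) - N u := by
    classical
    have hsub : (h.finite u).toFinset ⊆ (h.finite (u + t)).toFinset := by
      intro i hi
      simp only [Set.Finite.mem_toFinset, Set.mem_ofPred_eq] at hi ⊢
      linarith [ht.1]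
    have hmono : N (u + t) ≤ N (u + η) :=
      partialSum_mono h.finite (fun _ => zero_le_one) (by linarith [ht.2])
    have : ‖partialSum h.finite g (u + t) - partialSum h.finite g u‖ ≤ N (u + t) - N u := by
      rw [hN, partialSum, partialSum, partialSum, partialSum, ← Finset.sum_sdiff hsub,
        ← Finset.sum_sdiff hsub, add_sub_cancel_right, add_sub_cancel_right]
      exact norm_sum_le_of_le _ fun i _ => h.norm_le_one i
    linarith
  have n2 : ‖Complex.exp (-(β * t)) - 1‖ ≤ (1 + |α|) * t := by
    have e2 : Complex.exp (-(β * t)) - 1 =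
        (Real.exp (-t) : ℂ) * (Complex.exp (Complex.I * ((-(α * t) : ℝ) : ℂ)) - 1) +
        ((Real.exp (-t) - 1 : ℝ) : ℂ) := by
      have : Complex.exp (-(β * t)) =
          (Real.exp (-t) : ℂ) * Complex.exp (Complex.I * ((-(α * t) : ℝ) : ℂ)) := by
        rw [Complex.ofReal_exp, ← Complex.exp_add, hβ]
        push_cast
        ring_nf
      rw [this]
      push_cast
      ring
    have e3 : Real.exp (-t) ≤ 1 := Real.exp_le_one_iff.mpr (by linarith [ht.1])
    have e4 := Real.add_one_le_exp (-t)
    rw [e2]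
    refine (norm_add_le _ _).trans ?_
    rw [norm_mul, Complex.norm_real, Complex.norm_real, Real.norm_of_nonneg (Real.exp_nonneg _),
      Real.norm_eq_abs, abs_of_nonpos (by linarith)]
    have e5 := Real.norm_exp_I_mul_ofReal_sub_one_le (x := -(α * t))
    rw [norm_neg, norm_mul, Real.norm_eq_abs, Real.norm_of_nonneg ht.1] at e5
    have : Real.exp (-t) * ‖Complex.exp (Complex.I * ((-(α * t) : ℝ) : ℂ)) - 1‖ ≤
        1 * (|α| * t) := by
      gcongr
    linarith
  rw [e1]
  have n3 := h.norm_normalized_le (α := α) u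
  calc _ ≤ Real.exp (-(u + t)) * (N (u + η) - N u) + (1 + |α|) * t * B := by
        refine (norm_add_le _ _).trans (add_le_add ?_ ?_)
        · rw [norm_mul, norm_exp_neg_beta]
          gcongr
        · rw [norm_mul]
          have : 0 ≤ (1 + |α|) * t := mul_nonneg (by positivity) ht.1
          gcongr
    _ ≤ Real.exp (-u) * (N (u + η) - N u) + (1 + |α|) * η * B := by
        have : 0 ≤ N (u + η) - N u := (norm_nonneg _).trans n1
        gcongr
        · linarith [ht.1]
        · exact ht.2
    _ ≤ _ := by
        rw [hA]
        linarith [hu]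

/-- The convolution identity for `g ℓ`, after normalization: up to the deviation of the partial
sums of `g`, `u` times the normalized sum is a multiple of `weightSum`. The sum on the right may run
over all `i` with `ℓ i ≤ v`, as `deviation` vanishes for negative arguments; this makes its range
independent of `u`. -/
theorem norm_mul_normalized_sub_le (h : LogConvolution ℓ g b e B) {y u v : ℝ} (hu : 0 ≤ u)
    (huv : u ≤ v) :
    ‖u * normalized h.finite g α u - mainCoeff C α L y * weightSum h.finite b α u‖ ≤
      2 * B + ∑ i ∈ (h.finite v).toFinset,
        ‖b i‖ * Real.exp (-ℓ i) * ‖deviation h.finite g C α L y (u - ℓ i)‖ := by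
  set β := 1 + Complex.I * (α : ℂ) with hβ
  set c := mainCoeff C α L y with hc
  set E := Complex.exp (-(β * u)) with hE
  have nE : ‖E‖ = Real.exp (-u) := norm_exp_neg_beta α u
  have hcancel : ∀ x, x ≤ B * Real.exp u → Real.exp (-u) * x ≤ B := by
    intro x hx
    refine (mul_le_mul_of_nonneg_left hx (Real.exp_nonneg _)).trans_eq ?_
    rw [mul_left_comm, ← Real.exp_add, neg_add_cancel, Real.exp_zero, mul_one]
  have e1 : u * normalized h.finite g α u - c * weightSum h.finite b α u =
      E * partialSum h.finite e u -
      E * (partialSum h.finite (fun i => g i * ℓ i) u - u * partialSum h.finite g u) +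
      ∑ i ∈ (h.finite u).toFinset, b i * Complex.exp (-(β * ℓ i)) *
        (normalized h.finite g α (u - ℓ i) - c) := by
    have e2 : ∑ i ∈ (h.finite u).toFinset, b i * Complex.exp (-(β * ℓ i)) *
        (normalized h.finite g α (u - ℓ i) - c) =
        E * ∑ i ∈ (h.finite u).toFinset, b i * partialSum h.finite g (u - ℓ i) -
        c * weightSum h.finite b α u := by
      rw [weightSum, partialSum, Finset.mul_sum, Finset.mul_sum, ← Finset.sum_sub_distrib]
      refine Finset.sum_congr rfl fun i _ => ?_
      have : E = Complex.exp (-(β * ℓ i)) * Complex.exp (-(β * (u - ℓ i : ℝ))) := by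
        rw [hE, ← Complex.exp_add]
        push_cast
        ring_nf
      rw [this, normalized]
      ring
    rw [e2, h.partialSum_eq, normalized, ← hβ, ← hE]
    ring
  rw [e1, two_mul]
  refine (norm_add_le _ _).trans (add_le_add ((norm_sub_le _ _).trans (add_le_add ?_ ?_)) ?_)
  · rw [norm_mul, nE]
    exact hcancel _ ((norm_partialSum_le h.finite e u).trans (h.e_le u hu))
  · rw [norm_mul, nE]
    exact hcancel _ (h.norm_partialSum_mul_sub_le hu)
  · refine (norm_sum_le _ _).trans ?_
    refine le_trans (Finset.sum_le_sum fun i hi => ?_)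
      (Finset.sum_le_sum_of_subset_of_nonneg (fun i hi => ?_) fun i _ _ => by positivity)
    · have hi' : ℓ i ≤ u := by simpa using hi
      rw [norm_mul, norm_mul, norm_exp_neg_beta, norm_deviation_eq h.finite (sub_nonneg.mpr hi')]
    · simp only [Set.Finite.mem_toFinset, Set.mem_ofPred_eq] at hi ⊢
      linarith

end GeneralDirichlet.LogConvolution

/-! ### From the series to the partial sums -/

namespace GeneralDirichlet.LogConvolution

open MeasureTheory Filter Topology

variable {ι : Type*} {ℓ : ι → ℝ} {g b e : ι → ℂ} {B : ℝ} {C : ℂ} {α : ℝ} {L : ℝ → ℂ}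

/-- Averaging the convolution with the weights `|b i| e^{-ℓ i}` over a short interval: Chebyshev's
bound in the form `sum_weight_le` is enough, since each value of the deviation meets only the
weights in an interval of the same length. -/
theorem lintegral_sum_weight_le (h : LogConvolution ℓ g b e B) {y u η : ℝ} (hη1 : η ≤ 1)
    (hy : u + η ≤ 2 * y) :
    ∫⁻ v in Set.Icc u (u + η), ENNReal.ofReal (∑ i ∈ (h.finite (u + η)).toFinset,
        ‖b i‖ * Real.exp (-ℓ i) * ‖deviation h.finite g C α L y (v - ℓ i)‖) ≤
      ENNReal.ofReal (3 * B) * ∫⁻ v in Set.Icc 0 (2 * y), ‖deviation h.finite g C α L y v‖ₑ := by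
  classical
  set F := (h.finite (u + η)).toFinset with hF
  set w : ι → ℝ := fun i => ‖b i‖ * Real.exp (-ℓ i) with hw
  have hw0 : ∀ i, 0 ≤ w i := fun i => by positivity
  set f : ℝ → ENNReal := fun v => ‖deviation h.finite g C α L y v‖ₑ with hf
  have hfm : Measurable f := (measurable_deviation h.finite y).enorm
  set J : ℝ → ENNReal := (Set.Icc u (u + η)).indicator 1 with hJ
  have hJm : Measurable J := measurable_one.indicator measurableSet_Icc
  calc _ = ∫⁻ v, ∑ i ∈ F, ENNReal.ofReal (w i) * (J v * f (v - ℓ i)) := by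
        rw [← lintegral_indicator measurableSet_Icc]
        refine lintegral_congr fun v => ?_
        by_cases hv : v ∈ Set.Icc u (u + η)
        · rw [Set.indicator_of_mem hv, ENNReal.ofReal_sum_of_nonneg fun i _ => by positivity]
          refine Finset.sum_congr rfl fun i _ => ?_
          rw [ENNReal.ofReal_mul (hw0 i), ofReal_norm, hJ, Set.indicator_of_mem hv, Pi.one_apply,
            one_mul]
        · simp [hJ, Set.indicator_of_notMem hv]
    _ = ∑ i ∈ F, ENNReal.ofReal (w i) * ∫⁻ v, J v * f (v - ℓ i) := by
        rw [lintegral_finsetSum _ fun i _ => by fun_prop]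
        refine Finset.sum_congr rfl fun i _ => ?_
        rw [lintegral_const_mul _ (by fun_prop)]
    _ = ∑ i ∈ F, ENNReal.ofReal (w i) * ∫⁻ v, J (v + ℓ i) * f v := by
        refine Finset.sum_congr rfl fun i _ => ?_
        rw [← lintegral_add_right_eq_self (μ := volume) (fun v => J v * f (v - ℓ i)) (ℓ i)]
        simp only [add_sub_cancel_right]
    _ = ∫⁻ v, (∑ i ∈ F, ENNReal.ofReal (w i) * J (v + ℓ i)) * f v := by
        simp only [Finset.sum_mul, mul_assoc]
        rw [lintegral_finsetSum _ fun i _ => by fun_prop]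
        refine Finset.sum_congr rfl fun i _ => ?_
        rw [lintegral_const_mul _ (by fun_prop)]
    _ ≤ ∫⁻ v, (Set.Icc 0 (2 * y)).indicator (fun v => ENNReal.ofReal (3 * B) * f v) v := by
        refine lintegral_mono fun v => ?_
        by_cases hv : v ∈ Set.Icc 0 (2 * y)
        · rw [Set.indicator_of_mem hv]
          refine mul_le_mul_left ?_ _
          have e1 : ∑ i ∈ F, ENNReal.ofReal (w i) * J (v + ℓ i) =
              ENNReal.ofReal (∑ i ∈ F with v + ℓ i ∈ Set.Icc u (u + η), w i) := by
            rw [ENNReal.ofReal_sum_of_nonneg fun i _ => hw0 i, Finset.sum_filter]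
            refine Finset.sum_congr rfl fun i _ => ?_
            by_cases hi : v + ℓ i ∈ Set.Icc u (u + η) <;> simp [hJ, hi]
          rw [e1]
          refine ENNReal.ofReal_le_ofReal (h.sum_weight_le _ hη1 (x := u - v) fun i hi => ?_)
          have h2 := (Finset.mem_filter.mp hi).2
          exact ⟨by linarith [h2.1], by linarith [h2.2]⟩
        · rw [Set.indicator_of_notMem hv]
          have : (∑ i ∈ F, ENNReal.ofReal (w i) * J (v + ℓ i)) * f v = 0 := by
            rcases lt_or_ge v 0 with h1 | h1
            · simp [hf, deviation, not_le.mpr h1]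
            · have h2 : 2 * y < v := by
                by_contra h3
                exact hv ⟨h1, not_lt.mp h3⟩
              rw [Finset.sum_eq_zero, zero_mul]
              intro i _
              have h3 : v + ℓ i ∉ Set.Icc u (u + η) := by
                intro h4
                linarith [h4.2, h.nonneg i]
              simp [hJ, Set.indicator_of_notMem h3]
          exact this.le
    _ = _ := by
        rw [lintegral_indicator measurableSet_Icc, lintegral_const_mul _ hfm]

theorem integrableOn_deviation (h : LogConvolution ℓ g b e B) (hL1 : ∀ x, ‖L x‖ = 1) (y p q : ℝ) :
    IntegrableOn (fun u => ‖deviation h.finite g C α L y u‖) (Set.Icc p q) := by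
  refine Measure.integrableOn_of_bounded (by simp)
    (measurable_deviation h.finite y).norm.aestronglyMeasurable (M := B + ‖C‖)
    (Eventually.of_forall fun u => ?_)
  rw [norm_norm]
  exact h.norm_deviation_le hL1 y u

/-- On the whole range `[y/2, y]` the normalized sum is close to a multiple of `weightSum u / u`,
with one and the same coefficient. The pointwise bound `norm_mul_normalized_sub_le` involves the
deviation at the points `u - ℓ i` and is useful only after averaging over `u`. -/
theorem eventually_norm_mul_normalized_sub_le (h : LogConvolution ℓ g b e B)
    (hL : SlowlyOscillating L) (hL1 : ∀ x, ‖L x‖ = 1) (hG : SeriesAsymptotic ℓ g C α L) {ε : ℝ}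
    (hε : 0 < ε) :
    ∀ᶠ y in atTop, ∀ u : ℝ, y / 2 ≤ u → u ≤ y →
      ‖u * normalized h.finite g α u - mainCoeff C α L y * weightSum h.finite b α u‖ ≤ ε * y := by
  have hB := h.B_nonneg
  obtain ⟨A, hA, hA'⟩ := h.exists_norm_normalized_sub_le α
  set η := min 1 (ε / (4 * (A + 1))) with hη
  have hη0 : 0 < η := lt_min one_pos (by positivity)
  have hη1 : η ≤ 1 := min_le_left _ _
  have hηA : A * η ≤ ε / 4 := by
    have h1 : η ≤ ε / (4 * (A + 1)) := min_le_right _ _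
    rw [le_div_iff₀ (by positivity)] at h1
    nlinarith
  obtain ⟨u₀, hu₀⟩ := eventually_atTop.mp (hA' η hη0 hη1)
  set R := 2 * B + B + ‖C‖ * (3 * B * 2) with hR
  have hR0 : 0 ≤ R := by positivity
  set ε₁ := ε * η / (4 * (3 * B + 1)) with hε₁
  have hε₁0 : 0 < ε₁ := by positivity
  filter_upwards [h.eventually_integral_deviation_le hL hL1 hG hε₁0, eventually_ge_atTop (2 * u₀),
    eventually_ge_atTop 1, eventually_ge_atTop (4 * R / ε)] with y hI hyu hy hyR u hu1 hu2
  have hu : 0 ≤ u := by linarith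
  set Q : ℝ → ℂ := fun v => v * normalized h.finite g α v -
    mainCoeff C α L y * weightSum h.finite b α v with hQ
  set V : ℝ → ℝ := fun v => ∑ i ∈ (h.finite (u + η)).toFinset,
        ‖b i‖ * Real.exp (-ℓ i) * ‖deviation h.finite g C α L y (v - ℓ i)‖ with hV
  have hV0 : ∀ v, 0 ≤ V v := fun v => Finset.sum_nonneg fun i _ => by positivity
  -- The function `Q` does not vary much on `[u, u + η]`, so it may be averaged.
  have hpt : ∀ v ∈ Set.Icc u (u + η), ‖Q u‖ ≤ (A * η * y + R) + V v := by
    intro v hv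
    have h1 := hu₀ u (by linarith) (v - u) ⟨by linarith [hv.1], by linarith [hv.2]⟩
    rw [add_sub_cancel] at h1
    have h2 := h.norm_mul_normalized_sub_le (C := C) (α := α) (L := L) (y := y) (u := v)
      (v := u + η) (by linarith [hv.1]) hv.2
    have h3 := h.norm_weightSum_sub_le (α := α) hv.1
    have h4 : Q u = Q v - u * (normalized h.finite g α v - normalized h.finite g α u) -
        ((v - u : ℝ) : ℂ) * normalized h.finite g α v + mainCoeff C α L y *
          (weightSum h.finite b α v - weightSum h.finite b α u) := by
      simp only [hQ]
      push_cast
      ring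
    have n1 : ‖(u : ℂ) * (normalized h.finite g α v - normalized h.finite g α u)‖ ≤ A * η * y := by
      rw [norm_mul, Complex.norm_real, Real.norm_of_nonneg hu, mul_comm]
      gcongr
    have n2 : ‖((v - u : ℝ) : ℂ) * normalized h.finite g α v‖ ≤ 1 * B := by
      rw [norm_mul, Complex.norm_real, Real.norm_of_nonneg (by linarith [hv.1])]
      have := h.norm_normalized_le (α := α) v
      gcongr
      linarith [hv.2]
    have n3 : ‖mainCoeff C α L y * (weightSum h.finite b α v - weightSum h.finite b α u)‖ ≤
        ‖C‖ * (3 * B * 2) := by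
      rw [norm_mul]
      gcongr
      · exact norm_mainCoeff_le hL1 y
      · refine h3.trans ?_
        gcongr
        linarith [hv.2]
    rw [h4]
    refine (norm_add_le _ _).trans ((add_le_add ((norm_sub_le _ _).trans (add_le_add
      ((norm_sub_le _ _).trans (add_le_add h2 n1)) n2)) n3).trans_eq ?_)
    simp only [hR, hV]
    ring
  have hdm := measurable_deviation (g := g) (C := C) (α := α) (L := L) h.finite y
  have hlI : ∫⁻ v in Set.Icc 0 (2 * y), ‖deviation h.finite g C α L y v‖ₑ ≤
      ENNReal.ofReal (ε₁ * y) := by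
    refine le_trans (le_of_eq ?_) (ENNReal.ofReal_le_ofReal hI)
    rw [ofReal_integral_norm_eq_lintegral_enorm]
    exact (integrable_norm_iff hdm.aestronglyMeasurable).mp (h.integrableOn_deviation hL1 y _ _)
  have key : ENNReal.ofReal (‖Q u‖ * η) ≤
      ENNReal.ofReal ((A * η * y + R) * η + 3 * B * (ε₁ * y)) := by
    calc ENNReal.ofReal (‖Q u‖ * η) = ∫⁻ v in Set.Icc u (u + η), ENNReal.ofReal ‖Q u‖ := by
          rw [setLIntegral_const, Real.volume_Icc, add_sub_cancel_left,
            ENNReal.ofReal_mul (norm_nonneg _)]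
      _ ≤ ∫⁻ v in Set.Icc u (u + η), (ENNReal.ofReal (A * η * y + R) + ENNReal.ofReal (V v)) := by
          refine setLIntegral_mono' measurableSet_Icc fun v hv => ?_
          rw [← ENNReal.ofReal_add (by positivity) (hV0 v)]
          exact ENNReal.ofReal_le_ofReal (hpt v hv)
      _ = ENNReal.ofReal ((A * η * y + R) * η) +
          ∫⁻ v in Set.Icc u (u + η), ENNReal.ofReal (V v) := by
          rw [lintegral_add_left measurable_const, setLIntegral_const, Real.volume_Icc,
            add_sub_cancel_left, ENNReal.ofReal_mul (by positivity)]
      _ ≤ ENNReal.ofReal ((A * η * y + R) * η) +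
          ENNReal.ofReal (3 * B) * ENNReal.ofReal (ε₁ * y) := by
          gcongr
          exact (h.lintegral_sum_weight_le hη1 (by linarith)).trans (mul_le_mul_right hlI _)
      _ = _ := by
          rw [← ENNReal.ofReal_mul (by positivity), ← ENNReal.ofReal_add (by positivity)
            (by positivity)]
  rw [ENNReal.ofReal_le_ofReal_iff (by positivity)] at key
  have e1 : 3 * B * (ε₁ * y) ≤ ε / 4 * y * η := by
    have : ε₁ * (3 * B + 1) = ε * η / 4 := by
      rw [hε₁]
      field_simp
    have h2 : 3 * B * (ε₁ * y) = (ε₁ * (3 * B + 1)) * y - ε₁ * y := by ring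
    rw [h2, this]
    have : 0 ≤ ε₁ * y := by positivity
    linarith
  have e2 : R ≤ ε / 4 * y := by
    rw [div_le_iff₀ hε] at hyR
    linarith
  have e3 : A * η * y ≤ ε / 4 * y := by gcongr
  have e4 : ‖Q u‖ * η ≤ (ε * y) * η := by
    have h1 : (A * η * y + R) * η ≤ (ε / 4 * y + ε / 4 * y) * η := by gcongr
    have h2 : 0 ≤ ε * y * η := by positivity
    linarith
  exact le_of_mul_le_mul_right e4 hη0

/-- The normalized partial sums approach the main coefficient: they are nearly constant on
`[(1 - δ) y, y]` and close to the coefficient on average. -/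
theorem tendsto_normalized_sub (h : LogConvolution ℓ g b e B)
    (hL : SlowlyOscillating L) (hL1 : ∀ x, ‖L x‖ = 1) (hG : SeriesAsymptotic ℓ g C α L) :
    Tendsto (fun y => normalized h.finite g α y - mainCoeff C α L y) atTop (𝓝 0) := by
  have hB := h.B_nonneg
  rw [Metric.tendsto_nhds]
  intro ε hε
  set P := 6 * B * ‖C‖ + 2 * B + 1 with hP
  have hP0 : 0 < P := by positivity
  set δ := min (1 / 2) (ε / (8 * P)) with hδ
  have hδ0 : 0 < δ := lt_min (by norm_num) (by positivity)
  have hδ1 : δ ≤ 1 / 2 := min_le_left _ _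
  have hδ2 : P * δ ≤ ε / 8 := by
    have h1 : δ ≤ ε / (8 * P) := min_le_right _ _
    rw [le_div_iff₀ (by positivity)] at h1
    linarith
  filter_upwards [h.eventually_norm_mul_normalized_sub_le hL hL1 hG (ε := ε / 32) (by positivity),
    h.eventually_integral_deviation_le hL hL1 hG (ε := δ * (ε / 8)) (by positivity),
    eventually_ge_atTop 1, eventually_ge_atTop (1 / δ)] with y hQ hI hy hyδ
  have hy0 : 0 < y := by linarith
  have hyδ' : 1 ≤ δ * y := by
    rw [div_le_iff₀ hδ0] at hyδ
    linarith
  set ψ := normalized h.finite g α with hψ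
  set c := mainCoeff C α L y with hc
  -- Up to a small multiple of `y`, `u ψ(u)` equals `c * weightSum u`, which changes by `O(δ y)`
  -- over the interval `[(1 - δ) y, y]`.
  have hpt : ∀ u ∈ Set.Icc ((1 - δ) * y) y,
      ‖ψ y - c‖ - 3 * ε / 8 ≤ ‖deviation h.finite g C α L y u‖ := by
    intro u hu
    have hu1 : y / 2 ≤ u := by nlinarith [hu.1]
    have hu0 : 0 < u := by linarith
    have h1 := hQ u hu1 hu.2
    have h2 := hQ y (by linarith) le_rfl
    have h3 := h.norm_weightSum_sub_le (α := α) hu.2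
    have e1 : (u : ℂ) * (ψ y - ψ u) = (y * ψ y - c * weightSum h.finite b α y) -
        (u * ψ u - c * weightSum h.finite b α u) +
        c * (weightSum h.finite b α y - weightSum h.finite b α u) - ((y - u : ℝ) : ℂ) * ψ y := by
      push_cast
      ring
    have hyu : y - u ≤ δ * y := by linarith [hu.1]
    have n1 : ‖c * (weightSum h.finite b α y - weightSum h.finite b α u)‖ ≤
        ‖C‖ * (3 * B * (2 * (δ * y))) := by
      rw [norm_mul]
      gcongr
      · exact norm_mainCoeff_le hL1 y
      · refine h3.trans ?_
        gcongr
        linarith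
    have n2 : ‖((y - u : ℝ) : ℂ) * ψ y‖ ≤ δ * y * B := by
      rw [norm_mul, Complex.norm_real, Real.norm_of_nonneg (by linarith [hu.2])]
      have := h.norm_normalized_le (α := α) y
      gcongr
    have n3 : u * ‖ψ y - ψ u‖ ≤ ε / 32 * y + ε / 32 * y + ‖C‖ * (3 * B * (2 * (δ * y))) +
        δ * y * B := by
      have := congrArg norm e1
      rw [norm_mul, Complex.norm_real, Real.norm_of_nonneg hu0.le] at this
      rw [this]
      exact (norm_sub_le _ _).trans (add_le_add ((norm_add_le _ _).trans (add_le_add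
        ((norm_sub_le _ _).trans (add_le_add h2 h1)) n1)) n2)
    have n4 : y / 2 * ‖ψ y - ψ u‖ ≤ y / 2 * (3 * ε / 8) := by
      refine (mul_le_mul_of_nonneg_right hu1 (norm_nonneg _)).trans (n3.trans ?_)
      have h5 : ‖C‖ * (3 * B * (2 * (δ * y))) + δ * y * B = (P * δ) * y - δ * y * (B + 1) := by
        rw [hP]
        ring
      have h6 : 0 ≤ δ * y * (B + 1) := by positivity
      have h7 : (P * δ) * y ≤ ε / 8 * y := by gcongr
      nlinarith
    have n5 := le_of_mul_le_mul_left n4 (by positivity)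
    rw [norm_deviation_eq h.finite hu0.le]
    have := norm_sub_le_norm_sub_add_norm_sub (ψ y) (ψ u) c
    linarith
  have hI2 : (‖ψ y - c‖ - 3 * ε / 8) * (δ * y) ≤ δ * (ε / 8) * y := by
    calc (‖ψ y - c‖ - 3 * ε / 8) * (δ * y)
        = ∫ u in Set.Icc ((1 - δ) * y) y, (‖ψ y - c‖ - 3 * ε / 8) := by
          rw [setIntegral_const, Real.volume_real_Icc_of_le (by nlinarith), smul_eq_mul]
          ring
      _ ≤ ∫ u in Set.Icc ((1 - δ) * y) y, ‖deviation h.finite g C α L y u‖ :=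
          setIntegral_mono_on (integrableOn_const (by simp)) (h.integrableOn_deviation hL1 y _ _)
            measurableSet_Icc hpt
      _ ≤ ∫ u in Set.Icc 0 (2 * y), ‖deviation h.finite g C α L y u‖ := by
          refine setIntegral_mono_set (h.integrableOn_deviation hL1 y _ _)
            (Eventually.of_forall fun u => norm_nonneg _) ?_
          refine (Set.Icc_subset_Icc ?_ (by linarith)).eventuallyLE
          nlinarith
      _ ≤ _ := hI
  rw [dist_zero_right]
  have h8 : (‖ψ y - c‖ - 3 * ε / 8) * (δ * y) ≤ ε / 8 * (δ * y) := by linarith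
  have h9 := le_of_mul_le_mul_right h8 (by positivity)
  linarith

end GeneralDirichlet.LogConvolution

/-! ### From the partial sums to the series -/

namespace GeneralDirichlet.LogConvolution

open MeasureTheory Filter Topology

variable {ι : Type*} {ℓ : ι → ℝ} {g b e : ι → ℂ} {B : ℝ} {C : ℂ} {α : ℝ} {L : ℝ → ℂ}

/-- The Abelian direction in rescaled form. Dominated convergence applies with `y` as the parameter
and the constant `L(y)` inside the integral, so `L` need not be measurable. -/
theorem tendsto_integral_deviation_mul (h : LogConvolution ℓ g b e B) (hL : SlowlyOscillating L)
    (hL1 : ∀ x, ‖L x‖ = 1)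
    (hψ : Tendsto (fun y => normalized h.finite g α y - mainCoeff C α L y) atTop (𝓝 0)) :
    Tendsto (fun y => ∫ v in Set.Ioi (0 : ℝ),
      ‖deviation h.finite g C α L y (y * v)‖ * Real.exp (-v)) atTop (𝓝 0) := by
  have hB := h.B_nonneg
  have := tendsto_integral_filter_of_dominated_convergence (μ := volume.restrict (Set.Ioi (0 : ℝ)))
    (l := atTop) (F := fun y v => ‖deviation h.finite g C α L y (y * v)‖ * Real.exp (-v))
    (f := fun _ => 0) (fun v => (B + ‖C‖) * Real.exp (-v)) (Eventually.of_forall fun y => ?_)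
    (Eventually.of_forall fun y => Eventually.of_forall fun v => ?_) ?_ ?_
  · simpa using this
  · exact ((((measurable_deviation h.finite y).comp (measurable_const_mul y)).norm).mul
      (by fun_prop)).aestronglyMeasurable
  · rw [norm_mul, norm_norm, Real.norm_of_nonneg (Real.exp_nonneg _)]
    gcongr
    exact h.norm_deviation_le hL1 y _
  · have := (exp_neg_integrableOn_Ioi 0 one_pos).const_mul (B + ‖C‖)
    simpa using this
  · filter_upwards [ae_restrict_mem measurableSet_Ioi] with v hv
    have hv0 : 0 < v := hv
    have t1 := (hψ.comp (tendsto_id.const_mul_atTop hv0)).norm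
    have t2 := ((norm_sub_tendsto hL hL1 hv0).const_mul ‖C‖)
    have t3 := (t1.add t2).mul_const (Real.exp (-v))
    simp only [norm_zero, mul_zero, add_zero, zero_mul] at t3
    refine squeeze_zero' (Eventually.of_forall fun y => by positivity) ?_ t3
    filter_upwards [eventually_ge_atTop 0] with y hy
    refine mul_le_mul_of_nonneg_right ?_ (Real.exp_nonneg _)
    rw [norm_deviation_eq h.finite (by positivity), mul_comm y v]
    refine (norm_sub_le_norm_sub_add_norm_sub _ (mainCoeff C α L (v * y)) _).trans ?_
    refine add_le_add le_rfl ?_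
    have e1 : mainCoeff C α L (v * y) - mainCoeff C α L y =
        C * (L (v * y) - L y) / (1 + Complex.I * α) := by
      simp only [mainCoeff]
      ring
    rw [e1, norm_div, norm_mul]
    exact div_le_self (by positivity) (one_le_norm_one_add α)

/-- The left-hand side is the Laplace transform of the unnormalized deviation; substitute
`u = y v`. -/
theorem norm_dseries_div_sub_le (h : LogConvolution ℓ g b e B) {y : ℝ} (hy : 0 < y) (τ : ℝ) :
    ‖dseries ℓ g (point y τ) / point y τ -
      mainCoeff C α L y / (point y τ - (1 + Complex.I * α))‖ ≤
      y * ∫ v in Set.Ioi (0 : ℝ), ‖deviation h.finite g C α L y (y * v)‖ * Real.exp (-v) := by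
  have hre1 := one_lt_point_re hy τ
  have i1 := laplace.integrable (s := point y τ) (measurable_partialSum h.finite g)
    (fun u hu => partialSum_eq_zero h.finite h.nonneg _ hu)
    (fun u hu => (norm_partialSum_le h.finite _ u).trans (h.norm_g_le u hu)) hre1
  have i2 := laplace.integrable (s := point y τ) (B := 1) (ρ := 1)
    (f := fun u => if 0 ≤ u then Complex.exp ((1 + Complex.I * α) * u) else 0)
    (Measurable.ite measurableSet_Ici (by fun_prop) measurable_const)
    (fun u hu => by simp [hu]) (fun u hu => by
      rw [if_pos hu, norm_exp_beta, one_mul, one_mul]) hre1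
  have e1 := laplace.integral_exp_mul (β := 1 + Complex.I * α) (s := point y τ)
    (by simpa using hy)
  have e2 := dseries_eq_laplace h.finite h.nonneg h.norm_g_le zero_le_one hre1
  rw [e2, div_eq_mul_one_div (mainCoeff C α L y), ← e1, laplace, laplace,
    ← integral_const_mul, ← integral_sub i1 (i2.const_mul _)]
  refine (norm_integral_le_integral_norm _).trans_eq ?_
  have e3 := integral_comp_mul_left_Ioi (fun u =>
    ‖deviation h.finite g C α L y u‖ * Real.exp (-(u / y))) 0 hy
  rw [mul_zero, smul_eq_mul] at e3
  have e4 : ∀ v, y * v / y = v := fun v => by field_simp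
  simp only [e4] at e3
  rw [e3, ← mul_assoc, mul_inv_cancel₀ hy.ne', one_mul, ← integral_Ici_eq_integral_Ioi,
    ← integral_indicator measurableSet_Ici]
  refine integral_congr_ae (Eventually.of_forall fun u => ?_)
  simp only
  by_cases hu : 0 ≤ u
  · rw [Set.indicator_of_mem (Set.mem_Ici.mpr hu), if_pos hu, ← mul_assoc, ← sub_mul, norm_term,
      norm_deviation_eq h.finite hu]
    have e5 : partialSum h.finite g u - mainCoeff C α L y * Complex.exp ((1 + Complex.I * α) * u) =
        Complex.exp ((1 + Complex.I * α) * u) *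
          (normalized h.finite g α u - mainCoeff C α L y) := by
      rw [normalized, mul_sub, ← mul_assoc, ← Complex.exp_add, add_neg_cancel, Complex.exp_zero,
        one_mul, mul_comm (mainCoeff C α L y)]
    rw [e5, norm_mul, norm_exp_beta, point_re, mul_comm (Real.exp u), mul_assoc, ← Real.exp_add]
    ring_nf
  · rw [Set.indicator_of_notMem (by simpa using hu), if_neg hu,
      partialSum_eq_zero h.finite h.nonneg _ (not_le.mp hu)]
    simp

/-- The Abelian direction. The main term of `G(s) / s` is `c / (s - β)` with `c = C L(y) / β`, and
`s c / (s - β) = C L(y) / (s - β) + c`, where `c` is bounded. -/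
theorem seriesAsymptotic_of_tendsto (h : LogConvolution ℓ g b e B) (hL : SlowlyOscillating L)
    (hL1 : ∀ x, ‖L x‖ = 1)
    (hψ : Tendsto (fun y => normalized h.finite g α y - mainCoeff C α L y) atTop (𝓝 0)) :
    SeriesAsymptotic ℓ g C α L := by
  intro M ε hε
  have hε₁ : 0 < ε / (2 * (2 + |M|)) := by positivity
  filter_upwards [(h.tendsto_integral_deviation_mul hL hL1 hψ).eventually (gt_mem_nhds hε₁),
    eventually_ge_atTop 1, eventually_ge_atTop (2 * ‖C‖ / ε)] with y h1 hy hyC τ hτ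
  have hy0 : 0 < y := by linarith
  set s := point y τ with hs
  set β := 1 + Complex.I * (α : ℂ) with hβ
  have hs0 : s ≠ 0 := norm_pos_iff.mp (zero_lt_one.trans_le (one_le_norm_point hy0 τ))
  have hβ0 : β ≠ 0 := one_add_ne_zero α
  have ha0 : s - β ≠ 0 := norm_pos_iff.mp
    (lt_of_lt_of_le (by positivity) (inv_le_norm_point_sub hy0 τ α))
  have e1 : dseries ℓ g s - C / (s - β) * L y =
      s * (dseries ℓ g s / s - mainCoeff C α L y / (s - β)) + mainCoeff C α L y := by
    rw [mainCoeff, ← hβ]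
    field_simp
    ring
  have ns : ‖s‖ ≤ 2 + |M| := by
    rw [hs, point]
    refine (norm_add_le _ _).trans (add_le_add ?_ ?_)
    · rw [Complex.norm_real, Real.norm_of_nonneg (by positivity)]
      have : 1 / y ≤ 1 := (div_le_one hy0).mpr hy
      linarith
    · rw [norm_mul, Complex.norm_I, one_mul, Complex.norm_real, Real.norm_eq_abs]
      exact hτ.trans (le_abs_self M)
  have n1 := h.norm_dseries_div_sub_le (C := C) (α := α) (L := L) hy0 τ
  rw [← hs, ← hβ] at n1
  rw [e1]
  calc _ ≤ (2 + |M|) * (y * (ε / (2 * (2 + |M|)))) + ‖C‖ := by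
        refine (norm_add_le _ _).trans (add_le_add ?_ (norm_mainCoeff_le hL1 y))
        rw [norm_mul]
        gcongr
        exact n1.trans (by gcongr)
    _ = ε / 2 * y + ‖C‖ := by
        field_simp
    _ ≤ _ := by
        rw [div_le_iff₀ hε] at hyC
        linarith

end GeneralDirichlet.LogConvolution

/-! ### Norms of ideals -/

namespace IdealFunction

open GeneralDirichlet UniqueFactorizationMonoid Filter Topology

variable {K : Type*} [Field K] [NumberField K]

/-- The exponents `log 𝒩(𝔲)` that turn Dirichlet series over ideals into general ones. -/
noncomputable def logNorm (u : (Ideal (𝓞 K))⁰) : ℝ := Real.log (norm u)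

theorem one_le_norm (u : (Ideal (𝓞 K))⁰) : 1 ≤ norm u :=
  Nat.one_le_iff_ne_zero.mpr (Ideal.absNorm_ne_zero_iff_mem_nonZeroDivisors.mpr u.2)

theorem norm_pos (u : (Ideal (𝓞 K))⁰) : (0 : ℝ) < norm u := by
  exact_mod_cast one_le_norm u

theorem logNorm_nonneg (u : (Ideal (𝓞 K))⁰) : 0 ≤ logNorm u :=
  Real.log_nonneg (by exact_mod_cast one_le_norm u)

theorem logNorm_mul (u v : (Ideal (𝓞 K))⁰) : logNorm (u * v) = logNorm u + logNorm v := by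
  rw [logNorm, logNorm, logNorm, ← Real.log_mul (norm_pos u).ne' (norm_pos v).ne']
  congr 1
  rw [norm, norm, norm, Submonoid.coe_mul, map_mul, Nat.cast_mul]

theorem logNorm_pow (u : (Ideal (𝓞 K))⁰) (j : ℕ) : logNorm (u ^ j) = j * logNorm u := by
  rw [logNorm, logNorm, norm, norm, SubmonoidClass.coe_pow, map_pow, Nat.cast_pow, Real.log_pow]

theorem logNorm_le_iff (u : (Ideal (𝓞 K))⁰) (x : ℝ) : logNorm u ≤ x ↔ (norm u : ℝ) ≤ Real.exp x :=
  Real.log_le_iff_le_exp (norm_pos u)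

theorem finite_logNorm_le (x : ℝ) : {u : (Ideal (𝓞 K))⁰ | logNorm u ≤ x}.Finite := by
  simp only [logNorm_le_iff]
  exact finite_norm_le K _

theorem norm_cpow (u : (Ideal (𝓞 K))⁰) (s : ℂ) :
    (norm u : ℂ) ^ (-s) = Complex.exp (-(s * logNorm u)) := by
  rw [Complex.cpow_def_of_ne_zero (by exact_mod_cast (norm_pos u).ne'), logNorm,
    ← Complex.natCast_log]
  ring_nf

theorem dirichletSeries_eq (g : (Ideal (𝓞 K))⁰ → ℂ) (s : ℂ) :
    dirichletSeries g s = dseries logNorm g s := by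
  simp only [dirichletSeries, dseries, norm_cpow]

theorem summatory_eq (g : (Ideal (𝓞 K))⁰ → ℂ) {x : ℝ} (hx : 0 < x) :
    summatory g x = partialSum finite_logNorm_le g (Real.log x) := by
  refine Finset.sum_congr (Finset.ext fun u => ?_) fun _ _ => rfl
  simp only [Set.Finite.mem_toFinset, Set.mem_ofPred_eq, logNorm_le_iff, Real.exp_log hx]

variable (K) in
/-- The number of ideals with `log 𝒩(𝔲) ≤ u`. -/
noncomputable def idealCount (u : ℝ) : ℝ :=
  partialSum (finite_logNorm_le (K := K)) (fun _ => (1 : ℝ)) u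

variable (K) in
theorem exists_tendsto_idealCount :
    ∃ κ : ℝ, Tendsto (fun u => idealCount K u * Real.exp (-u)) atTop (𝓝 κ) := by
  refine ⟨_, ((NumberField.Ideal.tendsto_norm_le_div_atTop₀ K).comp
    Real.tendsto_exp_atTop).congr fun u => ?_⟩
  rw [Function.comp_apply, Real.exp_neg, div_eq_mul_inv]
  congr 1
  rw [idealCount, partialSum, Finset.sum_const, nsmul_eq_mul, mul_one,
    ← Nat.card_eq_card_finite_toFinset (finite_logNorm_le u)]
  simp only [logNorm_le_iff]
  rfl

theorem idealCount_nonneg (u : ℝ) : 0 ≤ idealCount K u :=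
  partialSum_nonneg _ (fun _ => zero_le_one) u

variable (K) in
theorem exists_idealCount_le : ∃ B : ℝ, 0 ≤ B ∧ ∀ u, idealCount K u ≤ B * Real.exp u := by
  obtain ⟨κ, hκ⟩ := exists_tendsto_idealCount K
  obtain ⟨u₀, hu₀⟩ := eventually_atTop.mp (hκ.eventually (gt_mem_nhds (lt_add_one κ)))
  set B := max (κ + 1) (idealCount K (max u₀ 0)) with hB
  have hB0 : 0 ≤ B := (idealCount_nonneg _).trans (le_max_right _ _)
  refine ⟨B, hB0, fun u => ?_⟩
  rcases lt_or_ge u 0 with h | h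
  · rw [idealCount, partialSum_eq_zero _ logNorm_nonneg _ h]
    positivity
  rcases le_total u₀ u with h1 | h1
  · have := (hu₀ u h1).le
    rw [Real.exp_neg, ← div_eq_mul_inv, div_le_iff₀ (Real.exp_pos u)] at this
    exact this.trans (by gcongr; exact le_max_left _ _)
  · calc idealCount K u ≤ idealCount K (max u₀ 0) :=
          partialSum_mono _ (fun _ => zero_le_one) (h1.trans (le_max_left _ _))
      _ ≤ B * 1 := by
          rw [mul_one]
          exact le_max_right _ _
      _ ≤ _ := by
          gcongr
          exact Real.one_le_exp h

/-! ### Chebyshev's bound for prime ideals -/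

theorem coe_ne_bot {F : Type*} [Field F] (u : (Ideal (𝓞 F))⁰) : (u : Ideal (𝓞 F)) ≠ ⊥ :=
  nonZeroDivisors.ne_zero u.2

/-- The prime ideals above a rational prime `p` divide `(p)`, so the product of their norms is at
most `p ^ [K : ℚ]`. -/
theorem sum_logNorm_above_le (T : Finset (Ideal (𝓞 K))⁰) {p : ℕ} (hp : p ≠ 0)
    (hT : ∀ P ∈ T, (P : Ideal (𝓞 K)).IsPrime ∧ (p : 𝓞 K) ∈ (P : Ideal (𝓞 K))) :
    ∑ P ∈ T, logNorm P ≤ Module.finrank ℤ (𝓞 K) * Real.log p := by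
  classical
  have h1 : ∏ P ∈ T.map ⟨fun P : (Ideal (𝓞 K))⁰ => (P : Ideal (𝓞 K)), Subtype.val_injective⟩, P ∣
      Ideal.span {(p : 𝓞 K)} := by
    refine Finset.prod_primes_dvd _ (fun P hP => ?_) fun P hP => ?_
    · obtain ⟨Q, hQ, rfl⟩ := Finset.mem_map.mp hP
      exact Ideal.prime_of_isPrime (coe_ne_bot Q) (hT Q hQ).1
    · obtain ⟨Q, hQ, rfl⟩ := Finset.mem_map.mp hP
      rw [Ideal.dvd_span_singleton]
      exact (hT Q hQ).2
  rw [Finset.prod_map] at h1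
  have h2 := map_dvd (Ideal.absNorm (S := 𝓞 K)) h1
  rw [map_prod, Ideal.absNorm_span_natCast] at h2
  have h3 := Nat.le_of_dvd (by positivity) h2
  have h4 : ∑ P ∈ T, logNorm P = Real.log ((∏ P ∈ T, norm P : ℕ) : ℝ) := by
    rw [Nat.cast_prod, Real.log_prod fun P _ => (norm_pos P).ne']
    rfl
  rw [h4, ← Real.log_pow]
  refine Real.log_le_log ?_ (by exact_mod_cast h3)
  exact_mod_cast Finset.prod_pos fun P _ => one_le_norm P

open Classical in
/-- The function that is `log 𝒩(P)` on prime ideals and zero elsewhere. -/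
noncomputable def primeLog (u : (Ideal (𝓞 K))⁰) : ℝ :=
  if (u : Ideal (𝓞 K)).IsPrime then logNorm u else 0

theorem primeLog_nonneg (u : (Ideal (𝓞 K))⁰) : 0 ≤ primeLog u := by
  rw [primeLog]
  split_ifs
  exacts [logNorm_nonneg u, le_rfl]

/-- The rational prime below a prime ideal. -/
theorem exists_prime_mem (P : (Ideal (𝓞 K))⁰) (hP : (P : Ideal (𝓞 K)).IsPrime) :
    ∃ p : ℕ, p.Prime ∧ (p : 𝓞 K) ∈ (P : Ideal (𝓞 K)) ∧ p ≤ norm P := by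
  have := hP.isMaximal (coe_ne_bot P)
  obtain ⟨p, n, hn, hmem, hp, hpn⟩ := Ideal.exists_prime_and_absNorm_eq_pow (P : Ideal (𝓞 K))
  refine ⟨p, hp, hmem, ?_⟩
  rw [norm, hpn]
  exact Nat.le_self_pow hn.ne' p

/-- Group the prime ideals by the rational primes below them and apply Chebyshev's bound for the
rational primes. -/
theorem partialSum_primeLog_le (u : ℝ) :
    partialSum (finite_logNorm_le (K := K)) primeLog u ≤
      (Module.finrank ℤ (𝓞 K) * Real.log 4) * Real.exp u := by
  classical
  choose! p hp using exists_prime_mem (K := K)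
  set T : Finset (Ideal (𝓞 K))⁰ := (finite_logNorm_le (K := K) u).toFinset.filter
    fun P : (Ideal (𝓞 K))⁰ => (P : Ideal (𝓞 K)).IsPrime with hT
  have hmem : ∀ P ∈ T, (P : Ideal (𝓞 K)).IsPrime ∧ (norm P : ℝ) ≤ Real.exp u := by
    intro P hP
    have h1 := Finset.mem_filter.mp hP
    exact ⟨h1.2, (logNorm_le_iff P u).mp (by simpa using h1.1)⟩
  have h1 : partialSum (finite_logNorm_le (K := K)) primeLog u = ∑ P ∈ T, logNorm P := by
    rw [hT, Finset.sum_filter]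
    rfl
  have hmaps : ∀ P ∈ T, p P ∈ (Finset.Icc 0 ⌊Real.exp u⌋₊).filter Nat.Prime := by
    intro P hP
    obtain ⟨h2, h3⟩ := hmem P hP
    obtain ⟨h4, -, h6⟩ := hp P h2
    refine Finset.mem_filter.mpr ⟨Finset.mem_Icc.mpr ⟨Nat.zero_le _, Nat.le_floor ?_⟩, h4⟩
    exact le_trans (by exact_mod_cast h6) h3
  rw [h1, ← Finset.sum_fiberwise_of_maps_to hmaps]
  calc _ ≤ ∑ q ∈ (Finset.Icc 0 ⌊Real.exp u⌋₊).filter Nat.Prime,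
        Module.finrank ℤ (𝓞 K) * Real.log q := by
        refine Finset.sum_le_sum fun q hq => ?_
        refine sum_logNorm_above_le _ (Finset.mem_filter.mp hq).2.ne_zero fun P hP => ?_
        obtain ⟨h2, rfl⟩ := Finset.mem_filter.mp hP
        exact ⟨(hmem P h2).1, (hp P (hmem P h2).1).2.1⟩
    _ = Module.finrank ℤ (𝓞 K) * Chebyshev.theta (Real.exp u) := by
        rw [Chebyshev.theta_eq_sum_Icc, Finset.mul_sum]
    _ ≤ Module.finrank ℤ (𝓞 K) * (Real.log 4 * Real.exp u) := by
        gcongr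
        exact Chebyshev.theta_le_log4_mul_x (Real.exp_nonneg u)
    _ = _ := by ring

end IdealFunction

/-! ### The convolution identity for `g log 𝒩` -/

namespace IdealFunction

open GeneralDirichlet UniqueFactorizationMonoid Filter Topology

variable {K : Type*} [Field K] [NumberField K]

open Classical in
/-- The factorizations `u = p.1 * p.2` of a nonzero ideal. -/
noncomputable def factorPairs (u : (Ideal (𝓞 K))⁰) :
    Finset ((Ideal (𝓞 K))⁰ × (Ideal (𝓞 K))⁰) :=
  ((finite_logNorm_le (logNorm u)).toFinset ×ˢ (finite_logNorm_le (logNorm u)).toFinset).filter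
    fun p => p.1 * p.2 = u

theorem mem_factorPairs {u : (Ideal (𝓞 K))⁰} {p : (Ideal (𝓞 K))⁰ × (Ideal (𝓞 K))⁰} :
    p ∈ factorPairs u ↔ p.1 * p.2 = u := by
  simp only [factorPairs, Finset.mem_filter, Finset.mem_product, Set.Finite.mem_toFinset,
    Set.mem_ofPred_eq, and_iff_right_iff_imp]
  rintro rfl
  have h1 := logNorm_nonneg p.1
  have h2 := logNorm_nonneg p.2
  rw [logNorm_mul]
  constructor <;> linarith

/-- Dirichlet convolution of functions on nonzero ideals. -/
noncomputable def conv (a b : (Ideal (𝓞 K))⁰ → ℂ) (u : (Ideal (𝓞 K))⁰) : ℂ :=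
  ∑ p ∈ factorPairs u, a p.1 * b p.2

/-- The product of two absolutely convergent general Dirichlet series, for exponents that are
additive and have finitely many factorizations. -/
theorem _root_.GeneralDirichlet.hasSum_conv {M : Type*} [Mul M] {ℓ : M → ℝ}
    (hℓ : ∀ u v, ℓ (u * v) = ℓ u + ℓ v) {pairs : M → Finset (M × M)}
    (hpairs : ∀ u p, p ∈ pairs u ↔ p.1 * p.2 = u) {a b : M → ℂ} {s : ℂ}
    (ha : Summable fun u => ‖a u * Complex.exp (-(s * ℓ u))‖)
    (hb : Summable fun u => ‖b u * Complex.exp (-(s * ℓ u))‖) :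
    HasSum (fun u => (∑ p ∈ pairs u, a p.1 * b p.2) * Complex.exp (-(s * ℓ u)))
      (dseries ℓ a s * dseries ℓ b s) := by
  set m : M × M → M := fun p => p.1 * p.2 with hm
  have h0 := summable_mul_of_summable_norm (f := fun u => a u * Complex.exp (-(s * ℓ u)))
    (g := fun u => b u * Complex.exp (-(s * ℓ u))) ha hb
  have ha' : HasSum (fun u => a u * Complex.exp (-(s * ℓ u))) (dseries ℓ a s) := ha.of_norm.hasSum
  have hb' : HasSum (fun u => b u * Complex.exp (-(s * ℓ u))) (dseries ℓ b s) := hb.of_norm.hasSum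
  have h1 := (ha'.mul hb' h0).tsum_fiberwise m
  have h2 : ∀ u, (∑ p ∈ pairs u, a p.1 * b p.2) * Complex.exp (-(s * ℓ u)) = ∑' p : m ⁻¹' {u},
      a p.1.1 * Complex.exp (-(s * ℓ p.1.1)) * (b p.1.2 * Complex.exp (-(s * ℓ p.1.2))) := by
    intro u
    have h3 : m ⁻¹' {u} = (pairs u : Set (M × M)) := by
      ext p
      rw [Finset.mem_coe, hpairs]
      rfl
    rw [h3, Finset.tsum_subtype' (pairs u) fun p => a p.1 * Complex.exp (-(s * ℓ p.1)) *
      (b p.2 * Complex.exp (-(s * ℓ p.2))), Finset.sum_mul]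
    refine Finset.sum_congr rfl fun p hp => ?_
    rw [← (hpairs u p).mp hp, hℓ, Complex.ofReal_add, mul_add, neg_add, Complex.exp_add]
    ring
  rw [funext h2]
  exact h1

theorem hasSum_conv {a b : (Ideal (𝓞 K))⁰ → ℂ} {s : ℂ}
    (ha : Summable fun u => ‖a u * Complex.exp (-(s * logNorm u))‖)
    (hb : Summable fun u => ‖b u * Complex.exp (-(s * logNorm u))‖) :
    HasSum (fun u => conv a b u * Complex.exp (-(s * logNorm u)))
      (dseries logNorm a s * dseries logNorm b s) :=
  GeneralDirichlet.hasSum_conv logNorm_mul (fun _ _ => mem_factorPairs) ha hb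

theorem partialSum_conv (a b : (Ideal (𝓞 K))⁰ → ℂ) (y : ℝ) :
    partialSum finite_logNorm_le (conv a b) y =
      ∑ u ∈ (finite_logNorm_le y).toFinset,
        a u * partialSum finite_logNorm_le b (y - logNorm u) := by
  simp only [partialSum, conv, Finset.mul_sum]
  rw [Finset.sum_sigma', Finset.sum_sigma']
  refine Finset.sum_nbij' (fun x => ⟨x.2.1, x.2.2⟩) (fun x => ⟨x.1 * x.2, (x.1, x.2)⟩)
    ?_ ?_ ?_ ?_ ?_
  · rintro ⟨u, p⟩ h
    simp only [Finset.mem_sigma, Set.Finite.mem_toFinset, Set.mem_ofPred_eq, mem_factorPairs] at h ⊢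
    obtain ⟨h1, rfl⟩ := h
    rw [logNorm_mul] at h1
    have := logNorm_nonneg p.2
    constructor <;> linarith
  · rintro ⟨u, v⟩ h
    simp only [Finset.mem_sigma, Set.Finite.mem_toFinset, Set.mem_ofPred_eq, mem_factorPairs,
      and_true] at h ⊢
    rw [logNorm_mul]
    linarith [h.2]
  · rintro ⟨u, p⟩ h
    simp only [Finset.mem_sigma, mem_factorPairs] at h
    obtain ⟨-, rfl⟩ := h
    rfl
  · rintro ⟨u, v⟩ h
    rfl
  · rintro ⟨u, p⟩ h
    rfl

open Classical in
/-- The exponent of the prime `P` in the factorization of `u`. -/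
noncomputable def primeExponent (P u : (Ideal (𝓞 K))⁰) : ℕ :=
  (normalizedFactors (u : Ideal (𝓞 K))).count (P : Ideal (𝓞 K))

theorem pow_dvd_iff {P u : (Ideal (𝓞 K))⁰} (hP : (P : Ideal (𝓞 K)).IsPrime) (j : ℕ) :
    P ^ j ∣ u ↔ j ≤ primeExponent P u := by
  classical
  have h1 : P ^ j ∣ u ↔ (P : Ideal (𝓞 K)) ^ j ∣ (u : Ideal (𝓞 K)) := by
    constructor
    · rintro ⟨w, rfl⟩
      exact ⟨w, by push_cast; rfl⟩
    · rintro ⟨w, hw⟩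
      have hw0 : w ≠ 0 := by
        rintro rfl
        exact coe_ne_bot u (by rw [hw, mul_zero]; rfl)
      exact ⟨⟨w, mem_nonZeroDivisors_of_ne_zero hw0⟩, Subtype.ext (by push_cast; exact hw)⟩
  rw [h1, pow_dvd_iff_le_emultiplicity, emultiplicity_eq_count_normalizedFactors
    (Ideal.prime_of_isPrime (coe_ne_bot P) hP).irreducible (coe_ne_bot u), normalize_eq,
    Nat.cast_le, primeExponent]

open Classical in
/-- The factorizations of `u` whose first factor is prime. -/
noncomputable def primePairs (u : (Ideal (𝓞 K))⁰) :
    Finset ((Ideal (𝓞 K))⁰ × (Ideal (𝓞 K))⁰) :=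
  (factorPairs u).filter fun p => (p.1 : Ideal (𝓞 K)).IsPrime

theorem mem_primePairs {u : (Ideal (𝓞 K))⁰} {p : (Ideal (𝓞 K))⁰ × (Ideal (𝓞 K))⁰} :
    p ∈ primePairs u ↔ p.1 * p.2 = u ∧ (p.1 : Ideal (𝓞 K)).IsPrime := by
  classical
  exact Finset.mem_filter.trans (and_congr mem_factorPairs Iff.rfl)

/-- The logarithm of the norm, from the factorization into primes; the sum runs over the prime
divisors `p.1` of `u`, each paired with its cofactor. -/
theorem logNorm_eq_sum (u : (Ideal (𝓞 K))⁰) :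
    logNorm u = ∑ p ∈ primePairs u, primeExponent p.1 u * logNorm p.1 := by
  classical
  have h1 : logNorm u = ∑ P ∈ (normalizedFactors (u : Ideal (𝓞 K))).toFinset,
      (normalizedFactors (u : Ideal (𝓞 K))).count P * Real.log (Ideal.absNorm P) := by
    rw [logNorm, norm]
    nth_rewrite 1 [← Ideal.prod_normalizedFactors_eq_self (coe_ne_bot u)]
    rw [map_multiset_prod, Finset.prod_multiset_map_count, Nat.cast_prod, Real.log_prod]
    · refine Finset.sum_congr rfl fun P _ => ?_
      rw [Nat.cast_pow, Real.log_pow]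
    · intro P hP
      have hP' := (Ideal.mem_normalizedFactors_iff (coe_ne_bot u)).mp (Multiset.mem_toFinset.mp hP)
      have : P ≠ ⊥ := fun h => coe_ne_bot u (le_bot_iff.mp (h ▸ hP'.2))
      have h3 : Ideal.absNorm P ≠ 0 := fun h => this (Ideal.absNorm_eq_zero_iff.mp h)
      positivity
  rw [h1]
  symm
  refine Finset.sum_bij (fun p _ => (p.1 : Ideal (𝓞 K))) ?_ ?_ ?_ ?_
  · intro p hp
    obtain ⟨rfl, h⟩ := mem_primePairs.mp hp
    rw [Multiset.mem_toFinset, Ideal.mem_normalizedFactors_iff (coe_ne_bot _)]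
    exact ⟨h, Ideal.mul_le_left⟩
  · intro p hp q hq h
    obtain ⟨h1, -⟩ := mem_primePairs.mp hp
    obtain ⟨h2, -⟩ := mem_primePairs.mp hq
    have h3 : p.1 = q.1 := Subtype.ext h
    refine Prod.ext h3 ?_
    rw [← h2, h3] at h1
    exact mul_left_cancel h1
  · intro P hP
    obtain ⟨hP1, hP2⟩ :=
      (Ideal.mem_normalizedFactors_iff (coe_ne_bot u)).mp (Multiset.mem_toFinset.mp hP)
    obtain ⟨w, hw⟩ := Ideal.dvd_iff_le.mpr hP2
    have hP0 : P ≠ 0 := by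
      rintro rfl
      exact coe_ne_bot u (by rw [hw, zero_mul]; rfl)
    have hw0 : w ≠ 0 := by
      rintro rfl
      exact coe_ne_bot u (by rw [hw, mul_zero]; rfl)
    refine ⟨(⟨P, mem_nonZeroDivisors_of_ne_zero hP0⟩, ⟨w, mem_nonZeroDivisors_of_ne_zero hw0⟩),
      mem_primePairs.mpr ⟨Subtype.ext hw.symm, hP1⟩, rfl⟩
  · intro p hp
    rfl

end IdealFunction

/-! ### The convolution identity for multiplicative functions -/

namespace IdealFunction

open GeneralDirichlet UniqueFactorizationMonoid Filter Topology

variable {K : Type*} [Field K] [NumberField K]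

/-- The coefficients `g(P) log 𝒩(P)`, supported on the prime ideals. -/
noncomputable def primeCoeff (g : (Ideal (𝓞 K))⁰ → ℂ) (u : (Ideal (𝓞 K))⁰) : ℂ :=
  g u * primeLog u

/-- The difference between `g log 𝒩` and the convolution of `primeCoeff g` with `g`. -/
noncomputable def errorCoeff (g : (Ideal (𝓞 K))⁰ → ℂ) (u : (Ideal (𝓞 K))⁰) : ℂ :=
  g u * logNorm u - conv (primeCoeff g) g u

theorem isCoprime_of_not_dvd {P w : (Ideal (𝓞 K))⁰} (hP : (P : Ideal (𝓞 K)).IsPrime)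
    (h : ¬ P ∣ w) : IsCoprime (P : Ideal (𝓞 K)) (w : Ideal (𝓞 K)) := by
  have hmax := hP.isMaximal (coe_ne_bot P)
  rw [Ideal.isCoprime_iff_sup_eq]
  refine hmax.out.2 _ (lt_of_le_of_ne le_sup_left fun h1 => h ?_)
  have h2 : (w : Ideal (𝓞 K)) ≤ P := by
    rw [h1]
    exact le_sup_right
  obtain ⟨x, hx⟩ := Ideal.dvd_iff_le.mpr h2
  have hx0 : x ≠ 0 := by
    rintro rfl
    exact coe_ne_bot w (by rw [hx, mul_zero]; rfl)
  exact ⟨⟨x, mem_nonZeroDivisors_of_ne_zero hx0⟩, Subtype.ext hx⟩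

/-- By multiplicativity, primes that divide `u` exactly once do not contribute to
`errorCoeff g u`. -/
theorem norm_errorCoeff_le {g : (Ideal (𝓞 K))⁰ → ℂ} (hg : IsMultiplicative g)
    (hg1 : ∀ u, ‖g u‖ ≤ 1) (u : (Ideal (𝓞 K))⁰) :
    ‖errorCoeff g u‖ ≤ ∑ p ∈ primePairs u, 3 * logNorm p.1 * ((primeExponent p.1 u : ℝ) - 1) := by
  classical
  have h1 : conv (primeCoeff g) g u = ∑ p ∈ primePairs u, g p.1 * logNorm p.1 * g p.2 := by
    rw [primePairs, Finset.sum_filter, conv]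
    refine Finset.sum_congr rfl fun p _ => ?_
    rw [primeCoeff, primeLog]
    split_ifs <;> simp
  have h2 : (logNorm u : ℂ) = ∑ p ∈ primePairs u, (primeExponent p.1 u : ℂ) * logNorm p.1 := by
    rw [logNorm_eq_sum]
    push_cast
    rfl
  rw [errorCoeff, h1, h2, Finset.mul_sum, ← Finset.sum_sub_distrib]
  refine norm_sum_le_of_le _ fun p hp => ?_
  obtain ⟨hpu, hP⟩ := mem_primePairs.mp hp
  have hℓ := logNorm_nonneg p.1
  have e1 : g u * ((primeExponent p.1 u : ℂ) * logNorm p.1) - g p.1 * logNorm p.1 * g p.2 =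
      logNorm p.1 * (primeExponent p.1 u * g u - g p.1 * g p.2) := by ring
  rw [e1, norm_mul, Complex.norm_real, Real.norm_of_nonneg hℓ]
  have hv : 1 ≤ primeExponent p.1 u :=
    (pow_dvd_iff hP 1).mp (by rw [pow_one]; exact ⟨p.2, hpu.symm⟩)
  rcases hv.eq_or_lt with hv1 | hv2
  · have hnd : ¬ p.1 ∣ p.2 := by
      rintro ⟨w, hw⟩
      have : p.1 ^ 2 ∣ u := ⟨w, by rw [← hpu, hw, sq, mul_assoc]⟩
      have := (pow_dvd_iff hP 2).mp this
      omega
    have hmul := hg p.1 p.2 (isCoprime_of_not_dvd hP hnd)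
    rw [hpu] at hmul
    rw [← hv1, hmul]
    simp
  · have hv' : (2 : ℝ) ≤ primeExponent p.1 u := by exact_mod_cast hv2
    have n1 : ‖(primeExponent p.1 u : ℂ) * g u - g p.1 * g p.2‖ ≤ primeExponent p.1 u + 1 := by
      refine (norm_sub_le _ _).trans (add_le_add ?_ ?_)
      · rw [norm_mul, Complex.norm_natCast]
        exact mul_le_of_le_one_right (by positivity) (hg1 u)
      · rw [norm_mul]
        exact mul_le_one₀ (hg1 _) (norm_nonneg _) (hg1 _)
    calc _ ≤ logNorm p.1 * (primeExponent p.1 u + 1) := by gcongr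
      _ ≤ logNorm p.1 * (3 * ((primeExponent p.1 u : ℝ) - 1)) := by
          gcongr
          linarith
      _ = _ := by ring

theorem log_two_le_logNorm {P : (Ideal (𝓞 K))⁰} (hP : (P : Ideal (𝓞 K)).IsPrime) :
    Real.log 2 ≤ logNorm P := by
  have h1 : norm P ≠ 1 := fun h => hP.ne_top (Ideal.absNorm_eq_one_iff.mp h)
  have h2 := one_le_norm P
  refine Real.log_le_log (by norm_num) ?_
  exact_mod_cast (by omega : 2 ≤ norm P)

theorem logNorm_le_of_dvd {w u : (Ideal (𝓞 K))⁰} (h : w ∣ u) : logNorm w ≤ logNorm u := by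
  obtain ⟨x, rfl⟩ := h
  rw [logNorm_mul]
  linarith [logNorm_nonneg x]

open Classical in
theorem card_dvd_le (w : (Ideal (𝓞 K))⁰) (y : ℝ) :
    (((finite_logNorm_le y).toFinset.filter fun u => w ∣ u).card : ℝ) ≤
      idealCount K (y - logNorm w) := by
  rw [idealCount, partialSum, Finset.sum_const, nsmul_eq_mul, mul_one, Nat.cast_le]
  refine (Finset.card_le_card (t := (finite_logNorm_le (y - logNorm w)).toFinset.image (w * ·))
    fun u hu => ?_).trans Finset.card_image_le
  simp only [Finset.mem_filter, Set.Finite.mem_toFinset, Set.mem_ofPred_eq] at hu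
  obtain ⟨h1, x, rfl⟩ := hu
  refine Finset.mem_image.mpr ⟨x, ?_, rfl⟩
  simp only [Set.Finite.mem_toFinset, Set.mem_ofPred_eq]
  rw [logNorm_mul] at h1
  linarith

open Classical in
theorem primeExponent_sub_one_le {P u : (Ideal (𝓞 K))⁰} (hP : (P : Ideal (𝓞 K)).IsPrime) {J : ℕ}
    (hJ : primeExponent P u < J) :
    (primeExponent P u : ℝ) - 1 ≤ ∑ j ∈ Finset.Ico 2 J, if P ^ j ∣ u then (1 : ℝ) else 0 := by
  have h1 : (Finset.Ico 2 (primeExponent P u + 1)) ⊆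
      (Finset.Ico 2 J).filter fun j => P ^ j ∣ u := by
    intro j hj
    rw [Finset.mem_Ico] at hj
    rw [Finset.mem_filter, Finset.mem_Ico, pow_dvd_iff hP]
    omega
  have h2 := Finset.card_le_card h1
  rw [Nat.card_Ico] at h2
  rw [← Finset.sum_filter, Finset.sum_const, nsmul_eq_mul, mul_one]
  have h3 : primeExponent P u ≤ ((Finset.Ico 2 J).filter fun j => P ^ j ∣ u).card + 1 := by omega
  have h4 : (primeExponent P u : ℝ) ≤ ((Finset.Ico 2 J).filter fun j => P ^ j ∣ u).card + 1 := by
    exact_mod_cast h3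
  linarith

/-- The partial sums of `errorCoeff` are `O(e^y)`: they are dominated by a sum over the ideals
divisible by `P ^ j` with `j ≥ 2`, and `∑ log 𝒩(P) / 𝒩(P)²` converges. -/
theorem partialSum_errorCoeff_le {g : (Ideal (𝓞 K))⁰ → ℂ} (hg : IsMultiplicative g)
    (hg1 : ∀ u, ‖g u‖ ≤ 1) {B : ℝ} (hB : 0 ≤ B) (hcount : ∀ u, idealCount K u ≤ B * Real.exp u)
    (y : ℝ) :
    partialSum finite_logNorm_le (fun u => ‖errorCoeff g u‖) y ≤ 36 * B ^ 2 * Real.exp y := by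
  classical
  set U : Finset (Ideal (𝓞 K))⁰ := (finite_logNorm_le y).toFinset with hU
  set T : Finset (Ideal (𝓞 K))⁰ :=
    U.filter fun P : (Ideal (𝓞 K))⁰ => (P : Ideal (𝓞 K)).IsPrime with hT
  -- As `log 𝒩(P) ≥ log 2`, every exponent `j` with `log 𝒩(P ^ j) ≤ y` is less than `J`.
  set J : ℕ := ⌊y / Real.log 2⌋₊ + 1 with hJ
  have hlog2 : 0 < Real.log 2 := Real.log_pos one_lt_two
  set f : (Ideal (𝓞 K))⁰ → (Ideal (𝓞 K))⁰ → ℝ := fun u P =>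
    3 * logNorm P * ∑ j ∈ Finset.Ico 2 J, if P ^ j ∣ u then (1 : ℝ) else 0 with hf
  have hf0 : ∀ u P, 0 ≤ f u P := fun u P => mul_nonneg
    (mul_nonneg (by norm_num) (logNorm_nonneg P))
    (Finset.sum_nonneg fun j _ => by split_ifs <;> norm_num)
  have hpointwise : ∀ u ∈ U, ‖errorCoeff g u‖ ≤ ∑ P ∈ T, f u P := by
    intro u hu
    have huy : logNorm u ≤ y := by simpa [hU] using hu
    refine (norm_errorCoeff_le hg hg1 u).trans ?_
    calc _ ≤ ∑ p ∈ primePairs u, f u p.1 := by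
          refine Finset.sum_le_sum fun p hp => ?_
          obtain ⟨hpu, hP⟩ := mem_primePairs.mp hp
          refine mul_le_mul_of_nonneg_left (primeExponent_sub_one_le hP ?_)
            (mul_nonneg (by norm_num) (logNorm_nonneg _))
          refine Nat.lt_succ_of_le (Nat.le_floor ?_)
          rw [le_div_iff₀ hlog2]
          have h1 := logNorm_le_of_dvd ((pow_dvd_iff hP _).mpr le_rfl : p.1 ^ _ ∣ u)
          rw [logNorm_pow] at h1
          calc _ ≤ (primeExponent p.1 u : ℝ) * logNorm p.1 := by
                gcongr
                exact log_two_le_logNorm hP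
            _ ≤ y := h1.trans huy
      _ = ∑ P ∈ (primePairs u).image Prod.fst, f u P := by
          rw [Finset.sum_image]
          intro p hp q hq h
          obtain ⟨h1, -⟩ := mem_primePairs.mp hp
          obtain ⟨h2, -⟩ := mem_primePairs.mp hq
          refine Prod.ext h ?_
          rw [← h2, h] at h1
          exact mul_left_cancel h1
      _ ≤ _ := by
          refine Finset.sum_le_sum_of_subset_of_nonneg (fun P hP => ?_) fun P _ _ => hf0 u P
          obtain ⟨p, hp, rfl⟩ := Finset.mem_image.mp hP
          obtain ⟨hpu, hP⟩ := mem_primePairs.mp hp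
          refine Finset.mem_filter.mpr ⟨?_, hP⟩
          have := logNorm_le_of_dvd (⟨p.2, hpu.symm⟩ : p.1 ∣ u)
          simp only [hU, Set.Finite.mem_toFinset, Set.mem_ofPred_eq]
          linarith
  have hprime : ∀ P ∈ T, ∑ u ∈ U, f u P ≤
      12 * B * Real.exp y * (1 * Real.exp (-(3 / 2 * logNorm P))) := by
    intro P hP
    have hP' : (P : Ideal (𝓞 K)).IsPrime := (Finset.mem_filter.mp hP).2
    have hℓ := logNorm_nonneg P
    set q := Real.exp (-logNorm P) with hq
    have hq0 : 0 ≤ q := Real.exp_nonneg _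
    have hq1 : q ≤ 1 / 2 := by
      have h1 : q ≤ Real.exp (-Real.log 2) :=
        Real.exp_le_exp.mpr (neg_le_neg (log_two_le_logNorm hP'))
      rwa [Real.exp_neg, Real.exp_log two_pos, ← one_div] at h1
    calc ∑ u ∈ U, f u P
        = 3 * logNorm P * ∑ j ∈ Finset.Ico 2 J, ((U.filter fun u => P ^ j ∣ u).card : ℝ) := by
          simp only [hf]
          rw [← Finset.mul_sum, Finset.sum_comm]
          congr 1
          refine Finset.sum_congr rfl fun j _ => ?_
          rw [← Finset.sum_filter, Finset.sum_const, nsmul_eq_mul, mul_one]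
      _ ≤ 3 * logNorm P * ∑ j ∈ Finset.Ico 2 J, B * Real.exp y * q ^ j := by
          gcongr with j hj
          refine (card_dvd_le (P ^ j) y).trans ((hcount _).trans_eq ?_)
          rw [hq, ← Real.exp_nat_mul, mul_assoc, ← Real.exp_add, logNorm_pow]
          ring_nf
      _ ≤ 3 * logNorm P * (B * Real.exp y * (2 * q ^ 2)) := by
          rw [← Finset.mul_sum]
          gcongr
          refine (geom_sum_Ico_le_of_lt_one hq0 (by linarith)).trans ?_
          rw [div_le_iff₀ (by linarith)]
          nlinarith [sq_nonneg q]
      _ = 6 * B * Real.exp y * (logNorm P * q ^ 2) := by ring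
      _ ≤ 6 * B * Real.exp y * (2 * Real.exp (-(3 / 2 * logNorm P))) := by
          refine mul_le_mul_of_nonneg_left ?_ (by positivity)
          -- `log 𝒩(P) / 𝒩(P)²` is at most `2 𝒩(P)^{-3/2}`, a term of a convergent series.
          have h1 : logNorm P ≤ 2 * Real.exp (logNorm P / 2) := by
            have := Real.add_one_le_exp (logNorm P / 2)
            linarith
          refine (mul_le_mul_of_nonneg_right h1 (sq_nonneg q)).trans_eq ?_
          rw [hq, ← Real.exp_nat_mul, mul_assoc, ← Real.exp_add]
          push_cast
          ring_nf
      _ = _ := by ring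
  have hZ := summable_of_partialSum_le (finite_logNorm_le (K := K)) logNorm_nonneg
    (a := fun _ => (1 : ℝ)) (fun _ => zero_le_one) (B := B) (ρ := 1)
    (fun u _ => by rw [one_mul]; exact hcount u) zero_le_one (σ := 3 / 2) (by norm_num)
  calc partialSum finite_logNorm_le (fun u => ‖errorCoeff g u‖) y
      ≤ ∑ u ∈ U, ∑ P ∈ T, f u P := Finset.sum_le_sum hpointwise
    _ = ∑ P ∈ T, ∑ u ∈ U, f u P := Finset.sum_comm
    _ ≤ ∑ P ∈ T, 12 * B * Real.exp y * (1 * Real.exp (-(3 / 2 * logNorm P))) :=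
        Finset.sum_le_sum hprime
    _ = 12 * B * Real.exp y * ∑ P ∈ T, 1 * Real.exp (-(3 / 2 * logNorm P)) :=
        (Finset.mul_sum _ _ _).symm
    _ ≤ 12 * B * Real.exp y * (B * (3 / 2) / (3 / 2 - 1)) := by
        gcongr
        exact (hZ.1.sum_le_tsum _ fun _ _ => by positivity).trans hZ.2
    _ = _ := by ring

/-- A bounded multiplicative function on ideals satisfies the hypotheses of the Tauberian
theorem. -/
theorem exists_logConvolution {g : (Ideal (𝓞 K))⁰ → ℂ} (hg : IsMultiplicative g)
    (hg1 : ∀ u, ‖g u‖ ≤ 1) :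
    ∃ B : ℝ, LogConvolution logNorm g (primeCoeff g) (errorCoeff g) B := by
  obtain ⟨B₀, hB₀, hcount⟩ := exists_idealCount_le K
  set B₁ := Module.finrank ℤ (𝓞 K) * Real.log 4 with hB₁
  set B₂ := 36 * B₀ ^ 2 with hB₂
  set B := max B₀ (max B₁ B₂) with hB
  have hb : ∀ u, ‖primeCoeff g u‖ ≤ primeLog u := by
    intro u
    rw [primeCoeff, norm_mul, Complex.norm_real, Real.norm_of_nonneg (primeLog_nonneg u)]
    exact mul_le_of_le_one_left (primeLog_nonneg u) (hg1 u)
  have bcount : ∀ u : ℝ, 0 ≤ u → partialSum (finite_logNorm_le (K := K)) (fun _ => (1 : ℝ)) u ≤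
      B * Real.exp u := fun u _ => (hcount u).trans (by gcongr; exact le_max_left _ _)
  have bb : ∀ u : ℝ, 0 ≤ u → partialSum finite_logNorm_le (fun i => ‖primeCoeff g i‖) u ≤
      B * Real.exp u := fun u _ =>
    (partialSum_le_partialSum _ u fun i _ => hb i).trans ((partialSum_primeLog_le u).trans (by
      gcongr
      exact (le_max_left _ _).trans (le_max_right _ _)))
  have be : ∀ u : ℝ, 0 ≤ u → partialSum finite_logNorm_le (fun i => ‖errorCoeff g i‖) u ≤
      B * Real.exp u := fun u _ =>
    (partialSum_errorCoeff_le hg hg1 hB₀ hcount u).trans (by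
      gcongr
      exact (le_max_right _ _).trans (le_max_right _ _))
  have bg : ∀ u : ℝ, 0 ≤ u → partialSum finite_logNorm_le (fun i => ‖g i‖) u ≤
      B * Real.exp (1 * u) := fun u hu => by
    rw [one_mul]
    exact (partialSum_le_partialSum _ u fun i _ => hg1 i).trans (bcount u hu)
  refine ⟨B, finite_logNorm_le, logNorm_nonneg, hg1, bcount, bb, be, exists_tendsto_idealCount K,
    fun s hs => ?_, fun u => ?_⟩
  · have sg := summable_norm finite_logNorm_le logNorm_nonneg bg zero_le_one hs
    have sb := summable_norm finite_logNorm_le logNorm_nonneg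
      (fun u hu => by simpa using bb u hu) (zero_le_one' ℝ) hs
    have se := (summable_norm finite_logNorm_le logNorm_nonneg
      (fun u hu => by simpa using be u hu) (zero_le_one' ℝ) hs).of_norm
    have h1 := (hasSum_conv sb sg).add se.hasSum
    rw [mul_comm (dseries logNorm g s)]
    refine Eq.trans (tsum_congr fun u => ?_) h1.tsum_eq
    rw [errorCoeff]
    ring
  · rw [← partialSum_conv, partialSum, partialSum, partialSum, ← Finset.sum_add_distrib]
    refine Finset.sum_congr rfl fun i _ => ?_
    rw [errorCoeff]
    ring

end IdealFunction

/-! ### The two sides of the equivalence in logarithmic variables -/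

namespace IdealFunction

open GeneralDirichlet GeneralDirichlet.LogConvolution Filter Topology

variable {K : Type*} [Field K] [NumberField K]

/-- In the variable `u = log x`, the asymptotic formula for the summatory function says that the
normalized partial sums approach `C L(u) / (1 + iα)`. -/
theorem isLittleO_iff_tendsto_normalized
    (g : (Ideal (𝓞 K))⁰ → ℂ) (C : ℂ) (α : ℝ) (L : ℝ → ℂ) :
    ((fun x : ℝ => IdealFunction.summatory g x -
        (x : ℂ) ^ (1 + Complex.I * α) / (1 + Complex.I * α) * C * L (Real.log x))
      =o[atTop] (fun x : ℝ => x)) ↔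
    Tendsto (fun y => normalized finite_logNorm_le g α y - mainCoeff C α L y) atTop (𝓝 0) := by
  set F : ℝ → ℂ := fun y => normalized finite_logNorm_le g α y - mainCoeff C α L y with hF
  have key : ∀ x : ℝ, 0 < x → IdealFunction.summatory g x -
      (x : ℂ) ^ (1 + Complex.I * α) / (1 + Complex.I * α) * C * L (Real.log x) =
      (x : ℂ) ^ (1 + Complex.I * α) * F (Real.log x) := by
    intro x hx
    have hx' : (x : ℂ) ≠ 0 := Complex.ofReal_ne_zero.mpr hx.ne'
    have e1 : (x : ℂ) ^ (1 + Complex.I * α) =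
        Complex.exp ((1 + Complex.I * α) * (Real.log x : ℝ)) := by
      rw [Complex.cpow_def_of_ne_zero hx', ← Complex.ofReal_log hx.le, mul_comm]
    rw [summatory_eq g hx, hF, e1]
    simp only [normalized, mainCoeff]
    rw [mul_sub, ← mul_assoc, ← Complex.exp_add, add_neg_cancel, Complex.exp_zero, one_mul]
    ring
  have hnorm : ∀ x : ℝ, 0 < x → ‖(x : ℂ) ^ (1 + Complex.I * α)‖ = x := by
    intro x hx
    rw [Complex.norm_cpow_eq_rpow_re_of_pos hx]
    simp
  have hT : Tendsto F atTop (𝓝 0) ↔ Tendsto (fun x => F (Real.log x)) atTop (𝓝 0) := by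
    refine ⟨fun h => h.comp Real.tendsto_log_atTop, fun h => ?_⟩
    simpa [Function.comp_def] using h.comp Real.tendsto_exp_atTop
  rw [hT, ← Asymptotics.isLittleO_one_iff ℝ, Asymptotics.isLittleO_iff, Asymptotics.isLittleO_iff]
  refine forall₂_congr fun c _ => eventually_congr ?_
  filter_upwards [eventually_gt_atTop 0] with x hx
  rw [key x hx, norm_mul, hnorm x hx, Real.norm_of_nonneg hx.le, norm_one, mul_one, mul_comm c,
    mul_le_mul_iff_right₀ hx]

/-- The substitution `y = 1 / (σ - 1)` turns the limit `σ → 1⁺` into the limit `y → ∞`. -/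
theorem forall_exists_iff_seriesAsymptotic
    (g : (Ideal (𝓞 K))⁰ → ℂ) (C : ℂ) (α : ℝ) (L : ℝ → ℂ) :
    (∀ M : ℝ, ∀ ε > 0, ∃ δ > 0, ∀ σ : ℝ, 1 < σ → σ < 1 + δ → ∀ τ : ℝ, -M ≤ τ → τ ≤ M →
      ‖IdealFunction.dirichletSeries g (σ + Complex.I * τ) -
        C / ((σ + Complex.I * τ) - (1 + Complex.I * α)) * L (1 / (σ - 1))‖
        ≤ ε * (1 / (σ - 1))) ↔ SeriesAsymptotic logNorm g C α L := by
  refine forall₃_congr fun M ε _ => ⟨?_, ?_⟩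
  · rintro ⟨δ, hδ, h⟩
    filter_upwards [eventually_gt_atTop (1 / δ)] with y hy τ hτ
    have hy0 : 0 < y := (one_div_pos.mpr hδ).trans hy
    have h1 := h (1 + 1 / y) (by have := one_div_pos.mpr hy0; linarith)
      (by have := (one_div_lt hδ hy0).mp hy; linarith) τ (abs_le.mp hτ).1 (abs_le.mp hτ).2
    rwa [add_sub_cancel_left, one_div_one_div, dirichletSeries_eq] at h1
  · intro h
    obtain ⟨y₀, hy₀⟩ := eventually_atTop.mp h
    refine ⟨1 / max y₀ 1, by positivity, fun σ h1 h2 τ hτ1 hτ2 => ?_⟩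
    have hσ : 0 < σ - 1 := sub_pos.mpr h1
    have hm : (0 : ℝ) < max y₀ 1 := by positivity
    have hy : max y₀ 1 ≤ 1 / (σ - 1) := (le_one_div hm hσ).mpr (by linarith)
    have h3 := hy₀ (1 / (σ - 1)) ((le_max_left _ _).trans hy) τ (abs_le.mpr ⟨hτ1, hτ2⟩)
    have e : point (1 / (σ - 1)) τ = σ + Complex.I * τ := by
      rw [point, one_div_one_div, add_sub_cancel]
    rwa [e, ← dirichletSeries_eq] at h3

end IdealFunction

theorem theoremC21 (K : Type*) [Field K] [NumberField K]
    (g : (Ideal (𝓞 K))⁰ → ℂ) (hg : IdealFunction.IsMultiplicative g) (hg1 : ∀ u, ‖g u‖ ≤ 1)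
    (C : ℂ) (α : ℝ) (L : ℝ → ℂ) (hL : SlowlyOscillating L) (hL1 : ∀ x, ‖L x‖ = 1) :
    ((fun x : ℝ => IdealFunction.summatory g x -
        (x : ℂ) ^ (1 + Complex.I * α) / (1 + Complex.I * α) * C * L (Real.log x))
      =o[Filter.atTop] (fun x : ℝ => x)) ↔
    (∀ M : ℝ, ∀ ε > 0, ∃ δ > 0, ∀ σ : ℝ, 1 < σ → σ < 1 + δ → ∀ τ : ℝ, -M ≤ τ → τ ≤ M →
      ‖IdealFunction.dirichletSeries g (σ + Complex.I * τ) -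
        C / ((σ + Complex.I * τ) - (1 + Complex.I * α)) * L (1 / (σ - 1))‖
        ≤ ε * (1 / (σ - 1))) := by
  obtain ⟨B, h⟩ := IdealFunction.exists_logConvolution hg hg1
  rw [IdealFunction.isLittleO_iff_tendsto_normalized,
    IdealFunction.forall_exists_iff_seriesAsymptotic]
  exact ⟨h.seriesAsymptotic_of_tendsto hL hL1, h.tendsto_normalized_sub hL hL1⟩
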